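/- Let $(\mathbb X,\mathcal X)$ be a measurable space with a $\sigma$-finite measure $\lambda$. For $t>0$ let $\eta_t$ be a Poisson process on $\mathbb X$ with intensity measure $t\lambda$, that is, a random integer-valued ($\infty$ allowed) $\sigma$-finite measure such that $\eta_t(B)$ is Poisson distributed with mean $t\lambda(B)$ for all measurable $B$ (almost surely infinite if $\lambda(B)=\infty$), with independent values on pairwise disjoint sets. All $\eta_t$ are defined on one probability space. For an integer-valued $\sigma$-finite measure $\mu$ on $\mathbb X$ and $m\in\mathbb N$ the $m$-th factorial measure on $\mathbb X^m$ is $$\mu^{(m)}(B)=\int\cdots\int \mathbf 1_B(x_1,\dots,x_m)\Big(\mu-\sum_{j=1}^{m-1}\delta_{x_j}\Big)(dx_m)\cdots(\mu-\delta_{x_1})(dx_2)\,\mu(dx_1).$$ Let $\ell\ge1$ and, for $i=1,\dots,\ell$, let $m_i\ge1$, let $f^{(i)}:\mathbb X^{m_i}\to\mathbb R$ be measurable, symmetric and $\lambda^{m_i}$-integrable, and let $g_i:(0,\infty)\to\mathbb R$ satisfy $g_i(t)\ne0$ for all sufficiently large $t$. Put $$F^{(i)}_t=g_i(t)\int f^{(i)}\,d\eta_t^{(m_i)},\qquad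 f^{(i)}_1(x)=m_i\int f^{(i)}(x,y_1,\dots,y_{m_i-1})\,\lambda^{m_i-1}(d(y_1,\dots,y_{m_i-1})).$$ For $n_1,\dots,n_\ell\in\mathbb N$ and $n=n_1+\dots+n_\ell$, divide $\{1,\dots,n\}$ into consecutive rows $J_1,\dots,J_\ell$ with $|J_i|=n_i$. Let $\Pi(n_1,\dots,n_\ell)$ be the set of all partitions $\sigma$ of $\{1,\dots,n\}$ such that every block of $\sigma$ meets every row in at most one element, and let $\Pi_{=2}(n_1,\dots,n_\ell)$ be the set of those $\sigma\in\Pi(n_1,\dots,n_\ell)$ all of whose blocks have exactly two elements. For functions $h_i:\mathbb X^{n_i}\to\mathbb R$ let $(\otimes_{i=1}^\ell h_i)(x_1,\dots,x_n)=\prod_{i=1}^\ell h_i\big((x_j)_{j\in J_i}\big)$, and for $h:\mathbb X^n\to\mathbb R$ let $h_\sigma:\mathbb X^{|\sigma|}\to\mathbb R$ be the function obtained from $h$ by identifying the arguments whose indices lie in the same block of $\sigma$, where $|\sigma|$ is the number of blocks. The joint cumulant of random variables $Y_1,\dots,Y_\ell$ is $$\gamma(Y_1,\dots,Y_\ell)=(-\mathbf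 i)^\ell\,\frac{\partial^\ell}{\partial z_1\cdots\partial z_\ell}\log\mathbb E\exp\big[\mathbf i(z_1Y_1+\dots+z_\ell Y_\ell)\big]\Big|_{z_1=\dots=z_\ell=0}.$$ Assume that $$\int(\otimes_{i=1}^\ell|f^{(i)}|)_\sigma\,d\lambda^{|\sigma|}<\infty\qquad\text{for all }\sigma\in\Pi(m_1,\dots,m_\ell).$$ Then, for every $t>0$ and every $i$, $f^{(i)}$ is almost surely $\eta_t^{(m_i)}$-integrable, and the random variables $F_t^{(i)}$ and $\prod_{i=1}^\ell(F_t^{(i)}-\mathbb EF_t^{(i)})$ are integrable; if no $f^{(i)}$ vanishes $\lambda^{m_i}$-almost everywhere, then $\prod_{i\in I}(F_t^{(i)}-\mathbb EF_t^{(i)})$ is integrable for every $I\subset\{1,\dots,\ell\}$. Here $f_1^{(i)}(x)$ is read as $0$ on the $\lambda$-null set of points $x$ at which its defining integral does not exist; the functions $(\otimes_{i=1}^\ell f_1^{(i)})_\sigma$, $\sigma\in\Pi_{=2}(1,\dots,1)$, are integrable, and $$\lim_{t\to\infty}\mathbb E\prod_{i=1}^\ell\frac{F_t^{(i)}-\mathbb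 EF_t^{(i)}}{g_i(t)\,t^{m_i-1/2}}=\sum_{\sigma\in\Pi_{=2}(1,\dots,1)}\int(\otimes_{i=1}^\ell f_1^{(i)})_\sigma\,d\lambda^{|\sigma|}.$$ If $\ell\ge3$, then moreover $$\lim_{t\to\infty}\frac{\gamma\big(F_t^{(1)}-\mathbb EF_t^{(1)},\dots,F_t^{(\ell)}-\mathbb EF_t^{(\ell)}\big)}{\prod_{i=1}^\ell g_i(t)\,t^{m_i-1/2}}=0.$$ (If some $f^{(i)}$ vanishes $\lambda^{m_i}$-almost everywhere, then $F_t^{(i)}=0$ almost surely, the characteristic function does not depend on $z_i$, and the joint cumulant is understood to be $0$.) -/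

import Mathlib

open MeasureTheory ProbabilityTheory Filter Topology
open scoped ENNReal

/-! ### Poisson processes -/

section PointProcesses

variable {X Ω : Type*} [MeasurableSpace X] [MeasurableSpace Ω]

/-- `μ` is an integer-valued (the value `∞` being allowed) `σ`-finite measure. -/
def IsPointMeasure (μ : Measure X) : Prop :=
  SigmaFinite μ ∧ ∀ B, MeasurableSet B → μ B = ∞ ∨ ∃ n : ℕ, μ B = n

/-- `η` is a Poisson process with intensity measure `ν`: a random element in the space of
integer-valued `σ`-finite measures (with the `σ`-field generated by the evaluations `μ ↦ μ B`),
such that `η(B)` is Poisson distributed with mean `ν(B)` for every measurable `B`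
(almost surely infinite if `ν(B) = ∞`), and such that `η(B₁), …, η(Bₖ)` are independent whenever
the measurable sets `B₁, …, Bₖ` are pairwise disjoint. -/
structure IsPoissonProcess (P : Measure Ω) (η : Ω → Measure X) (ν : Measure X) : Prop where
  measurable : Measurable η
  isPointMeasure : ∀ ω, IsPointMeasure (η ω)
  law_eq_poisson : ∀ B, MeasurableSet B → ν B ≠ ∞ →
    P.map (fun ω => η ω B) =
      (poissonMeasure (ν B).toNNReal).map (fun n : ℕ => (n : ℝ≥0∞))
  ae_eq_top : ∀ B, MeasurableSet B → ν B = ∞ → ∀ᵐ ω ∂P, η ω B = ∞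
  indep : ∀ (k : ℕ) (B : Fin k → Set X), (∀ i, MeasurableSet (B i)) →
    Pairwise (fun i j => Disjoint (B i) (B j)) → iIndepFun (fun i ω => η ω (B i)) P

/-! ### Factorial measures and U-statistics -/

/-- The value
`∫ ∫ 1_B(x₁, …, xₘ, y) (μ - δ_{x₁} - ⋯ - δ_{xₘ})(dy) ν(d(x₁, …, xₘ))`.
The subtrahend in the inner integral is finite, so that the difference always makes sense. -/
noncomputable def factorialStepValue (μ : Measure X) {m : ℕ} (ν : Measure (Fin m → X))
    (B : Set (Fin (m + 1) → X)) : ℝ≥0∞ :=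
  ∫⁻ x, (μ {y | (Fin.snoc x y : Fin (m + 1) → X) ∈ B} -
    ∑ j : Fin m, B.indicator 1 (Fin.snoc x (x j) : Fin (m + 1) → X)) ∂ν

open Classical in
/-- The unique measure on `X ^ (m + 1)` with values `factorialStepValue μ ν` on measurable sets. -/
noncomputable def factorialStep (μ : Measure X) {m : ℕ} (ν : Measure (Fin m → X)) :
    Measure (Fin (m + 1) → X) :=
  if h : ∃ ρ : Measure (Fin (m + 1) → X),
      ∀ B, MeasurableSet B → ρ B = factorialStepValue μ ν B
    then h.choose else 0

/-- The `m`-th factorial measure `μ^{(m)}` of an integer-valued `σ`-finite measure `μ`, that is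
`μ^{(m)}(B) = ∫ ⋯ ∫ 1_B(x₁, …, xₘ) (μ - δ_{x₁} - ⋯ - δ_{xₘ₋₁})(dxₘ) ⋯ (μ - δ_{x₁})(dx₂) μ(dx₁)`.
If `μ` is a countable sum of Dirac measures, this is the sum of the Dirac measures at the
`m`-tuples of points of `μ` with pairwise distinct indices. -/
noncomputable def factorialMeasure (μ : Measure X) : (m : ℕ) → Measure (Fin m → X)
  | 0 => Measure.dirac Fin.elim0
  | m + 1 => factorialStep μ (factorialMeasure μ m)

/-- The U-statistic `c ∫ f(x₁, …, xₘ) η^{(m)}(d(x₁, …, xₘ))`. -/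
noncomputable def uStat (c : ℝ) {m : ℕ} (f : (Fin m → X) → ℝ) (η : Ω → Measure X) (ω : Ω) : ℝ :=
  c * ∫ x, f x ∂(factorialMeasure (η ω) m)

/-- The centred random variable `Y - E Y`. -/
noncomputable def centred (P : Measure Ω) (Y : Ω → ℝ) (ω : Ω) : ℝ :=
  Y ω - ∫ ω', Y ω' ∂P

end PointProcesses

/-! ### Kernels and partitions -/

section Kernels

variable {X : Type*} [MeasurableSpace X]

/-- The space `L¹_s(lam ^ m)` of measurable, symmetric functions on `X ^ m` that are integrable
with respect to the product measure. -/
structure IsSymmL1 (lam : Measure X) {m : ℕ} (f : (Fin m → X) → ℝ) : Prop where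
  measurable : Measurable f
  symm : ∀ (π : Equiv.Perm (Fin m)) (x : Fin m → X), f (x ∘ π) = f x
  integrable : Integrable f (Measure.pi fun _ => lam)

/-- `fₙ(x₁, …, xₙ) = (m choose n) ∫ f(x₁, …, xₙ, y₁, …, yₘ₋ₙ) lam^{m-n}(d(y₁, …, yₘ₋ₙ))`
for `n ≤ m`. -/
noncomputable def projKernel (lam : Measure X) {m : ℕ} (f : (Fin m → X) → ℝ) (n : ℕ)
    (x : Fin n → X) : ℝ :=
  (m.choose n : ℝ) * ∫ y : Fin (m - n) → X,
    f (fun j => if h : (j : ℕ) < n then x ⟨j, h⟩ else y ⟨j - n, by omega⟩)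
    ∂(Measure.pi fun _ => lam)

end Kernels

section Partitions

variable {ℓ : ℕ}

/-- The index set `[n₁ + ⋯ + n_ℓ]`, written as the disjoint union of rows `J₁, …, J_ℓ`
of lengths `n₁, …, n_ℓ`; the index `⟨i, j⟩` is the `j`-th element of the row `Jᵢ`. -/
abbrev RowIndex (n : Fin ℓ → ℕ) : Type := Σ i : Fin ℓ, Fin (n i)

/-- The row `Jᵢ`. -/
def row (n : Fin ℓ → ℕ) (i : Fin ℓ) : Finset (RowIndex n) :=
  Finset.univ.filter fun a => a.1 = i

/-- Partitions of `[n₁ + ⋯ + n_ℓ]` into nonempty blocks. -/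
abbrev RowPartition (n : Fin ℓ → ℕ) : Type := Finpartition (Finset.univ : Finset (RowIndex n))

open Classical in
/-- The set `Π(n₁, …, n_ℓ)` of all partitions whose blocks meet every row in at most one
element. -/
noncomputable def nonflatPartitions (n : Fin ℓ → ℕ) : Finset (RowPartition n) :=
  Finset.univ.filter fun σ => ∀ i : Fin ℓ, ∀ b ∈ σ.parts, (row n i ∩ b).card ≤ 1

open Classical in
/-- The set `Π_{=2}(n₁, …, n_ℓ)` of all `σ ∈ Π(n₁, …, n_ℓ)` all of whose blocks have exactly
two elements. -/
noncomputable def pairPartitions (n : Fin ℓ → ℕ) : Finset (RowPartition n) :=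
  (nonflatPartitions n).filter fun σ => ∀ b ∈ σ.parts, b.card = 2

variable {X : Type*}

/-- The tensor product `f₁ ⊗ ⋯ ⊗ f_ℓ`. -/
def tensor {n : Fin ℓ → ℕ} (f : ∀ i, (Fin (n i) → X) → ℝ) (x : RowIndex n → X) : ℝ :=
  ∏ i, f i (fun j => x ⟨i, j⟩)

/-- The function `f_σ`, which arises from `f` by identifying the arguments that belong to the
same block of `σ`. It has one argument for each block of `σ`. -/
def identify {n : Fin ℓ → ℕ} (σ : RowPartition n) (f : (RowIndex n → X) → ℝ)
    (y : σ.parts → X) : ℝ :=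
  f fun a => y ⟨σ.part a, σ.part_mem.2 (Finset.mem_univ a)⟩

end Partitions

/-! ### Joint cumulants -/

section Cumulants

variable {ℓ : ℕ}

/-- The mixed partial derivative `∂^ℓ G / ∂z₁ ⋯ ∂z_ℓ`. -/
noncomputable def mixedPartial (G : (Fin ℓ → ℝ) → ℂ) : (Fin ℓ → ℝ) → ℂ :=
  (List.finRange ℓ).foldr (fun i H z => lineDeriv ℝ H z (Pi.single i 1)) G

/-- The joint cumulant
`(-𝐢)^ℓ ∂^ℓ / ∂z₁ ⋯ ∂z_ℓ log E exp(𝐢 (z₁ Y₁ + ⋯ + z_ℓ Y_ℓ))` at `z₁ = ⋯ = z_ℓ = 0`. -/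
noncomputable def jointCumulant {Ω : Type*} [MeasurableSpace Ω] (P : Measure Ω)
    (Y : Fin ℓ → Ω → ℝ) : ℂ :=
  (-Complex.I) ^ ℓ * mixedPartial (fun z : Fin ℓ → ℝ =>
    Complex.log (∫ ω, Complex.exp (Complex.I * ((∑ i, z i * Y i ω : ℝ) : ℂ)) ∂P)) 0

end Cumulants

/-!
# Mixed moments and cumulants of Poisson U-statistics

On a general measurable space the points of an integer-valued `σ`-finite measure need not exist, but
such a measure is a countable sum of measures with values in `{0, 1}`
(`IsPointMeasure.exists_eq_sum_zeroOne`). Products of zero-one measures are again zero-one measures,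
and a point that is random under such a measure behaves like a deterministic one. For this reason,
the factorial measures are sums of product measures over families of distinct indices
(`factorialMeasure_sum`), exactly as for sums of Dirac measures.

The values of a factorial measure on rectangles are polynomials in the masses of disjoint sets. For
a Poisson process, the independence of these masses and the factorial moments of the Poisson
distribution show that the expected factorial measure is a power of the intensity measure
(`IsPoissonSum.bind_facPi`). Sorting the indices that occur in several factors by coincidence turns
a product of factorial measures into a sum of factorial measures on diagonals (`pi_facPi`). Hence
the mixed moment `E ∏ᵢ ∫ fᵢ dη^(mᵢ)` is a sum over the partitions `σ` whose blocks meet every row in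
at most one element (`IsPoissonSum.integral_prod`). Centring removes the partitions in which all
elements of some row are singletons; this is inclusion and exclusion over the set of rows that are
replaced by their expectations (`IsPoissonSum.integral_prod_sub`). The integrability needed for the
subsets of rows follows from that for all rows if no kernel vanishes almost everywhere
(`integrable_rowProd_sub`).

For the intensity measure `t λ` the term of `σ` is proportional to `t ^ |σ|`. If no row consists of
singletons, then `2 |σ| ≤ 2 (m₁ + ⋯ + m_ℓ) - ℓ`, with equality exactly if `σ` arises by choosing one
element of each row and pairing the chosen elements (`two_mul_card_quotient_le`, `sum_leading`). By
symmetry, the choice of the elements produces the factors `mᵢ` of the projected kernels, and the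
limit of the normalized moments is the sum over all pairings (`tendsto_sum_rowProd`).

The joint cumulant is the function of the joint moments given by the recursion `cumulantOf`
(`jointCumulant_eq`): by the quotient rule, this recursion is stable under differentiation of the
logarithm of the characteristic function. The recursion is continuous in the moments and homogeneous
in each of the random variables. The limits of the moments are those of a centred Gaussian family,
that is, they satisfy Wick's recursion (`sum_matchings`), so that their cumulants of order at least
three vanish (`cumulantOf_pairMoment`).

If some kernel vanishes almost everywhere, the corresponding U-statistic vanishes almost surely, and
all limits are zero.
-/


/-! ### Zero-one measures -/

section ZeroOne

variable {α β ι X : Type*} [MeasurableSpace α] [MeasurableSpace β] [MeasurableSpace X]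

instance instIsZeroOneMeasure_zero : IsZeroOneMeasure (0 : Measure α) :=
  ⟨fun _ _ => Or.inl rfl⟩

theorem isZeroOneMeasure_of_isPiSystem {μ : Measure α} [IsProbabilityMeasure μ]
    {S : Set (Set α)} (hgen : ‹MeasurableSpace α› = .generateFrom S) (hpi : IsPiSystem S)
    (h : ∀ s ∈ S, μ s = 0 ∨ μ s = 1) : IsZeroOneMeasure μ := by
  refine ⟨fun s hs => ?_⟩
  induction s, hs using MeasurableSpace.induction_on_inter hgen hpi with
  | empty => simp
  | basic s hs => exact h s hs
  | compl s hsm ihs =>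
    rw [prob_compl_eq_one_sub hsm]
    rcases ihs with h | h <;> simp [h]
  | iUnion f hfd hfm ihf =>
    by_cases h0 : ∀ i, μ (f i) = 0
    · left; exact measure_iUnion_null h0
    · push Not at h0
      obtain ⟨i, hi⟩ := h0
      right
      refine le_antisymm prob_le_one ?_
      rw [← (ihf i).resolve_left hi]
      exact measure_mono (Set.subset_iUnion f i)

instance instIsZeroOneMeasure_pi [Fintype ι] (κ : ι → Measure α) [∀ i, IsZeroOneMeasure (κ i)] :
    IsZeroOneMeasure (Measure.pi κ) := by
  by_cases h : ∀ i, κ i Set.univ = 1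
  · have : ∀ i, IsProbabilityMeasure (κ i) := fun i => ⟨h i⟩
    refine isZeroOneMeasure_of_isPiSystem generateFrom_pi.symm isPiSystem_pi ?_
    rintro _ ⟨s, hs, rfl⟩
    rw [Measure.pi_pi]
    by_cases h0 : ∃ i, κ i (s i) = 0
    · obtain ⟨i, hi⟩ := h0
      left; exact Finset.prod_eq_zero (Finset.mem_univ i) hi
    · push Not at h0
      right
      exact Finset.prod_eq_one fun i _ => ((κ i).zero_one _).resolve_left (h0 i)
  · push Not at h
    obtain ⟨i, hi⟩ := h
    have : Measure.pi κ = 0 := by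
      rw [← Measure.measure_univ_eq_zero, Measure.pi_univ]
      exact Finset.prod_eq_zero (Finset.mem_univ i) (((κ i).zero_one _).resolve_right hi)
    rw [this]; infer_instance

/-- A finite measure with natural values is a finite sum of zero-one measures. -/
theorem exists_eq_sum_zeroOne_of_finite (n : ℕ) : ∀ (μ : Measure α), μ Set.univ = n →
    (∀ B, MeasurableSet B → ∃ k : ℕ, μ B = k) →
    ∃ κ : Fin n → Measure α, (∀ i, IsZeroOneMeasure (κ i)) ∧ μ = Measure.sum κ := by
  induction n using Nat.strong_induction_on with
  | _ n ih =>
    intro μ hn hμ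
    by_cases h : ∃ B, MeasurableSet B ∧ μ B ≠ 0 ∧ μ B ≠ n
    · -- a set of intermediate mass splits the measure into two parts of smaller mass
      obtain ⟨B, hB, hB0, hBn⟩ := h
      obtain ⟨k, hk⟩ := hμ B hB
      obtain ⟨l, hl⟩ := hμ Bᶜ hB.compl
      have hkl : k + l = n := by
        have := measure_add_measure_compl (μ := μ) hB
        rw [hk, hl, hn] at this
        exact_mod_cast this
      have hk0 : k ≠ 0 := by rintro rfl; simp [hk] at hB0
      have hkn : k ≠ n := by rintro rfl; exact hBn hk
      obtain ⟨κ₁, h₁, e₁⟩ := ih k (by omega) (μ.restrict B) (by simpa using hk)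
        (fun C hC => by rw [Measure.restrict_apply hC]; exact hμ _ (hC.inter hB))
      obtain ⟨κ₂, h₂, e₂⟩ := ih l (by omega) (μ.restrict Bᶜ) (by simpa using hl)
        (fun C hC => by rw [Measure.restrict_apply hC]; exact hμ _ (hC.inter hB.compl))
      subst hkl
      refine ⟨Fin.append κ₁ κ₂, fun i => ?_, ?_⟩
      · refine Fin.addCases (fun i => ?_) (fun i => ?_) i
        · rw [Fin.append_left]; exact h₁ i
        · rw [Fin.append_right]; exact h₂ i
      · rw [← Measure.restrict_add_restrict_compl hB (μ := μ), e₁, e₂]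
        ext s hs
        simp [Fin.sum_univ_add]
    · push Not at h
      rcases Nat.eq_zero_or_pos n with rfl | hpos
      · refine ⟨Fin.elim0, fun i => i.elim0, ?_⟩
        rw [Measure.sum_of_isEmpty]
        exact Measure.measure_univ_eq_zero.1 (by simpa using hn)
      · -- otherwise the normalized measure takes only the values zero and one
        have hn0 : (n : ℝ≥0∞) ≠ 0 := by exact_mod_cast hpos.ne'
        refine ⟨fun _ => (n : ℝ≥0∞)⁻¹ • μ, fun _ => ⟨fun s hs => ?_⟩, ?_⟩
        · rw [Measure.smul_apply, smul_eq_mul]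
          by_cases h0 : μ s = 0
          · left; simp [h0]
          · right; rw [h s hs h0]; exact ENNReal.inv_mul_cancel hn0 (by simp)
        · ext s hs
          simp only [Measure.sum_apply _ hs, tsum_fintype, Measure.smul_apply, smul_eq_mul,
            Finset.sum_const, Finset.card_univ, Fintype.card_fin, nsmul_eq_mul]
          rw [← mul_assoc, ENNReal.mul_inv_cancel hn0 (by simp), one_mul]

/-- An integer-valued `σ`-finite measure is a countable sum of zero-one measures. These play the
role of the Dirac measures at the points of the measure, which need not exist on a general
measurable space. -/
theorem IsPointMeasure.exists_eq_sum_zeroOne {μ : Measure α} (hμ : IsPointMeasure μ) :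
    ∃ κ : ℕ → Measure α, (∀ i, IsZeroOneMeasure (κ i)) ∧ μ = Measure.sum κ := by
  have := hμ.1
  have key : ∀ n, ∃ κ : ℕ → Measure α, (∀ i, IsZeroOneMeasure (κ i)) ∧
      μ.restrict (disjointed (spanningSets μ) n) = Measure.sum κ := by
    intro n
    set D := disjointed (spanningSets μ) n
    have hD : MeasurableSet D := .disjointed (fun i => measurableSet_spanningSets μ i) n
    have hfin : μ D ≠ ∞ := ((measure_mono (disjointed_subset _ _)).trans_lt
      (measure_spanningSets_lt_top μ n)).ne
    have hnat : ∀ B, MeasurableSet B → ∃ k : ℕ, μ.restrict D B = k := fun B hB => by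
      rw [Measure.restrict_apply hB]
      exact (hμ.2 _ (hB.inter hD)).resolve_left
        ((measure_mono Set.inter_subset_right).trans_lt hfin.lt_top).ne
    obtain ⟨N, hN⟩ := hnat Set.univ .univ
    obtain ⟨κ, h, e⟩ := exists_eq_sum_zeroOne_of_finite N _ hN hnat
    refine ⟨fun i => if hi : i < N then κ ⟨i, hi⟩ else 0, fun i => ?_, ?_⟩
    · dsimp only
      split_ifs
      · exact h _
      · infer_instance
    · rw [e]
      ext s hs
      simp only [Measure.sum_apply _ hs, tsum_fintype]
      rw [tsum_eq_sum (s := Finset.range N) (by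
        intro b hb
        rw [Finset.mem_range] at hb
        simp [hb]), Finset.sum_range]
      simp
  choose κ h e using key
  refine ⟨fun i => κ i.unpair.1 i.unpair.2, fun i => h _ _, ?_⟩
  have hsum : Measure.sum (fun n => μ.restrict (disjointed (spanningSets μ) n)) = μ := by
    rw [← Measure.restrict_iUnion (disjoint_disjointed _)
      (fun i => .disjointed (fun i => measurableSet_spanningSets μ i) i), iUnion_disjointed,
      iUnion_spanningSets, Measure.restrict_univ]
  conv_lhs => rw [← hsum]
  ext s hs
  simp only [e, Measure.sum_apply _ hs]
  rw [← ENNReal.tsum_prod, ← Nat.pairEquiv.symm.tsum_eq]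
  rfl

/-- Under a zero-one measure `K`, a random point behaves like a deterministic one: its image under
`φ` can be replaced by an independent copy. -/
theorem ae_indicator_eq_of_isZeroOneMeasure (K : Measure α) [IsZeroOneMeasure K]
    (κ : Measure β) [IsZeroOneMeasure κ] {φ : α → β}
    (hφ : Measure.QuasiMeasurePreserving φ K κ) {B : Set (α × β)} (hB : MeasurableSet B) :
    ∀ᵐ x ∂K, B.indicator (1 : α × β → ℝ≥0∞) (x, φ x) = κ {y | (x, y) ∈ B} := by
  rcases κ.zero_one Set.univ with h0 | h1
  · have : K = 0 := by
      rw [← Measure.measure_univ_eq_zero]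
      exact hφ.preimage_null h0
    simp [this]
  have : IsProbabilityMeasure κ := ⟨h1⟩
  induction B, hB using MeasurableSpace.induction_on_inter generateFrom_prod.symm isPiSystem_prod with
  | empty => simp
  | basic s hs =>
    obtain ⟨s, hs, t, ht, rfl⟩ := hs
    simp only [Set.mem_ofPred_eq] at hs ht
    have key : ∀ᵐ x ∂K, t.indicator (1 : β → ℝ≥0∞) (φ x) = κ t := by
      refine hφ.ae ?_ (p := fun y => t.indicator (1 : β → ℝ≥0∞) y = κ t)
      rcases κ.zero_one t with h | h
      · have : ∀ᵐ y ∂κ, y ∉ t := measure_eq_zero_iff_ae_notMem.1 h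
        filter_upwards [this] with y hy
        simp [hy, h]
      · have : ∀ᵐ y ∂κ, y ∈ t := (mem_ae_iff_prob_eq_one ht).2 h
        filter_upwards [this] with y hy
        simp [hy, h]
    filter_upwards [key] with x hx
    by_cases hxs : x ∈ s
    · have e : {y | (x, y) ∈ s ×ˢ t} = t := by ext; simp [hxs]
      rw [e, ← hx]
      by_cases hxt : φ x ∈ t
      · rw [Set.indicator_of_mem hxt, Set.indicator_of_mem (Set.mk_mem_prod hxs hxt)]
        rfl
      · rw [Set.indicator_of_notMem hxt, Set.indicator_of_notMem fun h => hxt h.2]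
    · have e : {y | (x, y) ∈ s ×ˢ t} = ∅ := by ext; simp [hxs]
      rw [e, measure_empty]
      simp [Set.mem_prod, hxs]
  | compl B hB ih =>
    filter_upwards [ih] with x hx
    have hm : MeasurableSet {y | (x, y) ∈ B} := measurable_prodMk_left hB
    have e : {y | (x, y) ∈ Bᶜ} = {y | (x, y) ∈ B}ᶜ := rfl
    rw [e, prob_compl_eq_one_sub hm, ← hx]
    by_cases h : (x, φ x) ∈ B <;> simp [h]
  | iUnion f hfd hfm ih =>
    filter_upwards [ae_all_iff.2 ih] with x hx
    have e : {y | (x, y) ∈ ⋃ i, f i} = ⋃ i, {y | (x, y) ∈ f i} := by ext; simp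
    have hd : Pairwise (Function.onFun Disjoint fun i => {y | (x, y) ∈ f i}) := fun i j hij =>
      Set.disjoint_left.2 fun y h1 h2 => Set.disjoint_left.1 (hfd hij) h1 h2
    have hm (i) : MeasurableSet {y | (x, y) ∈ f i} := measurable_prodMk_left (hfm i)
    rw [← Measure.dirac_apply' _ (.iUnion hfm), measure_iUnion hfd hfm, e, measure_iUnion hd hm]
    exact tsum_congr fun i => by rw [Measure.dirac_apply' _ (hfm i), hx i]

end ZeroOne

/-! ### Factorial measures of sums of zero-one measures -/

section Factorial

variable {X : Type*} [MeasurableSpace X]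

/-- The factorial measure on `X ^ ι` of the sum of the zero-one measures `κ 0, κ 1, …`: the sum of
the product measures `⨂ i, κ (k i)` over all families `k` of distinct indices. -/
noncomputable def facPi (κ : ℕ → Measure X) (ι : Type*) [Fintype ι] : Measure (ι → X) :=
  Measure.sum fun k : ι ↪ ℕ => Measure.pi fun i => κ (k i)

/-- Splitting off the last index of a family of distinct indices. -/
def embSnocEquiv (m : ℕ) : (Fin (m + 1) ↪ ℕ) ≃ Σ k : Fin m ↪ ℕ, {l : ℕ // l ∉ Set.range k} where
  toFun k := ⟨Fin.castSuccEmb.trans k, k (Fin.last m), by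
    rintro ⟨i, hi⟩
    exact (Fin.castSucc_lt_last i).ne (k.injective hi)⟩
  invFun p := ⟨Fin.snoc p.1 p.2.1, Fin.snoc_injective_iff.2 ⟨p.1.injective, p.2.2⟩⟩
  left_inv k := by
    ext i
    refine Fin.lastCases ?_ (fun i => ?_) i <;> simp
  right_inv p := by
    obtain ⟨k, l, hl⟩ := p
    have : (Fin.castSuccEmb.trans
      ⟨Fin.snoc k l, Fin.snoc_injective_iff.2 ⟨k.injective, hl⟩⟩ : Fin m ↪ ℕ) = k := by
      ext i; simp
    refine Sigma.ext this ?_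
    refine (Subtype.heq_iff_coe_eq ?_).2 ?_
    · intro x
      change x ∉ Set.range (Fin.castSuccEmb.trans ⟨Fin.snoc k l, _⟩) ↔ x ∉ Set.range k
      rw [this]
    · simp

theorem pi_snoc_apply {m : ℕ} (κ : Fin (m + 1) → Measure X) [∀ i, SigmaFinite (κ i)]
    {B : Set (Fin (m + 1) → X)} (hB : MeasurableSet B) :
    Measure.pi κ B = ∫⁻ x : Fin m → X, κ (Fin.last m) {y | (Fin.snoc x y : Fin (m + 1) → X) ∈ B}
      ∂(Measure.pi fun i => κ i.castSucc) := by
  have h := (measurePreserving_piFinSuccAbove κ (Fin.last m)).symm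
  rw [← h.measure_preimage hB.nullMeasurableSet, Measure.prod_apply_symm (h.measurable hB)]
  simp only [Fin.succAbove_last]
  refine lintegral_congr fun x => ?_
  congr 1
  ext y
  simp [MeasurableEquiv.piFinSuccAbove, Fin.insertNthEquiv, Fin.insertNth_last']

/-- One step of the recursion for factorial measures: after `m` points have been drawn from the
summands with indices `k`, the subtracted Dirac measures cancel exactly these summands. -/
theorem factorialStepValue_facPi (κ : ℕ → Measure X) [∀ i, IsZeroOneMeasure (κ i)] (m : ℕ)
    {B : Set (Fin (m + 1) → X)} (hB : MeasurableSet B) :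
    factorialStepValue (Measure.sum κ) (facPi κ (Fin m)) B = facPi κ (Fin (m + 1)) B := by
  classical
  have hsnoc : Measurable fun p : (Fin m → X) × X => (Fin.snoc p.1 p.2 : Fin (m + 1) → X) := by
    refine measurable_pi_lambda _ fun i => ?_
    refine Fin.lastCases ?_ (fun i => ?_) i
    · simpa using measurable_snd
    · simpa [Function.comp_def] using (measurable_pi_apply i).comp measurable_fst
  have hB' : MeasurableSet {p : (Fin m → X) × X | (Fin.snoc p.1 p.2 : Fin (m + 1) → X) ∈ B} :=
    hsnoc hB
  have hsec (x : Fin m → X) : MeasurableSet {y | (Fin.snoc x y : Fin (m + 1) → X) ∈ B} :=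
    measurable_prodMk_left hB'
  rw [factorialStepValue, facPi, lintegral_sum_measure, facPi, Measure.sum_apply _ hB,
    ← (embSnocEquiv m).symm.tsum_eq, ENNReal.tsum_sigma']
  refine tsum_congr fun k => ?_
  have hae : ∀ᵐ x ∂(Measure.pi fun i => κ (k i)), ∀ j : Fin m,
      B.indicator (1 : (Fin (m + 1) → X) → ℝ≥0∞) (Fin.snoc x (x j)) =
        κ (k j) {y | (Fin.snoc x y : Fin (m + 1) → X) ∈ B} := by
    refine ae_all_iff.2 fun j => ?_
    filter_upwards [ae_indicator_eq_of_isZeroOneMeasure (Measure.pi fun i => κ (k i)) (κ (k j))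
      (Measure.quasiMeasurePreserving_eval (fun i => κ (k i)) j) hB'] with x hx
    rw [← show _ = κ (k j) {y | (Fin.snoc x y : Fin (m + 1) → X) ∈ B} from hx]
    rfl
  have hval : ∀ᵐ x ∂(Measure.pi fun i => κ (k i)),
      Measure.sum κ {y | (Fin.snoc x y : Fin (m + 1) → X) ∈ B} -
        ∑ j : Fin m, B.indicator 1 (Fin.snoc x (x j) : Fin (m + 1) → X) =
      ∑' l : {l : ℕ // l ∉ Set.range k}, κ l {y | (Fin.snoc x y : Fin (m + 1) → X) ∈ B} := by
    filter_upwards [hae] with x hx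
    set u : ℕ → ℝ≥0∞ := fun l => κ l {y | (Fin.snoc x y : Fin (m + 1) → X) ∈ B}
    have h1 : ∑' l : Set.range k, u l = ∑ j, u (k j) := by
      rw [← tsum_fintype (L := .unconditional _), ← (Equiv.ofInjective k k.injective).tsum_eq]
      rfl
    have h2 : ∑' l, u l = ∑ j, u (k j) + ∑' l : {l : ℕ // l ∉ Set.range k}, u l := by
      rw [← h1]
      exact (ENNReal.summable.tsum_add_tsum_compl ENNReal.summable).symm
    rw [Measure.sum_apply _ (hsec x), Finset.sum_congr rfl fun j _ => hx j, h2]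
    refine ENNReal.add_sub_cancel_left ?_
    exact ENNReal.sum_ne_top.2 fun j _ => measure_ne_top _ _
  rw [lintegral_congr_ae hval, lintegral_tsum]
  · refine tsum_congr fun l => ?_
    rw [pi_snoc_apply _ hB]
    simp [embSnocEquiv]
  · exact fun l => (measurable_measure_prodMk_left hB').aemeasurable

/-- The factorial measures of a sum of zero-one measures are given by families of distinct
indices. -/
theorem factorialMeasure_sum (κ : ℕ → Measure X) [∀ i, IsZeroOneMeasure (κ i)] (m : ℕ) :
    factorialMeasure (Measure.sum κ) m = facPi κ (Fin m) := by
  induction m with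
  | zero =>
    rw [factorialMeasure, facPi]
    ext s hs
    rw [Measure.sum_apply _ hs, tsum_fintype, Fintype.sum_unique, Measure.pi_of_empty _ Fin.elim0]
  | succ m ih =>
    rw [factorialMeasure, ih, factorialStep]
    have h : ∃ ρ : Measure (Fin (m + 1) → X), ∀ B, MeasurableSet B →
        ρ B = factorialStepValue (Measure.sum κ) (facPi κ (Fin m)) B :=
      ⟨facPi κ (Fin (m + 1)), fun B hB => (factorialStepValue_facPi κ m hB).symm⟩
    rw [dif_pos h]
    ext B hB
    rw [h.choose_spec B hB, factorialStepValue_facPi κ m hB]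

end Factorial

/-! ### Factorial measures of rectangles -/

section Atoms

variable {X ι : Type*}

/-- The atom, indexed by a nonempty set `t ⊆ ι`, of the finite algebra generated by the sets
`B i`: the points that belong to `B i` exactly for `i ∈ t`. -/
def atomOf (B : ι → Set X) (t : {t : Finset ι // t.Nonempty}) : Set X :=
  {x | ∀ i, x ∈ B i ↔ i ∈ t.1}

theorem pairwise_disjoint_atomOf (B : ι → Set X) :
    Pairwise (Function.onFun Disjoint (atomOf B)) := by
  intro t t' h
  refine Set.disjoint_left.2 fun x hx hx' => h (Subtype.ext (Finset.ext fun i => ?_))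
  rw [← hx i, hx' i]

theorem atomOf_subset (B : ι → Set X) (t : {t : Finset ι // t.Nonempty}) :
    atomOf B t ⊆ B t.2.choose := fun _ hx => (hx _).2 t.2.choose_spec

end Atoms

section Rectangles

variable {X ι T : Type*} [MeasurableSpace X] [Fintype ι]

/-- The falling factorial `x (x - 1) ⋯ (x - n + 1)` on `[0, ∞]`, with truncated subtraction. -/
noncomputable def fallingFactorial (n : ℕ) (x : ℝ≥0∞) : ℝ≥0∞ := ∏ j ∈ Finset.range n, (x - j)

theorem measurable_fallingFactorial (n : ℕ) : Measurable (fallingFactorial n) := by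
  unfold fallingFactorial
  fun_prop

theorem fallingFactorial_natCast (n k : ℕ) :
    fallingFactorial n (k : ℝ≥0∞) = (k.descFactorial n : ℝ≥0∞) := by
  rw [Nat.descFactorial_eq_prod_range, fallingFactorial]
  push_cast [ENNReal.natCast_sub]
  rfl

/-- The factorial moments of the Poisson distribution. -/
theorem lintegral_fallingFactorial_poissonMeasure (n : ℕ) (r : NNReal) :
    ∫⁻ k : ℕ, fallingFactorial n (k : ℝ≥0∞) ∂(poissonMeasure r) = (r : ℝ≥0∞) ^ n := by
  have h1 : ∫⁻ k : ℕ, fallingFactorial n (k : ℝ≥0∞) ∂(poissonMeasure r) =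
      ∑' k : ℕ, (k.descFactorial n : ℝ≥0∞) * poissonMeasure r {k} := by
    rw [lintegral_countable']
    exact tsum_congr fun k => by rw [fallingFactorial_natCast]
  have h2 (k : ℕ) : ((k + n).descFactorial n : ℝ≥0∞) * poissonMeasure r {k + n} =
      (r : ℝ≥0∞) ^ n * poissonMeasure r {k} := by
    rw [poissonMeasure_singleton, poissonMeasure_singleton, ← ENNReal.ofReal_natCast,
      ← ENNReal.ofReal_coe_nnreal, ← ENNReal.ofReal_pow (NNReal.coe_nonneg r), ← ENNReal.ofReal_mul (by positivity),
      ← ENNReal.ofReal_mul (by positivity)]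
    congr 1
    have h := Nat.factorial_mul_descFactorial (Nat.le_add_left n k)
    rw [Nat.add_sub_cancel] at h
    have h' : (((k + n).factorial : ℕ) : ℝ) = k.factorial * (k + n).descFactorial n := by
      exact_mod_cast h.symm
    rw [h']
    have : (((k + n).descFactorial n : ℕ) : ℝ) ≠ 0 := by
      rw [Nat.cast_ne_zero, Ne, Nat.descFactorial_eq_zero_iff_lt]
      omega
    field_simp
    ring
  rw [h1, ← ENNReal.summable.sum_add_tsum_nat_add' (k := n), tsum_congr h2, ENNReal.tsum_mul_left,
    Finset.sum_eq_zero, zero_add]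
  · have : ∑' k : ℕ, poissonMeasure r {k} = poissonMeasure r Set.univ := by
      rw [← lintegral_one, lintegral_countable']
      simp
    rw [this, measure_univ, mul_one]
  · intro k hk
    rw [Nat.descFactorial_of_lt (Finset.mem_range.1 hk)]
    simp

theorem sum_apply_eq_encard (κ : ℕ → Measure X) [∀ i, IsZeroOneMeasure (κ i)] {A : Set X}
    (hA : MeasurableSet A) : Measure.sum κ A = ({l | κ l A = 1} : Set ℕ).encard := by
  rw [Measure.sum_apply _ hA, ← ENNReal.tsum_set_one, tsum_subtype {l | κ l A = 1} fun _ => 1]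
  refine tsum_congr fun l => ?_
  rcases (κ l).zero_one A with h | h <;> simp [h]

open Classical in
/-- The families of distinct indices that put the `i`-th point into the set `A (c i)`, where the
sets `A t` are disjoint, are counted by falling factorials. -/
theorem facPi_pi_of_disjoint (κ : ℕ → Measure X) [∀ i, IsZeroOneMeasure (κ i)] [Fintype T]
    (A : T → Set X) (hA : ∀ t, MeasurableSet (A t))
    (hd : Pairwise (Function.onFun Disjoint A)) (hfin : ∀ t, Measure.sum κ (A t) ≠ ∞)
    (c : ι → T) :
    facPi κ ι (Set.univ.pi fun i => A (c i)) =
      ∏ t, fallingFactorial (Fintype.card {i // c i = t}) (Measure.sum κ (A t)) := by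
  set K : T → Set ℕ := fun t => {l | κ l (A t) = 1}
  have hK (t : T) : (K t).Finite := by
    have := hfin t
    rw [sum_apply_eq_encard κ (hA t)] at this
    by_contra h
    have h' : (K t).encard = ⊤ := Set.encard_eq_top h
    exact this (by simp [K] at h' ⊢; simp [h'])
  have (t : T) : Fintype (K t) := (hK t).fintype
  have hsum (t : T) : Measure.sum κ (A t) = (Fintype.card (K t) : ℝ≥0∞) := by
    rw [sum_apply_eq_encard κ (hA t), ← Set.coe_fintypeCard]
    rfl
  have hdisj {l : ℕ} {t t' : T} (h : l ∈ K t) (h' : l ∈ K t') : t = t' := by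
    by_contra hne
    have h0 : κ l (A t ∩ A t') = 1 :=
      IsZeroOneMeasure.measure_inter_eq_one (hA t) (hA t') h h'
    rw [Set.disjoint_iff_inter_eq_empty.1 (hd hne)] at h0
    simp at h0
  let e : {k : ι ↪ ℕ // ∀ i, k i ∈ K (c i)} → ∀ t, ({i // c i = t} ↪ K t) := fun k t =>
    ⟨fun i => ⟨k.1 i.1, by have := k.2 i.1; rwa [i.2] at this⟩, fun i j hij => by
      have := congrArg Subtype.val hij
      exact Subtype.ext (k.1.injective this)⟩
  have he : Function.Bijective e := by
    constructor
    · intro k k' h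
      refine Subtype.ext (Function.Embedding.ext fun i => ?_)
      have := congrArg Subtype.val (DFunLike.congr_fun (congrFun h (c i)) ⟨i, rfl⟩)
      exact this
    · intro q
      refine ⟨⟨⟨fun i => q (c i) ⟨i, rfl⟩, fun i j hij => ?_⟩, fun i => (q (c i) ⟨i, rfl⟩).2⟩, ?_⟩
      · have hij' : ((q (c i) ⟨i, rfl⟩ : K (c i)) : ℕ) = (q (c j) ⟨j, rfl⟩ : K (c j)) := hij
        have hc : c i = c j := hdisj (q (c i) ⟨i, rfl⟩).2 (by rw [hij']; exact Subtype.coe_prop _)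
        have key : ∀ t (hi : c i = t) (hj : c j = t),
            ((q t ⟨i, hi⟩ : K t) : ℕ) = q t ⟨j, hj⟩ → i = j := fun t hi hj h => by
          have := (q t).injective (Subtype.ext h)
          exact congrArg Subtype.val this
        refine key (c j) hc rfl ?_
        rw [← hij']
        have : ∀ t (hi : c i = t), ((q t ⟨i, hi⟩ : K t) : ℕ) = q (c i) ⟨i, rfl⟩ := by
          rintro _ rfl; rfl
        exact this _ hc
      · funext t
        ext ⟨i, hi⟩
        subst hi
        rfl
  have hmeas : MeasurableSet (Set.univ.pi fun i => A (c i)) := .univ_pi fun i => hA _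
  have hval (k : ι ↪ ℕ) : Measure.pi (fun i => κ (k i)) (Set.univ.pi fun i => A (c i)) =
      {k : ι ↪ ℕ | ∀ i, k i ∈ K (c i)}.indicator (fun _ => 1) k := by
    rw [Measure.pi_pi]
    by_cases h : ∀ i, k i ∈ K (c i)
    · rw [Set.indicator_of_mem (by exact h)]
      exact Finset.prod_eq_one fun i _ => h i
    · rw [Set.indicator_of_notMem (by exact h)]
      push Not at h
      obtain ⟨i, hi⟩ := h
      exact Finset.prod_eq_zero (Finset.mem_univ i) (((κ (k i)).zero_one _).resolve_right hi)
  have : Fintype {k : ι ↪ ℕ // ∀ i, k i ∈ K (c i)} :=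
    Fintype.ofEquiv _ (Equiv.ofBijective e he).symm
  have : Fintype {k : ι ↪ ℕ | ∀ i, k i ∈ K (c i)} := this
  rw [facPi, Measure.sum_apply _ hmeas, tsum_congr hval, ← tsum_subtype, tsum_fintype]
  rw [Finset.sum_const, Finset.card_univ, nsmul_one]
  have hcard := Fintype.card_of_bijective he
  rw [Fintype.card_pi] at hcard
  simp only [Fintype.card_embedding_eq] at hcard
  simp only [hsum, fallingFactorial_natCast]
  rw [← Nat.cast_prod, ← hcard]
  exact congrArg _ (Fintype.card_congr (Equiv.refl _))

theorem measurableSet_atomOf {B : ι → Set X} (hB : ∀ i, MeasurableSet (B i))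
    (t : {t : Finset ι // t.Nonempty}) : MeasurableSet (atomOf B t) := by
  classical
  have : atomOf B t = ⋂ i, if i ∈ t.1 then B i else (B i)ᶜ := by
    ext x
    simp only [atomOf, Set.mem_iInter]
    refine forall_congr' fun i => ?_
    split_ifs with h <;> simp [h]
  rw [this]
  refine .iInter fun i => ?_
  split_ifs
  exacts [hB i, (hB i).compl]

open Classical in
theorem measure_eq_sum_atomOf (μ : Measure X) {B : ι → Set X} (hB : ∀ i, MeasurableSet (B i))
    (i : ι) : μ (B i) = ∑ t with i ∈ t.1, μ (atomOf B t) := by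
  rw [← measure_biUnion_finset]
  · congr 1
    ext x
    simp only [Finset.mem_filter, Finset.mem_univ, true_and, Set.mem_iUnion, exists_prop]
    constructor
    · intro hx
      exact ⟨⟨Finset.univ.filter fun j => x ∈ B j, i, by simpa using hx⟩, by simpa using hx,
        fun j => by simp⟩
    · rintro ⟨t, hi, hx⟩
      exact (hx i).2 hi
  · exact fun t _ t' _ h => pairwise_disjoint_atomOf B h
  · exact fun t _ => measurableSet_atomOf hB t

open Classical in
theorem prod_measure_eq_sum_atomOf (μ : ι → Measure X) {B : ι → Set X}
    (hB : ∀ i, MeasurableSet (B i)) :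
    ∏ i, μ i (B i) = ∑ c ∈ Fintype.piFinset fun i : ι =>
      (Finset.univ.filter fun t : {t : Finset ι // t.Nonempty} => i ∈ t.1),
      ∏ i, μ i (atomOf B (c i)) := by
  rw [Finset.prod_congr rfl fun i _ => measure_eq_sum_atomOf (μ i) hB i, Finset.prod_univ_sum]

open Classical in
/-- The factorial measure of a rectangle is a polynomial in the masses of the atoms generated by its
sides. -/
theorem facPi_pi (κ : ℕ → Measure X) [∀ i, IsZeroOneMeasure (κ i)]
    {B : ι → Set X} (hB : ∀ i, MeasurableSet (B i)) (hfin : ∀ i, Measure.sum κ (B i) ≠ ∞) :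
    facPi κ ι (Set.univ.pi B) = ∑ c ∈ Fintype.piFinset fun i : ι =>
      (Finset.univ.filter fun t : {t : Finset ι // t.Nonempty} => i ∈ t.1),
      ∏ t, fallingFactorial (Fintype.card {i // c i = t}) (Measure.sum κ (atomOf B t)) := by
  rw [facPi, Measure.sum_apply _ (.univ_pi hB)]
  simp only [Measure.pi_pi]
  rw [tsum_congr fun k : ι ↪ ℕ => prod_measure_eq_sum_atomOf (fun i => κ (k i)) hB,
    Summable.tsum_finsetSum fun _ _ => ENNReal.summable]
  refine Finset.sum_congr rfl fun c _ => ?_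
  have h := facPi_pi_of_disjoint κ (atomOf B) (measurableSet_atomOf hB) (pairwise_disjoint_atomOf B)
    (fun t => ((measure_mono (atomOf_subset B t)).trans_lt (hfin _).lt_top).ne) c
  rw [facPi, Measure.sum_apply _ (.univ_pi fun i => measurableSet_atomOf hB _)] at h
  simp only [Measure.pi_pi] at h
  convert h

theorem fallingFactorial_ne_top (n : ℕ) {x : ℝ≥0∞} (hx : x ≠ ∞) : fallingFactorial n x ≠ ∞ :=
  ENNReal.prod_ne_top fun _ _ => ENNReal.sub_ne_top hx

theorem facPi_pi_ne_top (κ : ℕ → Measure X) [∀ i, IsZeroOneMeasure (κ i)]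
    {B : ι → Set X} (hB : ∀ i, MeasurableSet (B i)) (hfin : ∀ i, Measure.sum κ (B i) ≠ ∞) :
    facPi κ ι (Set.univ.pi B) ≠ ∞ := by
  classical
  rw [facPi_pi κ hB hfin]
  exact ENNReal.sum_ne_top.2 fun c _ => ENNReal.prod_ne_top fun t _ => fallingFactorial_ne_top _
    ((measure_mono (atomOf_subset B t)).trans_lt (hfin _).lt_top).ne

end Rectangles

/-! ### Campbell's formula for factorial measures -/

section Campbell

variable {X Ω : Type*} [MeasurableSpace X] [MeasurableSpace Ω]

/-- A representation of a Poisson process with intensity measure `ν` as a random sum of zero-one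
measures. The sum is a measurable random element although the summands, which are chosen for each
`ω` separately, need not be measurable in `ω`. -/
structure IsPoissonSum (P : Measure Ω) (κ : Ω → ℕ → Measure X) (ν : Measure X)
    [SigmaFinite ν] : Prop where
  zeroOne : ∀ ω i, IsZeroOneMeasure (κ ω i)
  measurable : ∀ B, MeasurableSet B → Measurable fun ω => Measure.sum (κ ω) B
  finite : ∀ ω n, Measure.sum (κ ω) (spanningSets ν n) ≠ ∞
  law_eq_poisson : ∀ B, MeasurableSet B → ν B ≠ ∞ →
    P.map (fun ω => Measure.sum (κ ω) B) =
      (poissonMeasure (ν B).toNNReal).map (fun n : ℕ => (n : ℝ≥0∞))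
  indep : ∀ (k : ℕ) (B : Fin k → Set X), (∀ i, MeasurableSet (B i)) →
    Pairwise (fun i j => Disjoint (B i) (B j)) →
    iIndepFun (fun i ω => Measure.sum (κ ω) (B i)) P

/-- A Poisson process is almost surely a random sum of zero-one measures. -/
theorem IsPoissonProcess.exists_isPoissonSum {P : Measure Ω} [IsProbabilityMeasure P]
    {η : Ω → Measure X} {ν : Measure X} [SigmaFinite ν] (h : IsPoissonProcess P η ν) :
    ∃ κ : Ω → ℕ → Measure X, IsPoissonSum P κ ν ∧ ∀ᵐ ω ∂P, η ω = Measure.sum (κ ω) := by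
  classical
  have hev (B : Set X) (hB : MeasurableSet B) : Measurable fun ω => η ω B :=
    (Measure.measurable_coe hB).comp h.measurable
  -- Off the event `G`, the sum is replaced by zero, which makes it finite on `spanningSets ν n`
  -- for every `ω`.
  choose κ₀ hκ₀ e₀ using fun ω => (h.isPointMeasure ω).exists_eq_sum_zeroOne
  set G : Set Ω := {ω | ∀ n, η ω (spanningSets ν n) ≠ ∞} with hGdef
  have hG : MeasurableSet G := by
    have : G = ⋂ n, {ω | η ω (spanningSets ν n) = ∞}ᶜ := by ext; simp [G]
    rw [this]
    exact .iInter fun n => ((hev _ (measurableSet_spanningSets ν n))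
      (measurableSet_singleton ∞)).compl
  have hGae : ∀ᵐ ω ∂P, ω ∈ G := by
    refine ae_all_iff.2 fun n => ?_
    have hm := hev _ (measurableSet_spanningSets ν n)
    have hl := h.law_eq_poisson _ (measurableSet_spanningSets ν n)
      (measure_spanningSets_lt_top ν n).ne
    have h1 : ∀ᵐ x ∂(P.map fun ω => η ω (spanningSets ν n)), x ≠ ∞ := by
      rw [hl]
      refine (ae_map_iff (by fun_prop) (measurableSet_singleton ∞).compl).2 ?_
      exact ae_of_all _ fun k => ENNReal.natCast_ne_top k
    exact ae_of_ae_map hm.aemeasurable h1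
  refine ⟨fun ω => if ω ∈ G then κ₀ ω else 0, ?_, ?_⟩
  swap
  · filter_upwards [hGae] with ω hω
    rw [if_pos hω, ← e₀]
  have hsum (ω : Ω) : Measure.sum (if ω ∈ G then κ₀ ω else 0) = if ω ∈ G then η ω else 0 := by
    split_ifs
    · exact (e₀ ω).symm
    · exact Measure.sum_zero
  have hae (B : Set X) : (fun ω => η ω B) =ᵐ[P]
      fun ω => Measure.sum (if ω ∈ G then κ₀ ω else 0) B := by
    filter_upwards [hGae] with ω hω
    rw [hsum, if_pos hω]
  refine ⟨fun ω i => ?_, fun B hB => ?_, fun ω n => ?_, fun B hB hfin => ?_,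
    fun k B hB hd => ?_⟩
  · split_ifs
    · exact hκ₀ ω i
    · exact instIsZeroOneMeasure_zero
  · have : (fun ω => Measure.sum (if ω ∈ G then κ₀ ω else 0) B) =
        fun ω => if ω ∈ G then η ω B else 0 := by
      funext ω
      rw [hsum]
      split_ifs <;> rfl
    rw [this]
    exact Measurable.ite hG (hev B hB) measurable_const
  · rw [hsum]
    split_ifs with hω
    · exact hω n
    · simp
  · rw [← h.law_eq_poisson B hB hfin]
    exact (Measure.map_congr (hae B)).symm
  · exact (h.indep k B hB hd).congr fun i => hae (B i)

variable {P : Measure Ω} {κ : Ω → ℕ → Measure X} {ν : Measure X} [SigmaFinite ν]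

theorem isPiSystem_finite_rect (ν : Measure X) :
    IsPiSystem {B : Set X | MeasurableSet B ∧ ν B ≠ ∞} := fun _ hs _ ht _ =>
  ⟨hs.1.inter ht.1, ((measure_mono Set.inter_subset_left).trans_lt hs.2.lt_top).ne⟩

theorem monotone_pi_spanningSets (ν : Measure X) [SigmaFinite ν] (ι : Type*) :
    Monotone fun n => (Set.univ.pi fun _ : ι => spanningSets ν n) := fun _ _ hab =>
  Set.pi_mono fun _ _ => monotone_spanningSets ν hab

theorem iUnion_pi_spanningSets (ν : Measure X) [SigmaFinite ν] (ι : Type*) [Finite ι] :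
    ⋃ n, (Set.univ.pi fun _ : ι => spanningSets ν n) = Set.univ := by
  rw [Set.iUnion_univ_pi_of_monotone fun _ => monotone_spanningSets ν]
  simp [iUnion_spanningSets]

/-- The factorial measure is a random element although the summands `κ ω k` are not: on rectangles it
is a function of the masses of finitely many sets. -/
theorem IsPoissonSum.measurable_facPi (h : IsPoissonSum P κ ν) (ι : Type*) [Fintype ι] :
    Measurable fun ω => facPi (κ ω) ι := by
  classical
  have := h.zeroOne
  set S : ℕ → Set (ι → X) := fun n => Set.univ.pi fun _ => spanningSets ν n
  have hS (n : ℕ) : MeasurableSet (S n) := .univ_pi fun _ => measurableSet_spanningSets ν n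
  have hSfin (ω : Ω) (n : ℕ) : facPi (κ ω) ι (S n) ≠ ∞ :=
    facPi_pi_ne_top (κ ω) (fun _ => measurableSet_spanningSets ν n) fun _ => h.finite ω n
  have hrect (n : ℕ) (B : ι → Set X) (hB : ∀ i, MeasurableSet (B i)) :
      Measurable fun ω => facPi (κ ω) ι (Set.univ.pi B ∩ S n) := by
    have hBS (i : ι) : MeasurableSet (B i ∩ spanningSets ν n) :=
      (hB i).inter (measurableSet_spanningSets ν n)
    have hpi (ω : Ω) := facPi_pi (κ ω) hBS fun i =>
      ((measure_mono Set.inter_subset_right).trans_lt (h.finite ω n).lt_top).ne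
    simp only [S, ← Set.pi_inter_distrib, hpi]
    refine Finset.measurable_fun_sum _ fun c _ => Finset.measurable_fun_prod _ fun t _ => ?_
    exact (measurable_fallingFactorial _).comp (h.measurable _ (measurableSet_atomOf hBS t))
  have hres (n : ℕ) : Measurable fun ω => (facPi (κ ω) ι).restrict (S n) := by
    have (ω : Ω) : IsFiniteMeasure ((facPi (κ ω) ι).restrict (S n)) :=
      ⟨by rw [Measure.restrict_apply_univ]; exact (hSfin ω n).lt_top⟩
    refine Measurable.measure_of_isPiSystem generateFrom_pi.symm isPiSystem_pi ?_ ?_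
    · rintro _ ⟨B, hB, rfl⟩
      have hB' (i : ι) : MeasurableSet (B i) := hB i (Set.mem_univ i)
      simp only [Measure.restrict_apply (MeasurableSet.univ_pi hB')]
      exact hrect n B hB'
    · simp only [Measure.restrict_apply_univ]
      simpa using hrect n (fun _ => Set.univ) fun _ => .univ
  refine Measure.measurable_of_measurable_coe _ fun B hB => ?_
  have hsup (ω : Ω) : facPi (κ ω) ι B = ⨆ n, (facPi (κ ω) ι).restrict (S n) B := by
    have hmono : Monotone fun n => B ∩ S n := fun a b hab =>
      Set.inter_subset_inter_right _ (monotone_pi_spanningSets ν ι hab)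
    simp only [Measure.restrict_apply hB]
    rw [← hmono.measure_iUnion, ← Set.inter_iUnion, iUnion_pi_spanningSets, Set.inter_univ]
  simp only [hsup]
  exact .iSup fun n => (Measure.measurable_coe hB).comp (hres n)

/-- The random factorial measure as a kernel. -/
noncomputable def IsPoissonSum.kernel (h : IsPoissonSum P κ ν) (ι : Type*) [Fintype ι] :
    Kernel Ω (ι → X) := ⟨fun ω => facPi (κ ω) ι, h.measurable_facPi ι⟩

theorem IsPoissonSum.lintegral_facPi_pi (h : IsPoissonSum P κ ν) {ι : Type*} [Fintype ι]
    {B : ι → Set X} (hB : ∀ i, MeasurableSet (B i)) (hfin : ∀ i, ν (B i) ≠ ∞) :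
    ∫⁻ ω, facPi (κ ω) ι (Set.univ.pi B) ∂P = ∏ i, ν (B i) := by
  classical
  have := h.zeroOne
  have hpois {A : Set X} (hA : MeasurableSet A) (hAfin : ν A ≠ ∞) (n : ℕ) :
      ∫⁻ ω, fallingFactorial n (Measure.sum (κ ω) A) ∂P = ν A ^ n := by
    rw [← lintegral_map (measurable_fallingFactorial n) (h.measurable A hA),
      h.law_eq_poisson A hA hAfin, lintegral_map (measurable_fallingFactorial n) (by fun_prop),
      lintegral_fallingFactorial_poissonMeasure, ENNReal.coe_toNNReal hAfin]
  have hatom (t) : ν (atomOf B t) ≠ ∞ :=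
    ((measure_mono (atomOf_subset B t)).trans_lt (hfin _).lt_top).ne
  have hmatom := measurableSet_atomOf hB
  have hae : ∀ᵐ ω ∂P, ∀ i, Measure.sum (κ ω) (B i) ≠ ∞ := by
    refine ae_all_iff.2 fun i => ?_
    have h1 : ∫⁻ ω, Measure.sum (κ ω) (B i) ∂P = ν (B i) := by
      simpa [fallingFactorial] using hpois (hB i) (hfin i) 1
    filter_upwards [ae_lt_top (h.measurable _ (hB i)) (by rw [h1]; exact hfin i)] with ω hω
    exact hω.ne
  rw [lintegral_congr_ae (hae.mono fun ω hω => facPi_pi (κ ω) hB hω),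
    prod_measure_eq_sum_atomOf (fun _ => ν) hB, lintegral_finsetSum]
  swap
  · exact fun c _ => Finset.measurable_fun_prod _ fun t _ =>
      (measurable_fallingFactorial _).comp (h.measurable _ (hmatom t))
  refine Finset.sum_congr rfl fun c _ => ?_
  -- the numbers of points in the atoms are independent
  have hind : iIndepFun (fun t ω => Measure.sum (κ ω) (atomOf B t)) P := by
    set e := Fintype.equivFin {t : Finset ι // t.Nonempty}
    have := h.indep _ (fun j => atomOf B (e.symm j)) (fun j => hmatom _) fun i j hij =>
      pairwise_disjoint_atomOf B (e.symm.injective.ne hij)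
    have := this.precomp e.injective
    simpa using this
  refine (lintegral_prod_eq_prod_lintegral_of_indepFun _ _
    (hind.comp _ fun t => measurable_fallingFactorial (Fintype.card {i // c i = t}))
    fun t => (measurable_fallingFactorial _).comp (h.measurable _ (hmatom t))).trans ?_
  rw [← Finset.prod_fiberwise Finset.univ c]
  refine Finset.prod_congr rfl fun t _ => ?_
  rw [Finset.prod_congr rfl fun i hi => by rw [(Finset.mem_filter.1 hi).2], Finset.prod_const,
    Fintype.card_subtype]
  exact hpois (hmatom t) (hatom t) _

/-- The multivariate Campbell formula: the expectation of the factorial measure is the product of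
the intensity measures. -/
theorem IsPoissonSum.bind_facPi (h : IsPoissonSum P κ ν) (ι : Type*) [Fintype ι] :
    P.bind (h.kernel ι) = Measure.pi fun _ : ι => ν := by
  refine (Measure.pi_eq_generateFrom
    (C := fun _ => {B : Set X | MeasurableSet B ∧ ν B ≠ ∞}) (fun _ => ?_)
    (fun _ => isPiSystem_finite_rect ν) (fun _ => ?_) fun B hB => ?_).symm
  · refine le_antisymm (MeasurableSpace.generateFrom_le fun B hB => hB.1) fun B hB => ?_
    rw [← Set.inter_univ B, ← iUnion_spanningSets ν, Set.inter_iUnion]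
    exact .iUnion fun n => MeasurableSpace.measurableSet_generateFrom
      ⟨hB.inter (measurableSet_spanningSets ν n), ((measure_mono Set.inter_subset_right).trans_lt
        (measure_spanningSets_lt_top ν n)).ne⟩
  · exact ⟨spanningSets ν, fun n => ⟨measurableSet_spanningSets ν n,
      (measure_spanningSets_lt_top ν n).ne⟩, fun n => measure_spanningSets_lt_top ν n,
      iUnion_spanningSets ν⟩
  · rw [Measure.bind_apply (.univ_pi fun i => (hB i).1) (h.kernel ι).measurable.aemeasurable]
    exact h.lintegral_facPi_pi (fun i => (hB i).1) fun i => (hB i).2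

end Campbell

/-! ### Products of integrals with respect to factorial measures -/

section Tools

theorem ENNReal.prod_tsum_fin : ∀ {n : ℕ} {α : Fin n → Type*} (g : ∀ i, α i → ℝ≥0∞),
    ∏ i, ∑' k, g i k = ∑' k : ∀ i, α i, ∏ i, g i (k i) := by
  intro n
  induction n with
  | zero => intro α g; simp
  | succ n ih =>
    intro α g
    rw [Fin.prod_univ_succ, ih, ← (Fin.consEquiv α).tsum_eq, ENNReal.tsum_prod',
      ← ENNReal.tsum_mul_right]
    refine tsum_congr fun a => ?_
    rw [← ENNReal.tsum_mul_left]
    refine tsum_congr fun b => ?_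
    simp [Fin.prod_univ_succ, Fin.consEquiv]

theorem ENNReal.prod_tsum {L : Type*} [Fintype L] {α : L → Type*} (g : ∀ i, α i → ℝ≥0∞) :
    ∏ i, ∑' k, g i k = ∑' k : ∀ i, α i, ∏ i, g i (k i) := by
  let e := (Fintype.equivFin L).symm
  rw [← e.prod_comp, ENNReal.prod_tsum_fin fun i => g (e i),
    ← (Equiv.piCongrLeft α e).tsum_eq]
  refine tsum_congr fun k => ?_
  rw [← e.prod_comp]
  simp [Equiv.piCongrLeft_apply_apply]

variable {X α β : Type*} [MeasurableSpace X] [Fintype α] [Fintype β]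

theorem measurePreserving_comp_injective (κ : β → Measure X) [∀ b, IsProbabilityMeasure (κ b)]
    {φ : α → β} (hφ : Function.Injective φ) :
    MeasurePreserving (fun y : β → X => y ∘ φ) (Measure.pi κ) (Measure.pi (κ ∘ φ)) := by
  have hm : Measurable fun y : β → X => y ∘ φ :=
    measurable_pi_lambda _ fun a => measurable_pi_apply (φ a)
  have (a : α) : IsProbabilityMeasure ((κ ∘ φ) a) := inferInstanceAs (IsProbabilityMeasure (κ (φ a)))
  refine ⟨hm, (Measure.pi_eq fun s hs => ?_).symm⟩
  rw [Measure.map_apply hm (.univ_pi hs)]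
  have : (fun y : β → X => y ∘ φ) ⁻¹' Set.univ.pi s =
      Set.univ.pi (Function.extend φ s fun _ => Set.univ) := by
    ext y
    simp only [Set.mem_preimage, Set.mem_univ_pi]
    constructor
    · intro h b
      by_cases hb : ∃ a, φ a = b
      · obtain ⟨a, rfl⟩ := hb
        rw [hφ.extend_apply]
        exact h a
      · rw [Function.extend_apply' _ _ _ hb]
        exact Set.mem_univ _
    · intro h a
      have := h (φ a)
      rwa [hφ.extend_apply] at this
  rw [this, Measure.pi_pi]
  refine (Fintype.prod_of_injective φ hφ _ _ (fun b hb => ?_) fun a => ?_).symm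
  · rw [Function.extend_apply' _ _ _ (by simpa using hb)]
    exact measure_univ
  · rw [hφ.extend_apply]
    rfl

/-- Any events are independent under a zero-one measure. -/
theorem IsZeroOneMeasure.measure_iInter_eq_prod {L : Type*} [Fintype L] {Y : Type*}
    [MeasurableSpace Y] (K : Measure Y) [IsProbabilityMeasure K] [IsZeroOneMeasure K]
    {C : L → Set Y} (hC : ∀ i, MeasurableSet (C i)) : K (⋂ i, C i) = ∏ i, K (C i) := by
  by_cases h : ∃ i, K (C i) = 0
  · obtain ⟨i, hi⟩ := h
    rw [Finset.prod_eq_zero (Finset.mem_univ i) hi]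
    exact measure_mono_null (Set.iInter_subset _ i) hi
  · push Not at h
    have h1 (i : L) : K (C i) = 1 := (K.zero_one _).resolve_left (h i)
    rw [Finset.prod_eq_one fun i _ => h1 i]
    have : ∀ᵐ y ∂K, ∀ i, y ∈ C i := ae_all_iff.2 fun i => (mem_ae_iff_prob_eq_one (hC i)).2 (h1 i)
    refine (mem_ae_iff_prob_eq_one (.iInter hC)).1 ?_
    filter_upwards [this] with y hy using Set.mem_iInter.2 hy

end Tools

section RowSetoids

variable {L : Type*}

/-- The partitions, written as equivalence relations, of the disjoint union of rows of lengths
`n i` whose blocks meet every row in at most one element. -/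
abbrev RowSetoid (n : L → ℕ) : Type _ :=
  {s : Setoid (Σ i, Fin (n i)) // ∀ i j j', s ⟨i, j⟩ ⟨i, j'⟩ → j = j'}

noncomputable instance instFintypeSetoid (A : Type*) [Finite A] : Fintype (Setoid A) :=
  have : Finite (Setoid A) := Finite.of_injective (fun s : Setoid A => (s.r : A → A → Prop))
    fun _ _ h => Setoid.ext fun a b => by
      have := congrFun (congrFun h a) b
      exact iff_of_eq this
  Fintype.ofFinite _

noncomputable instance instFintypeRowSetoid [Finite L] (n : L → ℕ) : Fintype (RowSetoid n) :=
  Fintype.ofFinite _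

noncomputable instance instFintypeQuotient {A : Type*} [Finite A] (s : Setoid A) :
    Fintype (Quotient s) := Fintype.ofFinite _

/-- The arguments belonging to the `i`-th row, when the arguments indexed by the same block of `s`
are identified. -/
def rowArg {X : Type*} {n : L → ℕ} (s : Setoid (Σ i, Fin (n i))) (y : Quotient s → X) (i : L) :
    Fin (n i) → X := fun j => y (Quotient.mk s ⟨i, j⟩)

theorem measurable_rowArg {X : Type*} [MeasurableSpace X] {n : L → ℕ}
    (s : Setoid (Σ i, Fin (n i))) : Measurable (rowArg (X := X) s) :=
  measurable_pi_lambda _ fun _ => measurable_pi_lambda _ fun _ => measurable_pi_apply _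

/-- Rows of distinct indices are the same as distinct indices for the blocks of a partition that
meets every row in at most one element. -/
def rowEmb (n : L → ℕ) (p : Σ s : RowSetoid n, Quotient s.1 ↪ ℕ) (i : L) : Fin (n i) ↪ ℕ :=
  ⟨fun j => p.2 (Quotient.mk p.1.1 ⟨i, j⟩), fun j j' h =>
    p.1.2 i j j' (Quotient.exact (p.2.injective h))⟩

theorem rowEmb_bijective (n : L → ℕ) : Function.Bijective (rowEmb n) := by
  constructor
  · rintro ⟨s, k⟩ ⟨s', k'⟩ h
    have h' (a : Σ i, Fin (n i)) : k (Quotient.mk s.1 a) = k' (Quotient.mk s'.1 a) :=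
      DFunLike.congr_fun (congrFun h a.1) a.2
    have hs : s = s' := by
      refine Subtype.ext (Setoid.ext fun a b => ?_)
      rw [← Quotient.eq (r := s.1), ← k.injective.eq_iff, h', h', k'.injective.eq_iff, Quotient.eq]
    subst hs
    congr 1
    ext q
    obtain ⟨a, rfl⟩ := Quotient.exists_rep q
    exact h' a
  · intro k
    refine ⟨⟨⟨Setoid.ker fun a : Σ i, Fin (n i) => k a.1 a.2, fun i j j' h =>
      (k i).injective h⟩, ⟨Setoid.kerLift _, Setoid.kerLift_injective _⟩⟩, ?_⟩
    rfl

variable [Fintype L] {X : Type*} [MeasurableSpace X]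

/-- Identifying the arguments in a block is the same as drawing them independently from the summand
with the index of the block, because this summand is a zero-one measure. -/
theorem pi_rowArg_preimage {n : L → ℕ} (κ : ℕ → Measure X) [∀ i, IsZeroOneMeasure (κ i)]
    (p : Σ s : RowSetoid n, Quotient s.1 ↪ ℕ) {B : ∀ i, Set (Fin (n i) → X)}
    (hB : ∀ i, MeasurableSet (B i)) :
    Measure.pi (fun q => κ (p.2 q)) (rowArg p.1.1 ⁻¹' Set.univ.pi B) =
      ∏ i, Measure.pi (fun j => κ (rowEmb n p i j)) (B i) := by
  obtain ⟨s, k⟩ := p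
  by_cases h : ∀ q, κ (k q) Set.univ = 1
  · have (q : Quotient s.1) : IsProbabilityMeasure (κ (k q)) := ⟨h q⟩
    dsimp only
    have e : rowArg s.1 ⁻¹' Set.univ.pi B =
        ⋂ i, (fun y => y ∘ fun j => Quotient.mk s.1 ⟨i, j⟩) ⁻¹' B i := by
      ext y
      simp only [Set.mem_preimage, Set.mem_univ_pi, Set.mem_iInter]
      rfl
    have hmp (i : L) := measurePreserving_comp_injective (fun q => κ (k q))
      (φ := fun j => Quotient.mk s.1 ⟨i, j⟩) fun j j' hj => s.2 i j j' (Quotient.exact hj)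
    rw [e, IsZeroOneMeasure.measure_iInter_eq_prod _ fun i => (hmp i).measurable (hB i)]
    exact Finset.prod_congr rfl fun i _ => (hmp i).measure_preimage (hB i).nullMeasurableSet
  · push Not at h
    obtain ⟨q, hq⟩ := h
    have h0 : κ (k q) Set.univ = 0 := ((κ (k q)).zero_one _).resolve_right hq
    have e1 : Measure.pi (fun q => κ (k q)) = 0 := by
      rw [← Measure.measure_univ_eq_zero, Measure.pi_univ]
      exact Finset.prod_eq_zero (Finset.mem_univ q) h0
    obtain ⟨⟨i, j⟩, rfl⟩ := Quotient.exists_rep q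
    have e2 : Measure.pi (fun j => κ (rowEmb n ⟨s, k⟩ i j)) = 0 := by
      rw [← Measure.measure_univ_eq_zero, Measure.pi_univ]
      exact Finset.prod_eq_zero (Finset.mem_univ j) h0
    rw [e1, Finset.prod_eq_zero (Finset.mem_univ i) (by rw [e2]; rfl)]
    rfl

/-- The product formula: a product of factorial measures is a sum, over the partitions whose blocks
meet every row in at most one element, of factorial measures on diagonals. -/
theorem pi_facPi {n : L → ℕ} (κ : ℕ → Measure X) [∀ i, IsZeroOneMeasure (κ i)]
    [∀ i, SigmaFinite (facPi κ (Fin (n i)))] :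
    Measure.pi (fun i => facPi κ (Fin (n i))) =
      ∑ s : RowSetoid n, (facPi κ (Quotient s.1)).map (rowArg s.1) := by
  refine Measure.pi_eq fun B hB => ?_
  have h1 (s : RowSetoid n) : (facPi κ (Quotient s.1)).map (rowArg s.1) (Set.univ.pi B) =
      ∑' k : Quotient s.1 ↪ ℕ, Measure.pi (fun q => κ (k q)) (rowArg s.1 ⁻¹' Set.univ.pi B) := by
    rw [Measure.map_apply (measurable_rowArg _) (.univ_pi hB), facPi,
      Measure.sum_apply _ (measurable_rowArg _ (.univ_pi hB))]
  rw [Measure.coe_finsetSum, Finset.sum_apply, Finset.sum_congr rfl fun s _ => h1 s,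
    ← tsum_fintype (L := .unconditional _), ← ENNReal.tsum_sigma' fun p : Σ s : RowSetoid n, Quotient s.1 ↪ ℕ =>
      Measure.pi (fun q => κ (p.2 q)) (rowArg p.1.1 ⁻¹' Set.univ.pi B)]
  have h2 (i : L) : facPi κ (Fin (n i)) (B i) =
      ∑' k : Fin (n i) ↪ ℕ, Measure.pi (fun j => κ (k j)) (B i) := by
    rw [facPi, Measure.sum_apply _ (hB i)]
  rw [Finset.prod_congr rfl fun i _ => h2 i, ENNReal.prod_tsum,
    ← (Equiv.ofBijective _ (rowEmb_bijective n)).tsum_eq]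
  exact tsum_congr fun p => pi_rowArg_preimage κ p hB

end RowSetoids

/-! ### Mixed moments of U-statistics -/

section Moments

variable {X Ω L : Type*} [MeasurableSpace X] [MeasurableSpace Ω] {P : Measure Ω}
  {κ : Ω → ℕ → Measure X} {ν : Measure X} [SigmaFinite ν]

theorem IsPoissonSum.sigmaFinite_facPi (h : IsPoissonSum P κ ν) (ω : Ω) (ι : Type*) [Fintype ι] :
    SigmaFinite (facPi (κ ω) ι) := by
  have := h.zeroOne
  exact ⟨⟨⟨fun n => Set.univ.pi fun _ => spanningSets ν n, fun _ => trivial, fun n =>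
    (facPi_pi_ne_top (κ ω) (fun _ => measurableSet_spanningSets ν n)
      fun _ => h.finite ω n).lt_top, iUnion_pi_spanningSets ν ι⟩⟩⟩

/-- The multivariate Campbell formula for integrable functions. -/
theorem IsPoissonSum.integrable_facPi (h : IsPoissonSum P κ ν) {ι : Type*} [Fintype ι]
    {G : (ι → X) → ℝ} (hG : Integrable G (Measure.pi fun _ => ν)) :
    (∀ᵐ ω ∂P, Integrable G (facPi (κ ω) ι)) ∧
    Integrable (fun ω => ∫ x, G x ∂(facPi (κ ω) ι)) P ∧
    ∫ ω, ∫ x, G x ∂(facPi (κ ω) ι) ∂P = ∫ x, G x ∂(Measure.pi fun _ => ν) := by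
  have e : (h.kernel ι ∘ₖ Kernel.const Unit P) () = Measure.pi fun _ => ν := by
    rw [Kernel.comp_apply, Kernel.const_apply, h.bind_facPi]
  rw [← e] at hG ⊢
  have h1 := hG.ae_of_comp
  have h2 := hG.integral_comp
  have h3 := Kernel.integral_comp hG
  rw [Kernel.const_apply] at h1 h2 h3
  exact ⟨h1, h2, h3.symm⟩

variable [Fintype L] {n : L → ℕ}

/-- The tensor product of the functions `f i`, with arguments in the same block of `s`
identified. -/
def rowProd (f : ∀ i, (Fin (n i) → X) → ℝ) (s : Setoid (Σ i, Fin (n i))) (y : Quotient s → X) : ℝ :=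
  ∏ i, f i (rowArg s y i)

/-- The mixed moments of U-statistics: the product formula combined with Campbell's formula. -/
theorem IsPoissonSum.integral_prod (h : IsPoissonSum P κ ν) (f : ∀ i, (Fin (n i) → X) → ℝ)
    (hf : ∀ i, Measurable (f i))
    (hint : ∀ s : RowSetoid n, Integrable (rowProd f s.1) (Measure.pi fun _ => ν)) :
    Integrable (fun ω => ∏ i, ∫ x, f i x ∂(facPi (κ ω) (Fin (n i)))) P ∧
    ∫ ω, ∏ i, ∫ x, f i x ∂(facPi (κ ω) (Fin (n i))) ∂P =
      ∑ s : RowSetoid n, ∫ y, rowProd f s.1 y ∂(Measure.pi fun _ => ν) := by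
  have := h.zeroOne
  have hae : ∀ᵐ ω ∂P, ∏ i, ∫ x, f i x ∂(facPi (κ ω) (Fin (n i))) =
      ∑ s : RowSetoid n, ∫ y, rowProd f s.1 y ∂(facPi (κ ω) (Quotient s.1)) := by
    filter_upwards [ae_all_iff.2 fun s : RowSetoid n => (h.integrable_facPi (hint s)).1] with ω hω
    have (i : L) : SigmaFinite (facPi (κ ω) (Fin (n i))) := h.sigmaFinite_facPi ω _
    have hm : Measurable fun x : ∀ i, Fin (n i) → X => ∏ i, f i (x i) :=
      Finset.measurable_fun_prod _ fun i _ => (hf i).comp (measurable_pi_apply i)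
    rw [← integral_fintype_prod_eq_prod, pi_facPi, integral_finsetSum_measure]
    · refine Finset.sum_congr rfl fun s _ => ?_
      rw [integral_map (measurable_rowArg _).aemeasurable hm.aestronglyMeasurable]
      rfl
    · intro s _
      rw [integrable_map_measure hm.aestronglyMeasurable (measurable_rowArg _).aemeasurable]
      exact hω s
  constructor
  · refine (integrable_congr hae).2 (integrable_finsetSum _ fun s _ => ?_)
    exact (h.integrable_facPi (hint s)).2.1
  · rw [integral_congr_ae hae, integral_finsetSum _ fun s _ => (h.integrable_facPi (hint s)).2.1]
    exact Finset.sum_congr rfl fun s _ => (h.integrable_facPi (hint s)).2.2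

end Moments

/-! ### Extending partitions by singletons -/

section Extension

variable {A B C X : Type*}

/-- The partition of `A ≃ B ⊕ C` that extends the partition `t` of `B` by singletons. -/
def extSetoid (e : B ⊕ C ≃ A) (t : Setoid B) : Setoid A :=
  Setoid.ker fun a => Sum.map (Quotient.mk t) id (e.symm a)

theorem extSetoid_inl_inl (e : B ⊕ C ≃ A) (t : Setoid B) (x y : B) :
    extSetoid e t (e (.inl x)) (e (.inl y)) ↔ t x y := by
  change Sum.map (Quotient.mk t) id (e.symm (e (.inl x))) =
    Sum.map (Quotient.mk t) id (e.symm (e (.inl y))) ↔ _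
  simp only [Equiv.symm_apply_apply, Sum.map_inl, Sum.inl.injEq]
  exact Quotient.eq (r := t)

theorem extSetoid_inr (e : B ⊕ C ≃ A) (t : Setoid B) (c : C) (a : A) :
    extSetoid e t (e (.inr c)) a ↔ a = e (.inr c) := by
  obtain ⟨b, rfl⟩ := e.surjective a
  change Sum.map (Quotient.mk t) id (e.symm (e (.inr c))) =
    Sum.map (Quotient.mk t) id (e.symm (e b)) ↔ _
  simp only [Equiv.symm_apply_apply, Sum.map_inr, id]
  rcases b with b | b
  · simp
  · simp [eq_comm]

/-- A partition of `A ≃ B ⊕ C` under which the elements of `C` are singletons is determined by its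
restriction to `B`. -/
theorem extSetoid_comap (e : B ⊕ C ≃ A) (s : Setoid A)
    (hs : ∀ c a, s (e (.inr c)) a → a = e (.inr c)) :
    extSetoid e (s.comap fun x => e (.inl x)) = s := by
  refine Setoid.ext fun a b => ?_
  obtain ⟨a, rfl⟩ := e.surjective a
  obtain ⟨b, rfl⟩ := e.surjective b
  rcases a with a | a
  · rcases b with b | b
    · rw [extSetoid_inl_inl]; rfl
    · rw [Setoid.comm' (extSetoid _ _), extSetoid_inr, Setoid.comm' s]
      exact ⟨fun h => by rw [h], fun h => hs _ _ h⟩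
  · rw [extSetoid_inr]
    exact ⟨fun h => by rw [h], fun h => hs _ _ h⟩

theorem comap_extSetoid (e : B ⊕ C ≃ A) (t : Setoid B) :
    (extSetoid e t).comap (fun x => e (.inl x)) = t :=
  Setoid.ext fun x y => extSetoid_inl_inl e t x y

/-- The blocks of the extended partition. -/
noncomputable def extQuotientEquiv (e : B ⊕ C ≃ A) (t : Setoid B) :
    Quotient (extSetoid e t) ≃ Quotient t ⊕ C :=
  Setoid.quotientKerEquivOfSurjective _ <|
    (Sum.map_surjective.2 ⟨Quotient.mk_surjective, Function.surjective_id⟩).comp e.symm.surjective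

variable [MeasurableSpace X]

/-- A point of `X ^ C` and a point indexed by the blocks of `t` form a point indexed by the blocks
of the extended partition. -/
noncomputable def extGlue (e : B ⊕ C ≃ A) (t : Setoid B) :
    (Quotient t → X) × (C → X) ≃ᵐ (Quotient (extSetoid e t) → X) :=
  (MeasurableEquiv.sumPiEquivProdPi fun _ => X).symm.trans
    (MeasurableEquiv.piCongrLeft (fun _ => X) (extQuotientEquiv e t).symm)

theorem extGlue_mk (e : B ⊕ C ≃ A) (t : Setoid B) (z : (Quotient t → X) × (C → X)) (a : A) :
    extGlue e t z (Quotient.mk _ a) =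
      Sum.elim (fun b => z.1 (Quotient.mk t b)) z.2 (e.symm a) := by
  have h : (Quotient.mk _ a : Quotient (extSetoid e t)) =
      (extQuotientEquiv e t).symm (Sum.map (Quotient.mk t) id (e.symm a)) := by
    rw [Equiv.eq_symm_apply]; rfl
  rw [h, extGlue, MeasurableEquiv.trans_apply, MeasurableEquiv.coe_piCongrLeft,
    Equiv.piCongrLeft_apply_apply]
  rcases e.symm a with b | c <;> rfl

variable [Finite A] [Finite B] [Fintype C]

theorem measurePreserving_extGlue (ν : Measure X) [SigmaFinite ν] (e : B ⊕ C ≃ A)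
    (t : Setoid B) :
    MeasurePreserving (extGlue e t) ((Measure.pi fun _ : Quotient t => ν).prod
      (Measure.pi fun _ : C => ν)) (Measure.pi fun _ : Quotient (extSetoid e t) => ν) :=
  (measurePreserving_piCongrLeft (fun _ => ν) (extQuotientEquiv e t).symm).comp
    (measurePreserving_sumPiEquivProdPi_symm fun _ : Quotient t ⊕ C => ν)

end Extension

section Curry

variable {L X : Type*} [Fintype L] [MeasurableSpace X] {α : L → Type*} [∀ i, Fintype (α i)]

theorem measurePreserving_piCurry (ν : Measure X) [SigmaFinite ν] :
    MeasurePreserving (MeasurableEquiv.piCurry fun (i : L) (_ : α i) => X)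
      (Measure.pi fun _ => ν) (Measure.pi fun i => Measure.pi fun _ : α i => ν) := by
  refine MeasurePreserving.symm (MeasurableEquiv.piCurry fun (i : L) (_ : α i) => X).symm
    ⟨MeasurableEquiv.measurable _, (Measure.pi_eq fun s hs => ?_).symm⟩
  rw [Measure.map_apply (MeasurableEquiv.measurable _) (.univ_pi hs)]
  have : (MeasurableEquiv.piCurry fun (i : L) (_ : α i) => X).symm ⁻¹' Set.univ.pi s =
      Set.univ.pi fun i => Set.univ.pi fun j => s ⟨i, j⟩ := by
    ext y
    simp only [Set.mem_preimage, Set.mem_univ_pi]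
    exact ⟨fun h i j => h ⟨i, j⟩, fun h a => h a.1 a.2⟩
  rw [this, Measure.pi_pi, Fintype.prod_sigma]
  simp only [Measure.pi_pi]

theorem integral_prod_curry (ν : Measure X) [SigmaFinite ν] (G : ∀ i, (α i → X) → ℝ) :
    ∫ y : (Σ i, α i) → X, ∏ i, G i (fun j => y ⟨i, j⟩) ∂(Measure.pi fun _ => ν) =
      ∏ i, ∫ x, G i x ∂(Measure.pi fun _ => ν) := by
  rw [← integral_fintype_prod_eq_prod]
  exact (measurePreserving_piCurry ν).integral_comp' (g := fun x => ∏ i, G i (x i))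

end Curry

/-! ### Moments of centred U-statistics -/

section SubRows

variable {L X : Type*} {n : L → ℕ}

open Classical in
/-- The rows in `J` and the remaining rows. -/
noncomputable def rowsEquiv (n : L → ℕ) (J : Finset L) :
    (Σ i : J, Fin (n i)) ⊕ (Σ i : {i // i ∉ J}, Fin (n i)) ≃ Σ i, Fin (n i) where
  toFun := Sum.elim (fun a => ⟨a.1, a.2⟩) fun a => ⟨a.1, a.2⟩
  invFun a := if h : a.1 ∈ J then .inl ⟨⟨a.1, h⟩, a.2⟩ else .inr ⟨⟨a.1, h⟩, a.2⟩
  left_inv a := by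
    rcases a with ⟨⟨i, hi⟩, j⟩ | ⟨⟨i, hi⟩, j⟩
    · simp [hi]
    · simp [hi]
  right_inv a := by
    dsimp only
    split_ifs <;> rfl

theorem rowsEquiv_symm_of_mem {J : Finset L} {i : L} (h : i ∈ J) (j : Fin (n i)) :
    (rowsEquiv n J).symm ⟨i, j⟩ = .inl ⟨⟨i, h⟩, j⟩ := by
  rw [Equiv.symm_apply_eq]; rfl

theorem rowsEquiv_symm_of_notMem {J : Finset L} {i : L} (h : i ∉ J) (j : Fin (n i)) :
    (rowsEquiv n J).symm ⟨i, j⟩ = .inr ⟨⟨i, h⟩, j⟩ := by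
  rw [Equiv.symm_apply_eq]; rfl

/-- The elements of the `i`-th row are singletons of the partition `s`. -/
def IsSingletonRow (s : Setoid (Σ i, Fin (n i))) (i : L) : Prop :=
  ∀ (j : Fin (n i)) (a : Σ i, Fin (n i)), s ⟨i, j⟩ a → a = ⟨i, j⟩

/-- The extension of a partition of the rows in `J` by singletons in the remaining rows. -/
noncomputable def extRow (J : Finset L) (t : RowSetoid fun i : J => n i) : RowSetoid n :=
  ⟨extSetoid (rowsEquiv n J) t.1, fun i j j' h => by
    by_cases hi : i ∈ J
    · exact t.2 ⟨i, hi⟩ j j' ((extSetoid_inl_inl (rowsEquiv n J) t.1 _ _).1 h)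
    · have := (extSetoid_inr (rowsEquiv n J) t.1 ⟨⟨i, hi⟩, j⟩ _).1 h
      exact (eq_of_heq (Sigma.mk.inj this).2).symm⟩

open Classical in
theorem sum_extRow [Fintype L] (J : Finset L) (G : RowSetoid n → ℝ) :
    ∑ t : RowSetoid (fun i : J => n i), G (extRow J t) =
      ∑ s : RowSetoid n with ∀ i, i ∉ J → IsSingletonRow s.1 i, G s := by
  refine Finset.sum_bij (fun t _ => extRow J t) (fun t _ => ?_) (fun t _ t' _ h => ?_)
    (fun s hs => ?_) fun _ _ => rfl
  · rw [Finset.mem_filter]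
    exact ⟨Finset.mem_univ _, fun i hi j a h =>
      (extSetoid_inr (rowsEquiv n J) t.1 ⟨⟨i, hi⟩, j⟩ _).1 h⟩
  · have h' := congrArg (fun s : RowSetoid n => s.1.comap fun x => rowsEquiv n J (.inl x)) h
    simp only [extRow, comap_extSetoid] at h'
    exact Subtype.ext h'
  · rw [Finset.mem_filter] at hs
    refine ⟨⟨s.1.comap fun x => rowsEquiv n J (.inl x), fun i j j' h => s.2 i.1 j j' h⟩,
      Finset.mem_univ _, Subtype.ext ?_⟩
    exact extSetoid_comap _ _ fun c a h => hs.2 c.1 c.1.2 c.2 a h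

variable [Fintype L] [DecidableEq L] [MeasurableSpace X]

theorem rowProd_extRow (J : Finset L) (t : RowSetoid fun i : J => n i)
    (f : ∀ i, (Fin (n i) → X) → ℝ)
    (z : (Quotient t.1 → X) × ((Σ i : {i // i ∉ J}, Fin (n i)) → X)) :
    rowProd f (extSetoid (rowsEquiv n J) t.1) (extGlue (rowsEquiv n J) t.1 z) =
      rowProd (fun i : J => f i) t.1 z.1 * ∏ i : {i // i ∉ J}, f i fun j => z.2 ⟨i, j⟩ := by
  simp only [rowProd]
  rw [← Fintype.prod_subtype_mul_prod_subtype (· ∈ J)]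
  congr 1
  · refine Finset.prod_congr (by ext; simp) fun i _ => congrArg (f i) (funext fun j => ?_)
    refine (extGlue_mk _ _ _ _).trans ?_
    rw [rowsEquiv_symm_of_mem i.2]
    rfl
  · refine Finset.prod_congr rfl fun i _ => congrArg (f i) (funext fun j => ?_)
    refine (extGlue_mk _ _ _ _).trans ?_
    rw [rowsEquiv_symm_of_notMem i.2]
    rfl

variable {ν : Measure X} [SigmaFinite ν]

theorem integral_rowProd_extRow (J : Finset L) (t : RowSetoid fun i : J => n i)
    (f : ∀ i, (Fin (n i) → X) → ℝ) :
    ∫ y, rowProd f (extRow J t).1 y ∂(Measure.pi fun _ => ν) =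
      (∫ y, rowProd (fun i : J => f i) t.1 y ∂(Measure.pi fun _ => ν)) *
        ∏ i : {i // i ∉ J}, ∫ x, f i x ∂(Measure.pi fun _ => ν) := by
  rw [← integral_prod_curry ν (fun i : {i // i ∉ J} => f i), ← integral_prod_mul]
  refine ((measurePreserving_extGlue ν (rowsEquiv n J) t.1).integral_comp' _).symm.trans ?_
  exact integral_congr_ae (ae_of_all _ fun z => rowProd_extRow J t f z)

/-- If no kernel vanishes almost everywhere, the integrability of the diagonal products for all
rows is inherited by any set of rows: the remaining rows can be taken as singletons, and then
split off as nonzero factors. -/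
theorem integrable_rowProd_sub (f : ∀ i, (Fin (n i) → X) → ℝ)
    (h0 : ∀ i, ¬ f i =ᵐ[Measure.pi fun _ => ν] 0)
    (hint : ∀ s : RowSetoid n, Integrable (rowProd f s.1) (Measure.pi fun _ => ν))
    (hf1 : ∀ i, Integrable (f i) (Measure.pi fun _ => ν))
    (J : Finset L) (t : RowSetoid fun i : J => n i) :
    Integrable (rowProd (fun i : J => f i) t.1) (Measure.pi fun _ => ν) := by
  have h := ((measurePreserving_extGlue ν (rowsEquiv n J) t.1).integrable_comp_emb
    (MeasurableEquiv.measurableEmbedding _)).2 (hint (extRow J t))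
  have h' : Integrable (fun z : (Quotient t.1 → X) × ((Σ i : {i // i ∉ J}, Fin (n i)) → X) =>
      rowProd (fun i : J => f i) t.1 z.1 * ∏ i : {i // i ∉ J}, f i fun j => z.2 ⟨i, j⟩)
      ((Measure.pi fun _ => ν).prod (Measure.pi fun _ => ν)) :=
    h.congr (ae_of_all _ fun z => rowProd_extRow J t f z)
  have h2 := h'.prod_left_ae
  -- For almost every `y`, the first factor is integrable or the second one vanishes at `y`.
  by_contra hcon
  have h3 : ∀ᵐ y : (Σ i : {i // i ∉ J}, Fin (n i)) → X ∂(Measure.pi fun _ => ν),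
      ∏ i : {i // i ∉ J}, |f i fun j => y ⟨i, j⟩| = 0 := by
    filter_upwards [h2] with y hy
    rw [← Finset.abs_prod, abs_eq_zero]
    by_contra hne
    exact hcon ((integrable_mul_const_iff (IsUnit.mk0 _ hne) _).1 hy)
  have h4 := integral_congr_ae h3
  rw [integral_prod_curry ν fun (i : {i // i ∉ J}) x => |f i x|, integral_zero,
    Finset.prod_eq_zero_iff] at h4
  obtain ⟨i, -, hi⟩ := h4
  rw [integral_eq_zero_iff_of_nonneg (fun _ => abs_nonneg _) (hf1 i).abs] at hi
  exact h0 i (hi.mono fun x hx => abs_eq_zero.1 hx)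

variable {Ω : Type*} [MeasurableSpace Ω] {P : Measure Ω} {κ : Ω → ℕ → Measure X}

open Classical in
/-- The moments of centred U-statistics: by inclusion and exclusion, only those partitions remain
which have no row consisting of singletons. -/
theorem IsPoissonSum.integral_prod_sub (h : IsPoissonSum P κ ν) (f : ∀ i, (Fin (n i) → X) → ℝ)
    (hf : ∀ i, Measurable (f i))
    (hint : ∀ (J : Finset L) (t : RowSetoid fun i : J => n i),
      Integrable (rowProd (fun i : J => f i) t.1) (Measure.pi fun _ => ν)) :
    Integrable (fun ω => ∏ i, (∫ x, f i x ∂(facPi (κ ω) (Fin (n i))) -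
      ∫ x, f i x ∂(Measure.pi fun _ => ν))) P ∧
    ∫ ω, ∏ i, (∫ x, f i x ∂(facPi (κ ω) (Fin (n i))) - ∫ x, f i x ∂(Measure.pi fun _ => ν)) ∂P =
      ∑ s : RowSetoid n with ∀ i, ¬ IsSingletonRow s.1 i,
        ∫ y, rowProd f s.1 y ∂(Measure.pi fun _ => ν) := by
  set a : L → ℝ := fun i => ∫ x, f i x ∂(Measure.pi fun _ => ν)
  set F : L → Ω → ℝ := fun i ω => ∫ x, f i x ∂(facPi (κ ω) (Fin (n i)))
  have hexp (ω : Ω) : ∏ i, (F i ω - a i) = ∑ J : Finset L,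
      (∏ i : J, F i ω) * ∏ i ∈ Finset.univ \ J, -a i := by
    simp only [sub_eq_add_neg, Finset.prod_add, Finset.powerset_univ]
    exact Finset.sum_congr rfl fun J _ => by rw [← Finset.prod_coe_sort J]
  have hJ (J : Finset L) := h.integral_prod (fun i : J => f i) (fun i => hf i) (hint J)
  -- The terms with a fixed partition `s` are collected in the form of an expanded product, which
  -- contains the factor `1 - 1` for each row of singletons.
  have hE (J : Finset L) : ∫ ω, (∏ i : J, F i ω) * ∏ i ∈ Finset.univ \ J, -a i ∂P =
      ∑ s : RowSetoid n, (∫ y, rowProd f s.1 y ∂(Measure.pi fun _ => ν)) *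
        ((∏ i ∈ J, 1) * ∏ i ∈ Finset.univ \ J, -(if IsSingletonRow s.1 i then 1 else 0)) := by
    have hcompl : ∏ i ∈ Finset.univ \ J, -a i =
        (∏ i ∈ Finset.univ \ J, (-1 : ℝ)) * ∏ i : {i // i ∉ J}, a i := by
      rw [← Finset.prod_subtype (Finset.univ \ J) (by simp) a, ← Finset.prod_mul_distrib]
      simp
    rw [integral_mul_const, (hJ J).2, hcompl, mul_left_comm, Finset.sum_mul,
      Finset.sum_congr rfl fun t _ => (integral_rowProd_extRow J t f).symm,
      sum_extRow J fun s => ∫ y, rowProd f s.1 y ∂(Measure.pi fun _ => ν), Finset.mul_sum,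
      Finset.sum_filter]
    refine Finset.sum_congr rfl fun s _ => ?_
    split_ifs with hs
    · rw [mul_comm, Finset.prod_const_one, one_mul]
      congr 1
      refine Finset.prod_congr rfl fun i hi => ?_
      rw [if_pos (hs i (by simpa using hi))]
    · push Not at hs
      obtain ⟨i, hi, hi'⟩ := hs
      rw [Finset.prod_eq_zero (s := Finset.univ \ J) (i := i) (by simpa using hi) (by simp [hi'])]
      simp
  have hI (J : Finset L) : Integrable (fun ω => (∏ i : J, F i ω) * ∏ i ∈ Finset.univ \ J, -a i) P :=
    (hJ J).1.mul_const _
  constructor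
  · exact (integrable_congr (ae_of_all _ hexp)).2 (integrable_finsetSum _ fun J _ => hI J)
  · rw [integral_congr_ae (ae_of_all _ hexp), integral_finsetSum _ fun J _ => hI J,
      Finset.sum_congr rfl fun J _ => hE J, Finset.sum_comm, Finset.sum_filter]
    refine Finset.sum_congr rfl fun s _ => ?_
    rw [← Finset.mul_sum, ← Finset.powerset_univ, ← Finset.prod_add]
    split_ifs with hs
    · simp [hs]
    · push Not at hs
      obtain ⟨i, hi⟩ := hs
      rw [Finset.prod_eq_zero (Finset.mem_univ i) (by simp [hi]), mul_zero]

end SubRows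

/-! ### The leading partitions -/

section Counting

variable {L : Type*} {n : L → ℕ}

/-- A partition into blocks with exactly two elements. -/
def IsPairSetoid {A : Type*} (t : Setoid A) : Prop := ∀ a, {b | t a b}.ncard = 2

theorem ncard_class_pos {A : Type*} [Finite A] (s : Setoid A) (a : A) : 0 < {b | s a b}.ncard :=
  (Set.ncard_pos (Set.toFinite _)).2 ⟨a, s.refl a⟩

theorem ncard_class_eq_one_iff {A : Type*} (s : Setoid A) (a : A) :
    {b | s a b}.ncard = 1 ↔ ∀ b, s a b → b = a := by
  rw [Set.ncard_eq_one]
  constructor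
  · rintro ⟨c, hc⟩ b hb
    have h1 : b ∈ {b | s a b} := hb
    have h2 : a ∈ {b | s a b} := s.refl a
    rw [hc] at h1 h2
    rw [Set.mem_singleton_iff] at h1 h2
    rw [h1, h2]
  · intro h
    exact ⟨a, Set.ext fun b => ⟨h b, fun hb => by rw [Set.mem_singleton_iff.1 hb]; exact s.refl a⟩⟩

theorem sum_ncard_class {A : Type*} [Fintype A] (s : Setoid A) :
    ∑ q : Quotient s, {b | Quotient.mk s b = q}.ncard = Fintype.card A := by
  classical
  rw [← Finset.card_univ, Finset.card_eq_sum_card_fiberwise (f := Quotient.mk s)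
    (t := Finset.univ) (by simp)]
  refine Finset.sum_congr rfl fun q _ => ?_
  rw [← Set.ncard_coe_finset]
  congr 1
  ext; simp

theorem setOf_mk_eq {A : Type*} (s : Setoid A) (a : A) :
    {b | Quotient.mk s b = Quotient.mk s a} = {b | s a b} := by
  ext b
  exact Quotient.eq.trans (Setoid.comm' s)

open Classical in
/-- The number of non-singleton elements is at most twice the excess of the number of elements
over the number of blocks, with equality only if all blocks have at most two elements. -/
theorem two_mul_card_quotient_add_le {A : Type*} [Fintype A] (s : Setoid A) :
    2 * Fintype.card (Quotient s) + (Finset.univ.filter fun a => {b | s a b}.ncard ≠ 1).card ≤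
      2 * Fintype.card A ∧
    (2 * Fintype.card (Quotient s) + (Finset.univ.filter fun a => {b | s a b}.ncard ≠ 1).card =
      2 * Fintype.card A → ∀ a, {b | s a b}.ncard ≤ 2) := by
  set c : Quotient s → ℕ := fun q => {b | Quotient.mk s b = q}.ncard
  have hc (a : A) : c (Quotient.mk s a) = {b | s a b}.ncard := by
    simp only [c, setOf_mk_eq]
  have hpos (q : Quotient s) : 0 < c q := by
    obtain ⟨a, rfl⟩ := Quotient.exists_rep q
    rw [hc]
    exact ncard_class_pos s a
  have hN : (Finset.univ.filter fun a => {b | s a b}.ncard ≠ 1).card =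
      ∑ q, if c q = 1 then 0 else c q := by
    rw [Finset.card_eq_sum_card_fiberwise (f := Quotient.mk s) (t := Finset.univ) (by simp)]
    refine Finset.sum_congr rfl fun q _ => ?_
    split_ifs with h
    · rw [Finset.card_eq_zero, Finset.filter_eq_empty_iff]
      rintro a ha rfl
      exact (Finset.mem_filter.1 ha).2 ((hc a).symm.trans h)
    · simp only [c]
      rw [← Set.ncard_coe_finset]
      congr 1
      ext a
      simp only [Finset.coe_filter, Finset.mem_filter, Finset.mem_univ, true_and]
      refine ⟨fun ha => ha.2, fun ha => ⟨?_, ha⟩⟩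
      have ha' : Quotient.mk s a = q := ha
      rw [← hc, ha']
      exact h
  -- In terms of the block sizes `c`, the claim is the sum of these inequalities over all blocks.
  have hle (q : Quotient s) : 2 + (if c q = 1 then 0 else c q) ≤ 2 * c q := by
    have := hpos q
    split_ifs <;> omega
  have h1 : ∑ q : Quotient s, (2 + if c q = 1 then 0 else c q) =
      2 * Fintype.card (Quotient s) + (Finset.univ.filter fun a => {b | s a b}.ncard ≠ 1).card := by
    rw [Finset.sum_add_distrib, hN, Finset.sum_const, Finset.card_univ, smul_eq_mul, mul_comm]
  have h2 : ∑ q : Quotient s, 2 * c q = 2 * Fintype.card A := by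
    rw [← Finset.mul_sum, sum_ncard_class]
  rw [← h1, ← h2]
  refine ⟨Finset.sum_le_sum fun q _ => hle q, fun h a => ?_⟩
  have := (Finset.sum_eq_sum_iff_of_le fun q _ => hle q).1 h (Quotient.mk s a) (Finset.mem_univ _)
  rw [hc] at this
  split_ifs at this <;> omega

theorem isSingletonRow_iff (s : Setoid (Σ i, Fin (n i))) (i : L) :
    IsSingletonRow s i ↔ ∀ j, {b | s ⟨i, j⟩ b}.ncard = 1 :=
  forall_congr' fun j => (ncard_class_eq_one_iff s ⟨i, j⟩).symm

/-- Splitting off the zeroth element of the `i`-th row. -/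
def splitZero (i : L) (k : Fin (n i)) : L ⊕ (Σ i, Fin (n i - 1)) :=
  if h : (k : ℕ) < 1 then .inl i else .inr ⟨i, ⟨k - 1, by omega⟩⟩

/-- The element `j i` of each row, and the remaining elements of the rows. -/
def pickEquiv (hn : ∀ i, 1 ≤ n i) (j : ∀ i, Fin (n i)) :
    L ⊕ (Σ i, Fin (n i - 1)) ≃ Σ i, Fin (n i) where
  toFun := Sum.elim (fun i => ⟨i, j i⟩) fun a =>
    ⟨a.1, Equiv.swap ⟨0, hn a.1⟩ (j a.1) ⟨a.2 + 1, by have := hn a.1; omega⟩⟩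
  invFun a := splitZero a.1 (Equiv.swap ⟨0, hn a.1⟩ (j a.1) a.2)
  left_inv a := by
    rcases a with i | ⟨i, k⟩
    · change splitZero i (Equiv.swap ⟨0, hn i⟩ (j i) (j i)) = _
      rw [Equiv.swap_apply_right]
      simp [splitZero]
    · change splitZero i (Equiv.swap ⟨0, hn i⟩ (j i) (Equiv.swap ⟨0, hn i⟩ (j i) _)) = _
      rw [Equiv.swap_apply_eq_iff.2 (rfl : Equiv.swap ⟨0, hn i⟩ (j i) ⟨k + 1, _⟩ = _)]
      simp [splitZero]
  right_inv a := by
    obtain ⟨i, k⟩ := a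
    dsimp only [splitZero]
    split_ifs with h
    · simp only [Sum.elim_inl, Sigma.mk.injEq, heq_eq_eq, true_and]
      have h0 : Equiv.swap ⟨0, hn i⟩ (j i) k = ⟨0, hn i⟩ := Fin.ext (by simpa using h)
      rw [Equiv.swap_apply_eq_iff, Equiv.swap_apply_left] at h0
      exact h0.symm
    · simp only [Sum.elim_inr, Sigma.mk.injEq, heq_eq_eq, true_and]
      rw [Equiv.swap_apply_eq_iff]
      exact Fin.ext (by simp only; omega)

theorem pickEquiv_inr_ne (hn : ∀ i, 1 ≤ n i) (j : ∀ i, Fin (n i)) (c : Σ i, Fin (n i - 1)) :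
    ∃ k, k ≠ j c.1 ∧ pickEquiv hn j (.inr c) = ⟨c.1, k⟩ := by
  refine ⟨_, ?_, rfl⟩
  rw [Ne, Equiv.swap_apply_eq_iff, Equiv.swap_apply_right]
  simp

/-- The partition that pairs the elements `j i` of the rows according to `t`. -/
def pickRow (hn : ∀ i, 1 ≤ n i) (j : ∀ i, Fin (n i)) (t : Setoid L) : RowSetoid n :=
  ⟨extSetoid (pickEquiv hn j) t, fun i k k' h => by
    by_contra hne
    have key : ∀ k k', k ≠ j i → extSetoid (pickEquiv hn j) t ⟨i, k⟩ ⟨i, k'⟩ → k = k' := by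
      intro k k' hk h
      obtain ⟨b, hb⟩ := (pickEquiv hn j).surjective ⟨i, k⟩
      rcases b with b | b
      · exact absurd (by obtain ⟨rfl, h⟩ := Sigma.mk.inj_iff.1 hb; exact (eq_of_heq h).symm) hk
      · rw [← hb, extSetoid_inr, hb] at h
        exact (eq_of_heq (Sigma.mk.inj_iff.1 h).2).symm
    by_cases hk : k = j i
    · exact hne (key k' k (fun h' => hne (hk.trans h'.symm)) ((extSetoid _ t).symm h)).symm
    · exact hne (key k k' hk h)⟩

theorem ncard_class_pickRow (hn : ∀ i, 1 ≤ n i) (j : ∀ i, Fin (n i)) (t : Setoid L) (i : L) :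
    {b | (pickRow hn j t).1 ⟨i, j i⟩ b}.ncard = {b | t i b}.ncard := by
  rw [← Set.ncard_image_of_injective {b | t i b} (f := fun b => (⟨b, j b⟩ : Σ i, Fin (n i)))
    fun i i' h => congrArg Sigma.fst h]
  congr 1
  ext a
  obtain ⟨b, rfl⟩ := (pickEquiv hn j).surjective a
  rcases b with b | c
  · exact (extSetoid_inl_inl (pickEquiv hn j) t i b).trans
      ⟨fun h => ⟨b, h, rfl⟩, fun ⟨b', h, e⟩ => by
        have e' : b' = b := congrArg Sigma.fst e
        rwa [← e']⟩
  · obtain ⟨k, hk, e⟩ := pickEquiv_inr_ne hn j c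
    constructor
    · intro h
      have h' := (extSetoid_inr (pickEquiv hn j) t c _).1 ((extSetoid _ t).symm h)
      rw [e] at h'
      obtain ⟨rfl, h'⟩ := Sigma.mk.inj_iff.1 h'
      exact absurd (eq_of_heq h').symm hk
    · rintro ⟨b, -, h'⟩
      dsimp only at h'
      rw [e] at h'
      obtain ⟨rfl, h'⟩ := Sigma.mk.inj_iff.1 h'
      exact absurd (eq_of_heq h').symm hk

theorem ncard_class_pickRow_of_ne (hn : ∀ i, 1 ≤ n i) (j : ∀ i, Fin (n i)) (t : Setoid L) (i : L)
    {k : Fin (n i)} (hk : k ≠ j i) : {b | (pickRow hn j t).1 ⟨i, k⟩ b}.ncard = 1 := by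
  rw [ncard_class_eq_one_iff]
  intro b h
  obtain ⟨a, ha⟩ := (pickEquiv hn j).surjective ⟨i, k⟩
  rcases a with a | c
  · obtain ⟨rfl, h'⟩ := Sigma.mk.inj_iff.1 ha
    exact absurd (eq_of_heq h').symm hk
  · rw [← ha] at h ⊢
    exact (extSetoid_inr (pickEquiv hn j) t c b).1 h

variable [Fintype L]

open Classical in
/-- A partition without rows of singletons has at most `|A| - ℓ / 2` blocks, where `ℓ` is the
number of rows. In the case of equality, each row has exactly one element that is not a singleton,
and this element belongs to a pair. -/
theorem two_mul_card_quotient_le (s : Setoid (Σ i, Fin (n i)))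
    (hs : ∀ i, ¬ IsSingletonRow s i) :
    2 * Fintype.card (Quotient s) + Fintype.card L ≤ 2 * Fintype.card (Σ i, Fin (n i)) ∧
    (2 * Fintype.card (Quotient s) + Fintype.card L = 2 * Fintype.card (Σ i, Fin (n i)) →
      ∃ j : ∀ i, Fin (n i), (∀ i, {b | s ⟨i, j i⟩ b}.ncard = 2) ∧
        ∀ i k, k ≠ j i → {b | s ⟨i, k⟩ b}.ncard = 1) := by
  have hex (i : L) : ∃ j : Fin (n i), {b | s ⟨i, j⟩ b}.ncard ≠ 1 := by
    have := hs i
    rw [isSingletonRow_iff] at this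
    push Not at this
    exact this
  choose j hj using hex
  -- The chosen elements `J` are among the non-singleton elements `N`.
  set N := Finset.univ.filter fun a => {b | s a b}.ncard ≠ 1 with hNdef
  set J : Finset (Σ i, Fin (n i)) := Finset.univ.image fun i => ⟨i, j i⟩ with hJ
  have hJN : J ⊆ N := by
    intro a ha
    obtain ⟨i, -, rfl⟩ := Finset.mem_image.1 ha
    exact Finset.mem_filter.2 ⟨Finset.mem_univ _, hj i⟩
  have hJcard : J.card = Fintype.card L := by
    rw [hJ, Finset.card_image_of_injective _ fun i i' h => congrArg Sigma.fst h, Finset.card_univ]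
  have hcard := Finset.card_le_card hJN
  obtain ⟨h1, h2⟩ := two_mul_card_quotient_add_le s
  rw [← hNdef] at h1 h2
  refine ⟨by omega, fun heq => ⟨j, fun i => ?_, fun i k hk => ?_⟩⟩
  · have := h2 (by omega) ⟨i, j i⟩
    have := hj i
    have := ncard_class_pos s ⟨i, j i⟩
    omega
  · have hNJ : J = N := Finset.eq_of_subset_of_card_le hJN (by omega)
    by_contra hne
    have : (⟨i, k⟩ : Σ i, Fin (n i)) ∈ J := by
      rw [hNJ]
      exact Finset.mem_filter.2 ⟨Finset.mem_univ _, hne⟩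
    obtain ⟨i', -, h⟩ := Finset.mem_image.1 this
    obtain ⟨rfl, h⟩ := Sigma.mk.inj_iff.1 h
    exact hk (eq_of_heq h).symm

theorem two_mul_card_pairQuotient {t : Setoid L} (ht : IsPairSetoid t) :
    2 * Fintype.card (Quotient t) = Fintype.card L := by
  rw [← sum_ncard_class t, Finset.sum_congr rfl (g := fun _ => 2), Finset.sum_const,
    Finset.card_univ, smul_eq_mul, mul_comm]
  intro q _
  obtain ⟨a, rfl⟩ := Quotient.exists_rep q
  rw [setOf_mk_eq]
  exact ht a

open Classical in
/-- The partitions with the maximal number of blocks among those without a row of singletons: they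
arise by choosing one element from each row and pairing the chosen elements. -/
theorem sum_leading (hn : ∀ i, 1 ≤ n i) (G : RowSetoid n → ℝ) :
    ∑ s : RowSetoid n with (∀ i, ¬ IsSingletonRow s.1 i) ∧
      2 * Fintype.card (Quotient s.1) + Fintype.card L = 2 * Fintype.card (Σ i, Fin (n i)), G s =
    ∑ j : ∀ i, Fin (n i), ∑ t : Setoid L with IsPairSetoid t, G (pickRow hn j t) := by
  rw [Finset.sum_sigma']
  symm
  refine Finset.sum_bij (fun p _ => pickRow hn p.1 p.2) ?_ ?_ ?_ fun _ _ => rfl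
  · rintro ⟨j, t⟩ hp
    simp only [Finset.mem_sigma, Finset.mem_filter, Finset.mem_univ, true_and] at hp ⊢
    refine ⟨fun i h => ?_, ?_⟩
    · have := (isSingletonRow_iff _ _).1 h (j i)
      rw [ncard_class_pickRow, hp i] at this
      omega
    · have h1 := Fintype.card_congr (extQuotientEquiv (pickEquiv hn j) t)
      have h2 := Fintype.card_congr (pickEquiv hn j)
      have h3 := two_mul_card_pairQuotient hp
      rw [Fintype.card_sum] at h1 h2
      have h4 : Fintype.card (Quotient (pickRow hn j t).1) =
        Fintype.card (Quotient (extSetoid (pickEquiv hn j) t)) := rfl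
      omega
  · rintro ⟨j, t⟩ hp ⟨j', t'⟩ hp' h
    simp only [Finset.mem_sigma, Finset.mem_filter, Finset.mem_univ, true_and] at hp hp' h
    have hj : j = j' := by
      funext i
      by_contra hne
      have h1 := ncard_class_pickRow hn j t i
      rw [h, ncard_class_pickRow_of_ne hn j' t' i hne, hp i] at h1
      omega
    subst hj
    have h' := congrArg (fun s : RowSetoid n => s.1.comap fun x => pickEquiv hn j (.inl x)) h
    simp only [pickRow, comap_extSetoid] at h'
    rw [h']
  · intro s hs
    simp only [Finset.mem_filter, Finset.mem_univ, true_and] at hs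
    obtain ⟨j, hj2, hj1⟩ := (two_mul_card_quotient_le s.1 hs.1).2 hs.2
    have hext : pickRow hn j (s.1.comap fun x => pickEquiv hn j (.inl x)) = s := by
      refine Subtype.ext (extSetoid_comap _ _ fun c a h => ?_)
      obtain ⟨k, hk, e⟩ := pickEquiv_inr_ne hn j c
      rw [e] at h ⊢
      exact (ncard_class_eq_one_iff _ _).1 (hj1 _ _ hk) a h
    refine ⟨⟨j, s.1.comap fun x => pickEquiv hn j (.inl x)⟩, ?_, hext⟩
    simp only [Finset.mem_sigma, Finset.mem_filter, Finset.mem_univ, true_and]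
    intro i
    rw [← ncard_class_pickRow hn j, hext]
    exact hj2 i

end Counting

/-! ### The limit of the mixed moments -/

section Leading

variable {L X : Type*} {n : L → ℕ} [Fintype L] [MeasurableSpace X] {lam : Measure X}

/-- The product of the functions `h i` at arguments identified according to `t`. -/
def pairProd (h : L → X → ℝ) (t : Setoid L) (y : Quotient t → X) : ℝ :=
  ∏ i, h i (y (Quotient.mk t i))

/-- The vector with first coordinate `x` and remaining coordinates `z`. -/
def consArg {m : ℕ} (x : X) (z : Fin (m - 1) → X) : Fin m → X :=
  fun k => if h : (k : ℕ) < 1 then x else z ⟨k - 1, by omega⟩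

/-- By symmetry, it does not matter which element of a row is picked. -/
theorem rowProd_pickRow (hn : ∀ i, 1 ≤ n i) (j : ∀ i, Fin (n i)) (t : Setoid L)
    (f : ∀ i, (Fin (n i) → X) → ℝ) (hf : ∀ i, IsSymmL1 lam (f i))
    (z : (Quotient t → X) × ((Σ i, Fin (n i - 1)) → X)) :
    rowProd f (extSetoid (pickEquiv hn j) t) (extGlue (pickEquiv hn j) t z) =
      ∏ i, f i (consArg (z.1 (Quotient.mk t i)) fun k => z.2 ⟨i, k⟩) := by
  simp only [rowProd]
  refine Finset.prod_congr rfl fun i _ => ?_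
  rw [← (hf i).symm (Equiv.swap ⟨0, hn i⟩ (j i)) (consArg _ _)]
  refine congrArg (f i) (funext fun k => ?_)
  refine (extGlue_mk _ _ _ _).trans ?_
  change Sum.elim _ _ (splitZero i (Equiv.swap ⟨0, hn i⟩ (j i) k)) =
    consArg _ _ (Equiv.swap ⟨0, hn i⟩ (j i) k)
  simp only [splitZero, consArg]
  split_ifs <;> rfl

theorem projKernel_one_eq {m : ℕ} (f : (Fin m → X) → ℝ) (x : X) :
    projKernel lam f 1 (fun _ => x) = m * ∫ z, f (consArg x z) ∂(Measure.pi fun _ => lam) := by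
  rw [projKernel, Nat.choose_one_right]
  rfl

theorem pairProd_projKernel (t : Setoid L) (f : ∀ i, (Fin (n i) → X) → ℝ) :
    pairProd (fun i x => projKernel lam (f i) 1 fun _ => x) t =
      fun y => (∏ i, (n i : ℝ)) *
        pairProd (fun i x => ∫ z, f i (consArg x z) ∂(Measure.pi fun _ => lam)) t y := by
  funext y
  simp only [pairProd, projKernel_one_eq, Finset.prod_mul_distrib]

variable [SigmaFinite lam]

theorem integrable_consArg
    (hn : ∀ i, 1 ≤ n i) (j : ∀ i, Fin (n i)) (t : Setoid L)
    (f : ∀ i, (Fin (n i) → X) → ℝ) (hf : ∀ i, IsSymmL1 lam (f i))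
    (hint : Integrable (rowProd f (pickRow hn j t).1) (Measure.pi fun _ => lam)) :
    Integrable (fun z : (Quotient t → X) × ((Σ i, Fin (n i - 1)) → X) =>
      ∏ i, f i (consArg (z.1 (Quotient.mk t i)) fun k => z.2 ⟨i, k⟩))
      ((Measure.pi fun _ => lam).prod (Measure.pi fun _ => lam)) := by
  have h := ((measurePreserving_extGlue lam (pickEquiv hn j) t).integrable_comp_emb
    (MeasurableEquiv.measurableEmbedding _)).2 hint
  exact h.congr (ae_of_all _ fun z => rowProd_pickRow hn j t f hf z)

theorem integrable_pairProd_pickRow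
    (hn : ∀ i, 1 ≤ n i) (j : ∀ i, Fin (n i)) (t : Setoid L)
    (f : ∀ i, (Fin (n i) → X) → ℝ) (hf : ∀ i, IsSymmL1 lam (f i))
    (hint : Integrable (rowProd f (pickRow hn j t).1) (Measure.pi fun _ => lam)) :
    Integrable (pairProd (fun i x => ∫ z, f i (consArg x z) ∂(Measure.pi fun _ => lam)) t)
      (Measure.pi fun _ => lam) := by
  refine (integrable_consArg hn j t f hf hint).integral_prod_left.congr (ae_of_all _ fun y => ?_)
  exact integral_prod_curry lam fun i z => f i (consArg (y (Quotient.mk t i)) z)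

theorem integral_rowProd_pickRow
    (hn : ∀ i, 1 ≤ n i) (j : ∀ i, Fin (n i)) (t : Setoid L)
    (f : ∀ i, (Fin (n i) → X) → ℝ) (hf : ∀ i, IsSymmL1 lam (f i))
    (hint : Integrable (rowProd f (pickRow hn j t).1) (Measure.pi fun _ => lam)) :
    ∫ y, rowProd f (pickRow hn j t).1 y ∂(Measure.pi fun _ => lam) =
      ∫ y, pairProd (fun i x => ∫ z, f i (consArg x z) ∂(Measure.pi fun _ => lam)) t y
        ∂(Measure.pi fun _ => lam) := by
  refine ((measurePreserving_extGlue lam (pickEquiv hn j) t).integral_comp' _).symm.trans ?_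
  refine (integral_congr_ae (ae_of_all _ fun z => rowProd_pickRow hn j t f hf z)).trans ?_
  rw [integral_prod _ (integrable_consArg hn j t f hf hint)]
  refine integral_congr_ae (ae_of_all _ fun y => ?_)
  exact integral_prod_curry lam fun i z => f i (consArg (y (Quotient.mk t i)) z)

theorem integrable_pairProd_projKernel (hn : ∀ i, 1 ≤ n i) (t : Setoid L)
    (f : ∀ i, (Fin (n i) → X) → ℝ) (hf : ∀ i, IsSymmL1 lam (f i))
    (hint : ∀ s : RowSetoid n, Integrable (rowProd f s.1) (Measure.pi fun _ => lam)) :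
    Integrable (pairProd (fun i x => projKernel lam (f i) 1 fun _ => x) t)
      (Measure.pi fun _ => lam) := by
  rw [pairProd_projKernel]
  exact (integrable_pairProd_pickRow hn (fun i => ⟨0, hn i⟩) t f hf (hint _)).const_mul _

instance instSigmaFinite_ofReal_smul (t : ℝ) : SigmaFinite (ENNReal.ofReal t • lam) :=
  inferInstanceAs (SigmaFinite (t.toNNReal • lam))

theorem pi_ofReal_smul (t : ℝ) (ι : Type*) [Fintype ι] :
    Measure.pi (fun _ : ι => ENNReal.ofReal t • lam) =
      ENNReal.ofReal t ^ Fintype.card ι • Measure.pi fun _ => lam := by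
  refine Measure.pi_eq fun s _ => ?_
  simp [Finset.prod_mul_distrib, Measure.pi_pi]

theorem integral_pi_ofReal_smul {t : ℝ} (ht : 0 ≤ t) {ι : Type*} [Fintype ι] (G : (ι → X) → ℝ) :
    ∫ y, G y ∂(Measure.pi fun _ : ι => ENNReal.ofReal t • lam) =
      t ^ Fintype.card ι * ∫ y, G y ∂(Measure.pi fun _ => lam) := by
  rw [pi_ofReal_smul, integral_smul_measure, ENNReal.toReal_pow, ENNReal.toReal_ofReal ht,
    smul_eq_mul]

theorem integrable_pi_ofReal_smul (t : ℝ) {ι : Type*} [Fintype ι] {G : (ι → X) → ℝ}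
    (hG : Integrable G (Measure.pi fun _ => lam)) :
    Integrable G (Measure.pi fun _ : ι => ENNReal.ofReal t • lam) := by
  rw [pi_ofReal_smul]
  exact hG.smul_measure (by finiteness)

theorem prod_rpow_sub_half (n : L → ℕ) {t : ℝ} (ht : 0 < t) :
    ∏ i, t ^ ((n i : ℝ) - 1 / 2) =
      t ^ ((Fintype.card (Σ i, Fin (n i)) : ℝ) - (Fintype.card L : ℝ) / 2) := by
  rw [← Real.rpow_sum_of_pos ht]
  congr 1
  simp [Fintype.card_sigma, Finset.sum_sub_distrib, div_eq_mul_inv]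

open Classical in
/-- Each partition `s` contributes a term of order `t ^ |s|`; after normalization only the leading
partitions survive in the limit. -/
theorem tendsto_sum_rowProd (hn : ∀ i, 1 ≤ n i)
    (f : ∀ i, (Fin (n i) → X) → ℝ) (hf : ∀ i, IsSymmL1 lam (f i))
    (hint : ∀ s : RowSetoid n, Integrable (rowProd f s.1) (Measure.pi fun _ => lam)) :
    Tendsto (fun t : ℝ => (∑ s : RowSetoid n with ∀ i, ¬ IsSingletonRow s.1 i,
        ∫ y, rowProd f s.1 y ∂(Measure.pi fun _ => ENNReal.ofReal t • lam)) /
        ∏ i, t ^ ((n i : ℝ) - 1 / 2)) atTop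
      (𝓝 (∑ t : Setoid L with IsPairSetoid t,
        ∫ y, pairProd (fun i x => projKernel lam (f i) 1 fun _ => x) t y
          ∂(Measure.pi fun _ => lam))) := by
  have hlim : ∑ t : Setoid L with IsPairSetoid t,
        ∫ y, pairProd (fun i x => projKernel lam (f i) 1 fun _ => x) t y
          ∂(Measure.pi fun _ => lam) =
      ∑ s : RowSetoid n with ∀ i, ¬ IsSingletonRow s.1 i,
        (if 2 * Fintype.card (Quotient s.1) + Fintype.card L = 2 * Fintype.card (Σ i, Fin (n i))
          then 1 else 0) * ∫ y, rowProd f s.1 y ∂(Measure.pi fun _ => lam) := by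
    simp only [ite_mul, one_mul, zero_mul]
    rw [← Finset.sum_filter, Finset.filter_filter, sum_leading hn, Finset.sum_comm]
    refine Finset.sum_congr rfl fun t _ => ?_
    rw [Finset.sum_congr rfl fun j _ => integral_rowProd_pickRow hn j t f hf (hint _),
      Finset.sum_const, pairProd_projKernel, integral_const_mul, Finset.card_univ, Fintype.card_pi]
    simp
  rw [hlim]
  simp only [Finset.sum_div]
  refine tendsto_finsetSum _ fun s hs => ?_
  have hs' := (Finset.mem_filter.1 hs).2
  have hle := (two_mul_card_quotient_le s.1 hs').1
  have heq : (fun t : ℝ => t ^ ((Fintype.card (Quotient s.1) : ℝ) -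
      ((Fintype.card (Σ i, Fin (n i)) : ℝ) - (Fintype.card L : ℝ) / 2)) *
      ∫ y, rowProd f s.1 y ∂(Measure.pi fun _ => lam)) =ᶠ[atTop] fun t : ℝ =>
      (∫ y, rowProd f s.1 y ∂(Measure.pi fun _ => ENNReal.ofReal t • lam)) /
        ∏ i, t ^ ((n i : ℝ) - 1 / 2) := by
    filter_upwards [eventually_gt_atTop 0] with t ht
    rw [integral_pi_ofReal_smul ht.le, prod_rpow_sub_half n ht, Real.rpow_sub ht,
      Real.rpow_natCast]
    ring
  refine Tendsto.congr' heq (Tendsto.mul_const _ ?_)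
  split_ifs with h
  · have : (Fintype.card (Quotient s.1) : ℝ) -
      ((Fintype.card (Σ i, Fin (n i)) : ℝ) - (Fintype.card L : ℝ) / 2) = 0 := by
      have : (2 * Fintype.card (Quotient s.1) + Fintype.card L : ℝ) =
        2 * Fintype.card (Σ i, Fin (n i)) := by exact_mod_cast h
      linarith
    simp only [this, Real.rpow_zero]
    exact tendsto_const_nhds
  · have hlt : (2 * Fintype.card (Quotient s.1) + Fintype.card L : ℝ) <
        2 * Fintype.card (Σ i, Fin (n i)) := by exact_mod_cast lt_of_le_of_ne hle h
    have := tendsto_rpow_neg_atTop (y := -((Fintype.card (Quotient s.1) : ℝ) -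
      ((Fintype.card (Σ i, Fin (n i)) : ℝ) - (Fintype.card L : ℝ) / 2))) (by linarith)
    simpa only [neg_neg] using this

end Leading

/-! ### Cumulants as functions of the moments -/

section Cumulants

variable {ι : Type*} [DecidableEq ι]

/-- The joint cumulants, indexed by the sets `I` containing a distinguished element `i₀`, as
functions of the joint moments `M`. They are determined by the recursion
`M I = ∑ b, cumulantOf b * M (I \ b)`, where `b` ranges over the subsets of `I` containing `i₀`. -/
noncomputable def cumulantOf (M : Finset ι → ℂ) (i₀ : ι) (I : Finset ι) : ℂ :=
  (M I - ∑ b ∈ (I.ssubsets.filter fun b => i₀ ∈ b).attach,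
    cumulantOf M i₀ b.1 * M (I \ b.1)) / M ∅
termination_by I.card
decreasing_by
  exact Finset.card_lt_card (Finset.mem_ssubsets.1 (Finset.mem_filter.1 b.2).1)

theorem cumulantOf_eq (M : Finset ι → ℂ) (i₀ : ι) (I : Finset ι) :
    cumulantOf M i₀ I = (M I - ∑ b ∈ I.ssubsets with i₀ ∈ b,
      cumulantOf M i₀ b * M (I \ b)) / M ∅ := by
  rw [cumulantOf, Finset.sum_attach _ fun b => cumulantOf M i₀ b * M (I \ b)]

theorem cumulantOf_singleton (M : Finset ι → ℂ) (i₀ : ι) :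
    cumulantOf M i₀ {i₀} = M {i₀} / M ∅ := by
  rw [cumulantOf_eq, Finset.sum_eq_zero, sub_zero]
  intro b hb
  simp at hb
  simp [hb.1] at hb

/-- Multiplying the `i`-th random variable by `w i` multiplies the cumulants accordingly. -/
theorem cumulantOf_prod_mul (M : Finset ι → ℂ) (w : ι → ℂ) (i₀ : ι) (I : Finset ι) :
    cumulantOf (fun J => (∏ i ∈ J, w i) * M J) i₀ I = (∏ i ∈ I, w i) * cumulantOf M i₀ I := by
  induction I using Finset.strongInduction with
  | H I ih =>
    rw [cumulantOf_eq, cumulantOf_eq M, Finset.prod_empty, one_mul, ← mul_div_assoc, mul_sub,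
      Finset.mul_sum]
    congr 2
    refine Finset.sum_congr rfl fun b hb => ?_
    have hb' := Finset.mem_ssubsets.1 (Finset.mem_filter.1 hb).1
    rw [ih b hb', ← Finset.prod_sdiff hb'.1]
    ring

theorem tendsto_cumulantOf {β : Type*} {l : Filter β} {M : β → Finset ι → ℂ} {m : Finset ι → ℂ}
    (hM : ∀ I, Tendsto (fun t => M t I) l (𝓝 (m I))) (h0 : m ∅ ≠ 0) (i₀ : ι) (I : Finset ι) :
    Tendsto (fun t => cumulantOf (M t) i₀ I) l (𝓝 (cumulantOf m i₀ I)) := by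
  induction I using Finset.strongInduction with
  | H I ih =>
    simp only [cumulantOf_eq _ i₀ I]
    refine ((hM I).sub (tendsto_finsetSum _ fun b hb => ?_)).div (hM ∅) h0
    exact (ih b (Finset.mem_ssubsets.1 (Finset.mem_filter.1 hb).1)).mul (hM _)

theorem sum_ssubsets_insert {i₀ j : ι} {I : Finset ι} (hi : i₀ ∈ I) (hj : j ∉ I)
    (g : Finset ι → ℂ) :
    ∑ b ∈ (insert j I).ssubsets with i₀ ∈ b, g b =
      (∑ b ∈ I.ssubsets with i₀ ∈ b, (g (insert j b) + g b)) + g I := by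
  have hne : i₀ ≠ j := fun h => hj (h ▸ hi)
  have h1 (K : Finset ι) (hK : i₀ ∈ K) (g : Finset ι → ℂ) : ∑ b ∈ K.ssubsets with i₀ ∈ b, g b =
      (∑ b ∈ K.powerset, if i₀ ∈ b then g b else 0) - g K := by
    rw [Finset.sum_filter, Finset.ssubsets, ← Finset.sum_erase_add _ _ (Finset.mem_powerset_self K),
      if_pos hK, add_sub_cancel_right]
  rw [h1 _ (Finset.mem_insert_of_mem hi), h1 _ hi, Finset.sum_powerset_insert hj,
    ← Finset.sum_add_distrib]
  have h2 : ∀ b ∈ I.powerset, ((if i₀ ∈ b then g b else 0) +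
      if i₀ ∈ insert j b then g (insert j b) else 0) =
      if i₀ ∈ b then g (insert j b) + g b else 0 := by
    intro b _
    by_cases hb : i₀ ∈ b
    · rw [if_pos hb, if_pos (Finset.mem_insert_of_mem hb), if_pos hb, add_comm]
    · have : i₀ ∉ insert j b := by simp [hb, hne]
      rw [if_neg hb, if_neg this, if_neg hb, add_zero]
  rw [Finset.sum_congr rfl h2]
  ring

/-- If differentiation in the direction `j` adds `j` to the index set of the moments, it does the
same for the cumulants. -/
theorem hasDerivAt_cumulantOf {ψ : Finset ι → ℝ → ℂ} {j i₀ : ι}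
    (hψ : ∀ I, j ∉ I → HasDerivAt (ψ I) (ψ (insert j I) 0) 0) (h0 : ψ ∅ 0 ≠ 0)
    {I : Finset ι} (hi : i₀ ∈ I) (hj : j ∉ I) :
    HasDerivAt (fun s => cumulantOf (fun J => ψ J s) i₀ I)
      (cumulantOf (fun J => ψ J 0) i₀ (insert j I)) 0 := by
  induction I using Finset.strongInduction with
  | H I ih =>
    have hfun : (fun s => cumulantOf (fun J => ψ J s) i₀ I) = fun s =>
        (ψ I s - ∑ b ∈ I.ssubsets with i₀ ∈ b, cumulantOf (fun J => ψ J s) i₀ b * ψ (I \ b) s) /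
          ψ ∅ s := by
      funext s
      rw [cumulantOf_eq]
    have hsum : HasDerivAt (fun s => ∑ b ∈ I.ssubsets with i₀ ∈ b,
        cumulantOf (fun J => ψ J s) i₀ b * ψ (I \ b) s)
        (∑ b ∈ I.ssubsets with i₀ ∈ b, (cumulantOf (fun J => ψ J 0) i₀ (insert j b) * ψ (I \ b) 0 +
          cumulantOf (fun J => ψ J 0) i₀ b * ψ (insert j (I \ b)) 0)) 0 := by
      refine HasDerivAt.fun_sum fun b hb => ?_
      obtain ⟨hb, hib⟩ := Finset.mem_filter.1 hb
      have hb' := Finset.mem_ssubsets.1 hb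
      exact (ih b hb' hib fun h => hj (hb'.1 h)).mul
        (hψ (I \ b) fun h => hj (Finset.sdiff_subset h))
    have hD := ((hψ I hj).sub hsum).div (hψ ∅ (Finset.notMem_empty j)) h0
    rw [hfun]
    refine hD.congr_deriv ?_
    have hK := cumulantOf_eq (fun J => ψ J 0) i₀ I
    rw [eq_div_iff h0] at hK
    simp only [Pi.sub_apply]
    rw [← hK, cumulantOf_eq _ _ (insert j I), sum_ssubsets_insert hi hj,
      Finset.insert_sdiff_of_notMem _ hj, sdiff_self, Finset.bot_eq_empty]
    have hrw : ∀ b ∈ (I.ssubsets.filter fun b => i₀ ∈ b),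
        cumulantOf (fun J => ψ J 0) i₀ (insert j b) * ψ (insert j I \ insert j b) 0 +
          cumulantOf (fun J => ψ J 0) i₀ b * ψ (insert j I \ b) 0 =
        cumulantOf (fun J => ψ J 0) i₀ (insert j b) * ψ (I \ b) 0 +
          cumulantOf (fun J => ψ J 0) i₀ b * ψ (insert j (I \ b)) 0 := by
      intro b hb
      have hb' := Finset.mem_ssubsets.1 (Finset.mem_filter.1 hb).1
      rw [Finset.insert_sdiff_of_notMem _ fun h => hj (hb'.1 h), Finset.insert_sdiff_insert,
        Finset.sdiff_insert, Finset.erase_eq_of_notMem fun h => hj (Finset.sdiff_subset h)]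
    rw [Finset.sum_congr rfl hrw]
    field_simp
    ring

/-- If the moments satisfy Wick's recursion, only the cumulants of order two can be nonzero. -/
theorem cumulantOf_of_wick [Fintype ι] (m : Finset ι → ℂ) (i₀ : ι) (c : ι → ℂ) (h0 : m ∅ = 1)
    (hm : ∀ I, i₀ ∈ I → m I = ∑ j ∈ Finset.univ.erase i₀ with j ∈ I, c j * m (I \ {i₀, j}))
    (I : Finset ι) (hI : i₀ ∈ I) :
    cumulantOf m i₀ I = ∑ j ∈ Finset.univ.erase i₀, if I = {i₀, j} then c j else 0 := by
  induction I using Finset.strongInduction with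
  | H I ih =>
    rw [cumulantOf_eq, h0, div_one]
    have h1 : ∑ b ∈ I.ssubsets with i₀ ∈ b, cumulantOf m i₀ b * m (I \ b) =
        ∑ b ∈ I.ssubsets with i₀ ∈ b, ∑ j ∈ Finset.univ.erase i₀,
          if b = {i₀, j} then c j * m (I \ {i₀, j}) else 0 := by
      refine Finset.sum_congr rfl fun b hb => ?_
      obtain ⟨hb, hib⟩ := Finset.mem_filter.1 hb
      rw [ih b (Finset.mem_ssubsets.1 hb) hib, Finset.sum_mul]
      refine Finset.sum_congr rfl fun j _ => ?_
      split_ifs with h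
      · rw [h]
      · rw [zero_mul]
    rw [h1, Finset.sum_comm, hm I hI, Finset.sum_filter, ← Finset.sum_sub_distrib]
    refine Finset.sum_congr rfl fun j hj => ?_
    have h2 : ∑ b ∈ I.ssubsets with i₀ ∈ b,
        (if b = {i₀, j} then c j * m (I \ {i₀, j}) else 0) =
        if ({i₀, j} : Finset ι) ⊂ I then c j * m (I \ {i₀, j}) else 0 := by
      rw [Finset.sum_ite_eq']
      simp
    rw [h2]
    by_cases hjI : j ∈ I
    · have hsub : ({i₀, j} : Finset ι) ⊆ I := by
        intro x hx
        rcases Finset.mem_insert.1 hx with rfl | hx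
        · exact hI
        · rwa [Finset.mem_singleton.1 hx]
      by_cases heq : I = {i₀, j}
      · rw [if_pos hjI, if_neg (by rw [heq]; exact fun h => h.2 subset_rfl), if_pos heq, heq,
          sdiff_self, Finset.bot_eq_empty, h0, mul_one, sub_zero]
      · rw [if_pos hjI, if_pos (hsub.ssubset_of_ne fun h => heq h.symm), if_neg heq, sub_self]
    · rw [if_neg hjI, if_neg fun h => hjI (h.1 (by simp)), if_neg fun h => hjI (by rw [h]; simp),
        sub_self]

end Cumulants

/-! ### Mixed partial derivatives of the logarithm of the characteristic function -/

section MixedPartial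

variable {ℓ : ℕ}

/-- If the functions `Φ I` are obtained from `Φ ∅` by differentiating in the directions `i ∈ I`,
then the mixed partial derivatives of `log (Φ ∅)` are the cumulants built from the `Φ I`. -/
theorem foldr_lineDeriv_log (Φ : Finset (Fin ℓ) → (Fin ℓ → ℝ) → ℂ) (U : Set (Fin ℓ → ℝ))
    (hU : IsOpen U) (hslit : ∀ z ∈ U, Φ ∅ z ∈ Complex.slitPlane)
    (hΦ : ∀ I, ∀ j ∉ I, ∀ z, HasLineDerivAt ℝ (Φ I) (Φ (insert j I) z) z (Pi.single j 1))
    (i₀ : Fin ℓ) (l : List (Fin ℓ)) (hl : (l ++ [i₀]).Nodup) :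
    ∀ z ∈ U, (l ++ [i₀]).foldr (fun i H z => lineDeriv ℝ H z (Pi.single i (1 : ℝ)))
      (fun z => Complex.log (Φ ∅ z)) z = cumulantOf (fun I => Φ I z) i₀ (l ++ [i₀]).toFinset := by
  induction l with
  | nil =>
    intro z hz
    have h1 : HasDerivAt (fun t : ℝ => Φ ∅ (z + t • Pi.single i₀ 1)) (Φ {i₀} z) 0 :=
      hΦ ∅ i₀ (Finset.notMem_empty _) z
    have h2 := h1.clog_real (by simpa using hslit z hz)
    simp only [zero_smul, add_zero] at h2
    simp only [List.nil_append, List.foldr_cons, List.foldr_nil, List.toFinset_cons,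
      List.toFinset_nil, insert_empty_eq]
    rw [cumulantOf_singleton]
    exact HasLineDerivAt.lineDeriv h2
  | cons a l ih =>
    intro z hz
    rw [List.cons_append, List.nodup_cons] at hl
    specialize ih hl.2
    rw [List.cons_append, List.foldr_cons, List.toFinset_cons]
    have ha : a ∉ (l ++ [i₀]).toFinset := by simpa [and_comm] using hl.1
    have h1 := hasDerivAt_cumulantOf (ψ := fun I s => Φ I (z + s • Pi.single a 1)) (j := a)
      (i₀ := i₀) (I := (l ++ [i₀]).toFinset) (fun I hI => by
        simp only [zero_smul, add_zero]
        exact hΦ I a hI z)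
      (by simpa using Complex.slitPlane_ne_zero (hslit z hz)) (by simp) ha
    simp only [zero_smul, add_zero] at h1
    have h2 : HasLineDerivAt ℝ (fun w => cumulantOf (fun I => Φ I w) i₀ (l ++ [i₀]).toFinset)
      (cumulantOf (fun I => Φ I z) i₀ (insert a (l ++ [i₀]).toFinset)) z (Pi.single a 1) := h1
    refine (h2.congr_of_eventuallyEq ?_).lineDeriv
    filter_upwards [hU.mem_nhds hz] with w hw using ih w hw

/-- A mixed partial derivative vanishes for a function that does not depend on one of the
variables. -/
theorem foldr_lineDeriv_of_invariant (G : (Fin ℓ → ℝ) → ℂ) (i : Fin ℓ)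
    (hG : ∀ z (s : ℝ), G (z + s • Pi.single i 1) = G z) (l : List (Fin ℓ)) :
    (∀ z (s : ℝ), l.foldr (fun i H z => lineDeriv ℝ H z (Pi.single i (1 : ℝ))) G
      (z + s • Pi.single i 1) =
      l.foldr (fun i H z => lineDeriv ℝ H z (Pi.single i (1 : ℝ))) G z) ∧
    (i ∈ l → l.foldr (fun i H z => lineDeriv ℝ H z (Pi.single i (1 : ℝ))) G = fun _ => 0) := by
  induction l with
  | nil => exact ⟨hG, fun h => absurd h List.not_mem_nil⟩
  | cons a l ih =>
    obtain ⟨ih1, ih2⟩ := ih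
    simp only [List.foldr_cons]
    set H := l.foldr (fun i H z => lineDeriv ℝ H z (Pi.single i (1 : ℝ))) G
    refine ⟨fun z s => ?_, fun h => ?_⟩
    · simp only [lineDeriv]
      congr 1
      funext t
      rw [add_right_comm, ih1]
    · funext z
      rcases List.mem_cons.1 h with rfl | h
      · simp only [lineDeriv, ih1, deriv_const]
      · rw [ih2 h]
        simp [lineDeriv]

end MixedPartial

section CharFun

variable {ℓ : ℕ} {Ω : Type*}

/-- The exponential `exp (𝐢 (z₁ Y₁ + ⋯ + z_ℓ Y_ℓ))`. -/
noncomputable def charExp (Y : Fin ℓ → Ω → ℝ) (z : Fin ℓ → ℝ) (ω : Ω) : ℂ :=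
  Complex.exp (Complex.I * ((∑ i, z i * Y i ω : ℝ) : ℂ))

theorem norm_charExp (Y : Fin ℓ → Ω → ℝ) (z : Fin ℓ → ℝ) (ω : Ω) : ‖charExp Y z ω‖ = 1 := by
  rw [charExp, mul_comm, Complex.norm_exp_ofReal_mul_I]

variable [MeasurableSpace Ω] {P : Measure Ω}

/-- The derivative of the characteristic function of `Y` in the directions `i ∈ I`. -/
noncomputable def charDeriv (P : Measure Ω) (Y : Fin ℓ → Ω → ℝ) (I : Finset (Fin ℓ))
    (z : Fin ℓ → ℝ) : ℂ :=
  ∫ ω, (∏ i ∈ I, Complex.I * (Y i ω : ℂ)) * charExp Y z ω ∂P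

theorem aestronglyMeasurable_charExp {Y : Fin ℓ → Ω → ℝ} (hY : ∀ i, AEStronglyMeasurable (Y i) P)
    (z : Fin ℓ → ℝ) : AEStronglyMeasurable (charExp Y z) P := by
  have h : AEStronglyMeasurable (fun ω => ∑ i, z i * Y i ω) P :=
    Finset.aestronglyMeasurable_fun_sum _ fun i _ => (hY i).const_mul _
  exact (by fun_prop : Continuous fun x : ℝ => Complex.exp (Complex.I * (x : ℂ))).comp_aestronglyMeasurable h

/-- The joint cumulant vanishes if one of the random variables vanishes almost surely. -/
theorem jointCumulant_eq_zero {Y : Fin ℓ → Ω → ℝ} {i : Fin ℓ} (hi : ∀ᵐ ω ∂P, Y i ω = 0) :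
    jointCumulant P Y = 0 := by
  rw [jointCumulant, mixedPartial, (foldr_lineDeriv_of_invariant _ i (fun z s => ?_) _).2
    (List.mem_finRange i), mul_zero]
  congr 1
  refine integral_congr_ae (hi.mono fun ω hω => ?_)
  have : ∑ k, (z + s • Pi.single i (1 : ℝ) : Fin ℓ → ℝ) k * Y k ω = ∑ k, z k * Y k ω := by
    simp [add_mul, Finset.sum_add_distrib, Pi.single_apply, hω]
  simp only [this]

theorem integrable_prod_mul_charExp {Y : Fin ℓ → Ω → ℝ} (hY : ∀ i, AEStronglyMeasurable (Y i) P)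
    (hint : ∀ I : Finset (Fin ℓ), Integrable (fun ω => ∏ i ∈ I, Y i ω) P) (I : Finset (Fin ℓ))
    (z : Fin ℓ → ℝ) : Integrable (fun ω => (∏ i ∈ I, Complex.I * (Y i ω : ℂ)) * charExp Y z ω) P := by
  have h1 : Integrable (fun ω => ∏ i ∈ I, Complex.I * (Y i ω : ℂ)) P := by
    have := (hint I).ofReal (𝕜 := ℂ) |>.const_mul (Complex.I ^ I.card)
    refine this.congr (ae_of_all _ fun ω => ?_)
    simp [Finset.prod_mul_distrib]
  exact h1.mul_bdd (aestronglyMeasurable_charExp hY z)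
    (ae_of_all _ fun ω => (norm_charExp Y z ω).le)

theorem hasDerivAt_integral_of_norm_le {F F' : ℝ → Ω → ℂ} {b : Ω → ℝ}
    (hF : ∀ s, Integrable (F s) P) (hF' : ∀ s, Integrable (F' s) P) (hb : Integrable b P)
    (hle : ∀ s ω, ‖F' s ω‖ ≤ b ω) (hderiv : ∀ s ω, HasDerivAt (fun s => F s ω) (F' s ω) s) :
    HasDerivAt (fun s => ∫ ω, F s ω ∂P) (∫ ω, F' 0 ω ∂P) 0 :=
  (hasDerivAt_integral_of_dominated_loc_of_deriv_le (s := Set.univ) univ_mem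
    (Eventually.of_forall fun s => (hF s).1) (hF 0) (hF' 0).1
    (ae_of_all _ fun ω s _ => hle s ω) hb (ae_of_all _ fun ω s _ => hderiv s ω)).2

/-- Differentiation under the integral sign, with the product of the `|Y i|` as dominating
function. -/
theorem hasLineDerivAt_charDeriv {Y : Fin ℓ → Ω → ℝ} (hY : ∀ i, AEStronglyMeasurable (Y i) P)
    (hint : ∀ I : Finset (Fin ℓ), Integrable (fun ω => ∏ i ∈ I, Y i ω) P) (I : Finset (Fin ℓ))
    (j : Fin ℓ) (hj : j ∉ I) (z : Fin ℓ → ℝ) :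
    HasLineDerivAt ℝ (charDeriv P Y I) (charDeriv P Y (insert j I) z) z (Pi.single j 1) := by
  have hexp (s : ℝ) (ω : Ω) : charExp Y (z + s • Pi.single j 1) ω =
      Complex.exp (Complex.I * (((∑ i, z i * Y i ω : ℝ) : ℂ) + s * Y j ω)) := by
    rw [charExp]
    congr 2
    have : ∑ i, (z + s • Pi.single j (1 : ℝ) : Fin ℓ → ℝ) i * Y i ω =
        ∑ i, z i * Y i ω + s * Y j ω := by
      simp [add_mul, Finset.sum_add_distrib, Pi.single_apply]
    rw [this]
    push_cast
    ring
  have hbound (s : ℝ) (ω : Ω) : ‖(∏ i ∈ insert j I, Complex.I * (Y i ω : ℂ)) *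
      charExp Y (z + s • Pi.single j 1) ω‖ ≤ ‖∏ i ∈ insert j I, Y i ω‖ := by
    rw [norm_mul, norm_charExp, mul_one, norm_prod, norm_prod]
    refine (Finset.prod_congr rfl fun i _ => ?_).le
    rw [norm_mul, Complex.norm_I, one_mul, Complex.norm_real]
  have hderiv (s : ℝ) (ω : Ω) : HasDerivAt
      (fun s : ℝ => (∏ i ∈ I, Complex.I * (Y i ω : ℂ)) * charExp Y (z + s • Pi.single j 1) ω)
      ((∏ i ∈ insert j I, Complex.I * (Y i ω : ℂ)) * charExp Y (z + s • Pi.single j 1) ω) s := by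
    simp only [hexp]
    rw [Finset.prod_insert hj]
    have h1 : HasDerivAt (fun s : ℝ => Complex.I * (((∑ i, z i * Y i ω : ℝ) : ℂ) + s * Y j ω))
        (Complex.I * (Y j ω : ℂ)) s := by
      have h2 : HasDerivAt (fun s : ℝ => (s : ℂ)) 1 s := Complex.ofRealCLM.hasDerivAt
      simpa using ((h2.mul_const (Y j ω : ℂ)).const_add _).const_mul Complex.I
    refine (h1.cexp.const_mul _).congr_deriv ?_
    ring
  have hFint (J : Finset (Fin ℓ)) (s : ℝ) := integrable_prod_mul_charExp hY hint J
    (z + s • Pi.single j (1 : ℝ))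
  have hmain : HasDerivAt (fun s : ℝ => charDeriv P Y I (z + s • Pi.single j (1 : ℝ)))
      (charDeriv P Y (insert j I) (z + (0 : ℝ) • Pi.single j (1 : ℝ))) 0 :=
    hasDerivAt_integral_of_norm_le (hFint I) (hFint (insert j I)) (hint (insert j I)).norm
      hbound hderiv
  rw [zero_smul, add_zero] at hmain
  exact hmain

variable [IsProbabilityMeasure P]

theorem continuous_charDeriv_empty {Y : Fin ℓ → Ω → ℝ} (hY : ∀ i, AEStronglyMeasurable (Y i) P) :
    Continuous (charDeriv P Y ∅) := by
  unfold charDeriv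
  simp only [Finset.prod_empty, one_mul]
  refine continuous_of_dominated (bound := fun _ => 1) (aestronglyMeasurable_charExp hY)
    (fun z => ae_of_all _ fun ω => (norm_charExp Y z ω).le) (integrable_const _)
    (ae_of_all _ fun ω => ?_)
  unfold charExp
  fun_prop

/-- The joint cumulant, defined through the characteristic function, is the corresponding function
of the joint moments. -/
theorem jointCumulant_eq {ℓ : ℕ} {Y : Fin (ℓ + 1) → Ω → ℝ}
    (hY : ∀ i, AEStronglyMeasurable (Y i) P)
    (hint : ∀ I : Finset (Fin (ℓ + 1)), Integrable (fun ω => ∏ i ∈ I, Y i ω) P) :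
    jointCumulant P Y =
      cumulantOf (fun I => ((∫ ω, ∏ i ∈ I, Y i ω ∂P : ℝ) : ℂ)) (Fin.last ℓ) Finset.univ := by
  have h0 : charDeriv P Y ∅ 0 = 1 := by simp [charDeriv, charExp]
  have hlist : List.finRange (ℓ + 1) =
      (List.finRange ℓ).map Fin.castSucc ++ [Fin.last ℓ] := List.finRange_succ_last
  have key := foldr_lineDeriv_log (charDeriv P Y) (charDeriv P Y ∅ ⁻¹' Complex.slitPlane)
    (Complex.isOpen_slitPlane.preimage (continuous_charDeriv_empty hY)) (fun z hz => hz)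
    (hasLineDerivAt_charDeriv hY hint) (Fin.last ℓ) ((List.finRange ℓ).map Fin.castSucc)
    (by rw [← hlist]; exact List.nodup_finRange _) 0
    (by rw [Set.mem_preimage, h0]; exact Complex.one_mem_slitPlane)
  rw [← hlist, List.toFinset_finRange] at key
  have hfun : (fun z : Fin (ℓ + 1) → ℝ => Complex.log (charDeriv P Y ∅ z)) =
      fun z => Complex.log (∫ ω, Complex.exp (Complex.I * ((∑ i, z i * Y i ω : ℝ) : ℂ)) ∂P) := by
    funext z
    simp [charDeriv, charExp]
  rw [hfun] at key
  rw [jointCumulant, mixedPartial, key]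
  have hmom : (fun I => charDeriv P Y I 0) = fun I =>
      (∏ i ∈ I, Complex.I) * ((∫ ω, ∏ i ∈ I, Y i ω ∂P : ℝ) : ℂ) := by
    funext I
    rw [← integral_complex_ofReal, ← integral_const_mul]
    refine integral_congr_ae (ae_of_all _ fun ω => ?_)
    simp [charExp, Finset.prod_mul_distrib]
  rw [hmom, cumulantOf_prod_mul _ fun _ => Complex.I]
  rw [Finset.prod_const, Finset.card_univ, Fintype.card_fin, ← mul_assoc, ← mul_pow]
  simp

end CharFun

/-! ### Perfect matchings and Wick's recursion -/

section Wick

variable {ι : Type*}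

open Classical in
/-- The partitions of the finite set `I` into blocks of size two, written as sets of blocks. -/
noncomputable def matchings (I : Finset ι) : Finset (Finset (Finset ι)) :=
  {p ∈ I.powerset.powerset | (∀ b ∈ p, b.card = 2) ∧ ∀ i ∈ I, ∃! b, b ∈ p ∧ i ∈ b}

theorem mem_matchings {I : Finset ι} {p : Finset (Finset ι)} :
    p ∈ matchings I ↔
      (∀ b ∈ p, b ⊆ I) ∧ (∀ b ∈ p, b.card = 2) ∧ ∀ i ∈ I, ∃! b, b ∈ p ∧ i ∈ b := by
  classical
  simp only [matchings, Finset.mem_filter, Finset.mem_powerset, Finset.subset_iff (s₁ := p)]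

theorem matchings_empty : matchings (∅ : Finset ι) = {∅} := by
  ext p
  rw [mem_matchings, Finset.mem_singleton]
  refine ⟨fun h => ?_, fun h => by simp [h]⟩
  rw [Finset.eq_empty_iff_forall_notMem]
  intro b hb
  have h1 := h.2.1 b hb
  rw [Finset.subset_empty.1 (h.1 b hb)] at h1
  simp at h1

theorem insert_mem_matchings [DecidableEq ι] {I : Finset ι} {i j : ι} (hi : i ∈ I) (hj : j ∈ I) (hij : i ≠ j)
    {p : Finset (Finset ι)} (hp : p ∈ matchings (I \ {i, j})) :
    insert {i, j} p ∈ matchings I := by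
  rw [mem_matchings] at hp ⊢
  obtain ⟨h1, h2, h3⟩ := hp
  refine ⟨fun b hb => ?_, fun b hb => ?_, fun k hk => ?_⟩
  · rcases Finset.mem_insert.1 hb with rfl | hb
    · simp [Finset.insert_subset_iff, hi, hj]
    · exact (h1 b hb).trans Finset.sdiff_subset
  · rcases Finset.mem_insert.1 hb with rfl | hb
    · exact Finset.card_pair hij
    · exact h2 b hb
  · by_cases hk' : k ∈ ({i, j} : Finset ι)
    · refine ⟨{i, j}, ⟨Finset.mem_insert_self _ _, hk'⟩, fun b ⟨hb, hkb⟩ => ?_⟩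
      rcases Finset.mem_insert.1 hb with rfl | hb
      · rfl
      · exact absurd hk' (Finset.mem_sdiff.1 (h1 b hb hkb)).2
    · obtain ⟨b, ⟨hb, hkb⟩, hu⟩ := h3 k (Finset.mem_sdiff.2 ⟨hk, hk'⟩)
      refine ⟨b, ⟨Finset.mem_insert_of_mem hb, hkb⟩, fun b' ⟨hb', hkb'⟩ => ?_⟩
      rcases Finset.mem_insert.1 hb' with rfl | hb'
      · exact absurd hkb' hk'
      · exact hu b' ⟨hb', hkb'⟩

theorem pair_notMem_of_mem_matchings [DecidableEq ι] {I : Finset ι} {i j : ι}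
    {p : Finset (Finset ι)} (hp : p ∈ matchings (I \ {i, j})) : {i, j} ∉ p := fun h =>
  (Finset.mem_sdiff.1 ((mem_matchings.1 hp).1 _ h (Finset.mem_insert_self i _))).2
    (Finset.mem_insert_self _ _)

theorem erase_mem_matchings [DecidableEq ι] {I : Finset ι} {i j : ι} {p : Finset (Finset ι)}
    (hp : p ∈ matchings I) (hij : {i, j} ∈ p) : p.erase {i, j} ∈ matchings (I \ {i, j}) := by
  rw [mem_matchings] at hp ⊢
  obtain ⟨h1, h2, h3⟩ := hp
  refine ⟨fun b hb k hk => ?_, fun b hb => h2 b (Finset.mem_of_mem_erase hb), fun k hk => ?_⟩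
  · have hb' := Finset.mem_erase.1 hb
    refine Finset.mem_sdiff.2 ⟨h1 b hb'.2 hk, fun hk' => hb'.1 ?_⟩
    exact (h3 k (h1 b hb'.2 hk)).unique ⟨hb'.2, hk⟩ ⟨hij, hk'⟩
  · obtain ⟨hk, hk'⟩ := Finset.mem_sdiff.1 hk
    obtain ⟨b, ⟨hb, hkb⟩, hu⟩ := h3 k hk
    refine ⟨b, ⟨Finset.mem_erase.2 ⟨?_, hb⟩, hkb⟩, fun b' ⟨hb', hkb'⟩ =>
      hu b' ⟨Finset.mem_of_mem_erase hb', hkb'⟩⟩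
    rintro rfl
    exact hk' hkb

/-- The sum over all perfect matchings of `I`, split according to the partner `j` of a fixed
element `i`. -/
theorem sum_matchings [DecidableEq ι] {R : Type*} [CommSemiring R] (c : Finset ι → R) {I : Finset ι} {i : ι}
    (hi : i ∈ I) :
    ∑ p ∈ matchings I, ∏ b ∈ p, c b =
      ∑ j ∈ I.erase i, c {i, j} * ∑ p ∈ matchings (I \ {i, j}), ∏ b ∈ p, c b := by
  simp only [Finset.mul_sum]
  rw [Finset.sum_sigma']
  symm
  refine Finset.sum_bij (fun a _ => insert {i, a.1} a.2) ?_ ?_ ?_ ?_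
  · rintro ⟨j, p⟩ h
    obtain ⟨hj, hp⟩ := Finset.mem_sigma.1 h
    obtain ⟨hji, hj⟩ := Finset.mem_erase.1 hj
    exact insert_mem_matchings hi hj (Ne.symm hji) hp
  · rintro ⟨j, p⟩ h ⟨j', p'⟩ h' heq
    obtain ⟨hj, hp⟩ := Finset.mem_sigma.1 h
    obtain ⟨hj', hp'⟩ := Finset.mem_sigma.1 h'
    simp only at hj hp hj' hp' heq
    have h1 := insert_mem_matchings hi (Finset.mem_of_mem_erase hj)
      (Finset.ne_of_mem_erase hj).symm hp
    have h2 : ({i, j} : Finset ι) = {i, j'} :=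
      ((mem_matchings.1 h1).2.2 i hi).unique ⟨Finset.mem_insert_self _ _, by simp⟩
        ⟨heq ▸ Finset.mem_insert_self _ _, by simp⟩
    obtain rfl : j = j' := by
      have : j ∈ ({i, j'} : Finset ι) := h2 ▸ by simp
      simpa [Finset.ne_of_mem_erase hj] using this
    have h3 := congrArg (fun q => q.erase {i, j}) heq
    simp only [Finset.erase_insert (pair_notMem_of_mem_matchings hp),
      Finset.erase_insert (pair_notMem_of_mem_matchings hp')] at h3
    rw [h3]
  · intro p hp
    obtain ⟨b, ⟨hb, hib⟩, -⟩ := (mem_matchings.1 hp).2.2 i hi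
    have hcard := (mem_matchings.1 hp).2.1 b hb
    obtain ⟨j, hj⟩ := Finset.card_eq_one.1
      (by rw [Finset.card_erase_of_mem hib, hcard] : (b.erase i).card = 1)
    obtain rfl : b = {i, j} := by rw [← Finset.insert_erase hib, hj]
    have hji : j ≠ i := Finset.ne_of_mem_erase (hj ▸ Finset.mem_singleton_self j)
    have hjI : j ∈ I := (mem_matchings.1 hp).1 _ hb (by simp)
    exact ⟨⟨j, p.erase {i, j}⟩, Finset.mem_sigma.2 ⟨Finset.mem_erase.2 ⟨hji, hjI⟩,
      erase_mem_matchings hp hb⟩, Finset.insert_erase hb⟩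
  · rintro ⟨j, p⟩ h
    exact (Finset.prod_insert (pair_notMem_of_mem_matchings (Finset.mem_sigma.1 h).2)).symm

open Classical in
/-- The block of a partition of `I` that is the class `q`, as a subset of the ambient type. -/
noncomputable def classBlock {I : Finset ι} (t : Setoid I) (q : Quotient t) : Finset ι :=
  ({a | Quotient.mk t a = q} : Finset I).map (Function.Embedding.subtype _)

theorem coe_mem_classBlock {I : Finset ι} {t : Setoid I} {q : Quotient t} {a : I} :
    (a : ι) ∈ classBlock t q ↔ Quotient.mk t a = q := by
  simp [classBlock]

theorem mem_classBlock {I : Finset ι} {t : Setoid I} {q : Quotient t} {i : ι} :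
    i ∈ classBlock t q ↔ ∃ h : i ∈ I, Quotient.mk t ⟨i, h⟩ = q := by
  simp [classBlock]

theorem classBlock_injective {I : Finset ι} (t : Setoid I) :
    Function.Injective (classBlock t) := by
  intro q q' h
  induction q using Quotient.inductionOn with | h a =>
  exact coe_mem_classBlock.1 (h ▸ coe_mem_classBlock.2 rfl)

theorem card_classBlock {I : Finset ι} (t : Setoid I) (a : I) :
    (classBlock t (Quotient.mk t a)).card = {b | t a b}.ncard := by
  classical
  rw [classBlock, Finset.card_map, ← Set.ncard_coe_finset]
  congr 1
  ext b
  simp only [Finset.coe_filter, Finset.mem_univ, true_and, Set.mem_ofPred_eq]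
  exact Quotient.eq.trans ⟨t.symm, t.symm⟩

open Classical in
/-- Perfect matchings, encoded as equivalence relations on `I` or as sets of blocks. -/
theorem sum_isPairSetoid {R : Type*} [CommSemiring R] (c : Finset ι → R) (I : Finset ι) :
    ∑ t : Setoid I with IsPairSetoid t, ∏ q : Quotient t, c (classBlock t q) =
      ∑ p ∈ matchings I, ∏ b ∈ p, c b := by
  refine Finset.sum_bij (fun t _ => Finset.univ.image (classBlock t)) ?_ ?_ ?_ ?_
  · intro t ht
    have ht := (Finset.mem_filter.1 ht).2
    rw [mem_matchings]
    refine ⟨fun b hb => ?_, fun b hb => ?_, fun i hi => ?_⟩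
    · obtain ⟨q, -, rfl⟩ := Finset.mem_image.1 hb
      exact fun i hi => (mem_classBlock.1 hi).1
    · obtain ⟨q, -, rfl⟩ := Finset.mem_image.1 hb
      induction q using Quotient.inductionOn with | h a =>
      rw [card_classBlock, ht a]
    · refine ⟨classBlock t (Quotient.mk t ⟨i, hi⟩),
        ⟨Finset.mem_image_of_mem _ (Finset.mem_univ _), mem_classBlock.2 ⟨hi, rfl⟩⟩, ?_⟩
      rintro b ⟨hb, hib⟩
      obtain ⟨q, -, rfl⟩ := Finset.mem_image.1 hb
      obtain ⟨_, rfl⟩ := mem_classBlock.1 hib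
      rfl
  · intro t _ t' _ h
    have key (s s' : Setoid I) (h : Finset.univ.image (classBlock s) =
        Finset.univ.image (classBlock s')) (a b : I) (hab : s a b) : s' a b := by
      have h1 : classBlock s (Quotient.mk s a) ∈ Finset.univ.image (classBlock s') :=
        h ▸ Finset.mem_image_of_mem _ (Finset.mem_univ _)
      obtain ⟨q, -, hq⟩ := Finset.mem_image.1 h1
      have ha : Quotient.mk s' a = q := coe_mem_classBlock.1 (hq ▸ coe_mem_classBlock.2 rfl)
      have hb : Quotient.mk s' b = q :=
        coe_mem_classBlock.1 (hq ▸ coe_mem_classBlock.2 (Quotient.sound (s.symm hab)))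
      exact Quotient.exact (ha.trans hb.symm)
    exact Setoid.ext fun a b => ⟨key t t' h a b, key t' t h.symm a b⟩
  · intro p hp
    obtain ⟨h1, h2, h3⟩ := mem_matchings.1 hp
    let t : Setoid I :=
      { r := fun a b => ∃ s ∈ p, (a : ι) ∈ s ∧ (b : ι) ∈ s
        iseqv := by
          refine ⟨fun a => ?_, ?_, ?_⟩
          · obtain ⟨b, ⟨hb, hab⟩, -⟩ := h3 a a.2
            exact ⟨b, hb, hab, hab⟩
          · rintro a b ⟨s, hs, ha, hb⟩
            exact ⟨s, hs, hb, ha⟩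
          · rintro a b c ⟨s, hs, ha, hb⟩ ⟨s', hs', hb', hc⟩
            obtain rfl := (h3 b b.2).unique ⟨hs, hb⟩ ⟨hs', hb'⟩
            exact ⟨s, hs, ha, hc⟩ }
    have hblock (a : I) (s : Finset ι) (hs : s ∈ p) (ha : (a : ι) ∈ s) :
        classBlock t (Quotient.mk t a) = s := by
      ext i
      rw [mem_classBlock]
      constructor
      · rintro ⟨hi, h⟩
        obtain ⟨s', hs', hi', ha'⟩ : t ⟨i, hi⟩ a := Quotient.exact h
        rwa [(h3 a a.2).unique ⟨hs, ha⟩ ⟨hs', ha'⟩]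
      · intro hi
        exact ⟨h1 s hs hi, Quotient.sound ⟨s, hs, hi, ha⟩⟩
    refine ⟨t, Finset.mem_filter.2 ⟨Finset.mem_univ _, fun a => ?_⟩, ?_⟩
    · obtain ⟨s, ⟨hs, ha⟩, -⟩ := h3 a a.2
      rw [← card_classBlock, hblock a s hs ha, h2 s hs]
    · ext s
      simp only [Finset.mem_image, Finset.mem_univ, true_and]
      constructor
      · rintro ⟨q, rfl⟩
        induction q using Quotient.inductionOn with | h a =>
        obtain ⟨s, ⟨hs, ha⟩, -⟩ := h3 a a.2
        rwa [hblock a s hs ha]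
      · intro hs
        obtain ⟨i, hi⟩ : s.Nonempty := Finset.card_pos.1 (by rw [h2 s hs]; norm_num)
        exact ⟨_, hblock ⟨i, h1 s hs hi⟩ s hs hi⟩
  · intro t _
    rw [Finset.prod_image fun _ _ _ _ h => classBlock_injective t h]

variable {X : Type*} [MeasurableSpace X] {lam : Measure X}

/-- The integral belonging to a partition factorizes over its blocks. -/
theorem integral_pairProd [SigmaFinite lam] (h : ι → X → ℝ) (I : Finset ι) (t : Setoid I) :
    ∫ y, pairProd (fun i : I => h i) t y ∂(Measure.pi fun _ => lam) =
      ∏ q : Quotient t, ∫ x, ∏ i ∈ classBlock t q, h i x ∂lam := by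
  classical
  rw [← integral_fintype_prod_eq_prod]
  refine integral_congr_ae (ae_of_all _ fun y => ?_)
  rw [pairProd, ← Finset.prod_fiberwise Finset.univ fun i : I => Quotient.mk t i]
  refine Finset.prod_congr rfl fun q _ => ?_
  rw [classBlock, Finset.prod_map]
  refine Finset.prod_congr (by ext; simp) fun i hi => ?_
  rw [(Finset.mem_filter.1 hi).2]
  rfl

/-- The mixed moment of a centred Gaussian family with covariances `∫ hᵢ hⱼ dλ`, written as a sum
over the perfect matchings of the index set. -/
noncomputable def pairMoment (lam : Measure X) (h : ι → X → ℝ) (I : Finset ι) : ℝ :=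
  ∑ p ∈ matchings I, ∏ b ∈ p, ∫ x, ∏ i ∈ b, h i x ∂lam

open Classical in
theorem sum_integral_pairProd [SigmaFinite lam] (h : ι → X → ℝ) (I : Finset ι) :
    ∑ t : Setoid I with IsPairSetoid t,
      ∫ y, pairProd (fun i : I => h i) t y ∂(Measure.pi fun _ => lam) = pairMoment lam h I := by
  simp only [integral_pairProd]
  exact sum_isPairSetoid (fun b => ∫ x, ∏ i ∈ b, h i x ∂lam) I

/-- A Gaussian family has no joint cumulants of order three or higher. -/
theorem cumulantOf_pairMoment [DecidableEq ι] [Fintype ι] (h : ι → X → ℝ) (i₀ : ι) (hι : 3 ≤ Fintype.card ι) :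
    cumulantOf (fun I => (pairMoment lam h I : ℂ)) i₀ Finset.univ = 0 := by
  rw [cumulantOf_of_wick _ i₀ (fun j => ((∫ x, ∏ i ∈ {i₀, j}, h i x ∂lam : ℝ) : ℂ)) ?_ ?_ _
    (Finset.mem_univ _)]
  · refine Finset.sum_eq_zero fun j _ => if_neg fun heq => ?_
    have h1 := Finset.card_le_two (a := i₀) (b := j)
    rw [← heq, Finset.card_univ] at h1
    omega
  · simp [pairMoment, matchings_empty]
  · intro I hI
    simp only [pairMoment]
    rw [sum_matchings _ hI]
    push_cast
    refine Finset.sum_congr ?_ fun _ _ => rfl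
    ext j
    simp

end Wick

/-! ### Partitions of the index set as equivalence relations -/

section Partitions

variable {ℓ : ℕ} {n : Fin ℓ → ℕ} {L X : Type*} [MeasurableSpace X] {lam : Measure X}
  [SigmaFinite lam]

/-- The blocks of a partition are the classes of an equivalence relation on a set `L` of
representatives. -/
noncomputable def partsEquiv (σ : RowPartition n) {φ : L → RowIndex n}
    (hφ : Function.Surjective φ) {t : Setoid L}
    (ht : ∀ a b, t a b ↔ σ.part (φ a) = σ.part (φ b)) : Quotient t ≃ σ.parts :=
  Equiv.ofBijective
    (Quotient.lift (fun a => (⟨σ.part (φ a), σ.part_mem.2 (Finset.mem_univ _)⟩ : σ.parts))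
      fun a b h => Subtype.ext ((ht a b).1 h)) <| by
    refine ⟨fun p q => ?_, fun ⟨b, hb⟩ => ?_⟩
    · induction p, q using Quotient.inductionOn₂ with | h a b =>
      exact fun h => Quotient.sound ((ht a b).2 (congrArg Subtype.val h))
    · obtain ⟨a, -, ha⟩ := σ.part_surjOn hb
      obtain ⟨c, rfl⟩ := hφ a
      exact ⟨Quotient.mk t c, Subtype.ext ha⟩

theorem identify_piCongrLeft_partsEquiv (σ : RowPartition n) {φ : L → RowIndex n}
    (hφ : Function.Surjective φ) {t : Setoid L}
    (ht : ∀ a b, t a b ↔ σ.part (φ a) = σ.part (φ b)) (ψ : RowIndex n → L)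
    (hψ : ∀ a, φ (ψ a) = a) (h : (RowIndex n → X) → ℝ) (y : Quotient t → X) :
    identify σ h (MeasurableEquiv.piCongrLeft (fun _ => X) (partsEquiv σ hφ ht) y) =
      h fun a => y (Quotient.mk t (ψ a)) := by
  rw [identify]
  congr 1
  funext a
  have : (⟨σ.part a, σ.part_mem.2 (Finset.mem_univ a)⟩ : σ.parts) =
      partsEquiv σ hφ ht (Quotient.mk t (ψ a)) := Subtype.ext (by
    change _ = σ.part (φ (ψ a))
    rw [hψ])
  rw [this, MeasurableEquiv.coe_piCongrLeft, Equiv.piCongrLeft_apply_apply]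

theorem integrable_identify_iff [Finite L] (σ : RowPartition n) {φ : L → RowIndex n}
    (hφ : Function.Surjective φ) {t : Setoid L}
    (ht : ∀ a b, t a b ↔ σ.part (φ a) = σ.part (φ b)) (ψ : RowIndex n → L)
    (hψ : ∀ a, φ (ψ a) = a) (h : (RowIndex n → X) → ℝ) :
    Integrable (identify σ h) (Measure.pi fun _ => lam) ↔
      Integrable (fun y : Quotient t → X => h fun a => y (Quotient.mk t (ψ a)))
        (Measure.pi fun _ => lam) := by
  rw [← (measurePreserving_piCongrLeft (fun _ => lam) (partsEquiv σ hφ ht)).integrable_comp_emb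
    (MeasurableEquiv.measurableEmbedding _)]
  exact iff_of_eq (congrArg (Integrable · _)
    (funext fun y => identify_piCongrLeft_partsEquiv σ hφ ht ψ hψ h y))

theorem integral_identify [Finite L] (σ : RowPartition n) {φ : L → RowIndex n}
    (hφ : Function.Surjective φ) {t : Setoid L}
    (ht : ∀ a b, t a b ↔ σ.part (φ a) = σ.part (φ b)) (ψ : RowIndex n → L)
    (hψ : ∀ a, φ (ψ a) = a) (h : (RowIndex n → X) → ℝ) :
    ∫ y, identify σ h y ∂(Measure.pi fun _ => lam) =
      ∫ y : Quotient t → X, h (fun a => y (Quotient.mk t (ψ a))) ∂(Measure.pi fun _ => lam) := by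
  rw [← (measurePreserving_piCongrLeft (fun _ => lam) (partsEquiv σ hφ ht)).integral_comp
    (MeasurableEquiv.measurableEmbedding _)]
  exact integral_congr_ae (ae_of_all _ fun y =>
    identify_piCongrLeft_partsEquiv σ hφ ht ψ hψ h y)

/-- The integrability assumption for partitions of the index set, in terms of equivalence
relations. -/
theorem integrable_rowProd_of_nonflat (f : ∀ i, (Fin (n i) → X) → ℝ) (hf : ∀ i, Measurable (f i))
    (hint : ∀ σ ∈ nonflatPartitions n,
      Integrable (identify σ (tensor fun i x => |f i x|)) (Measure.pi fun _ => lam))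
    (s : RowSetoid n) : Integrable (rowProd f s.1) (Measure.pi fun _ => lam) := by
  classical
  have hrel (a b : RowIndex n) : b ∈ (Finpartition.ofSetoid s.1).part a ↔ s.1 a b :=
    Finpartition.mem_part_ofSetoid_iff_rel
  have hs (a b : RowIndex n) : s.1 a b ↔
      (Finpartition.ofSetoid s.1).part a = (Finpartition.ofSetoid s.1).part b := by
    rw [← Finpartition.mem_part_iff_part_eq_part _ (Finset.mem_univ a) (Finset.mem_univ b), hrel]
    exact ⟨s.1.symm, s.1.symm⟩
  have hmem : Finpartition.ofSetoid s.1 ∈ nonflatPartitions n := by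
    refine Finset.mem_filter.2 ⟨Finset.mem_univ _, fun i b hb => Finset.card_le_one.2 ?_⟩
    rintro ⟨k, j⟩ hj ⟨k', j'⟩ hj'
    obtain ⟨hj, hjb⟩ := Finset.mem_inter.1 hj
    obtain ⟨hj', hjb'⟩ := Finset.mem_inter.1 hj'
    obtain rfl : k = i := (Finset.mem_filter.1 hj).2
    obtain rfl : k' = k := (Finset.mem_filter.1 hj').2
    have h1 := (Finpartition.part_eq_of_mem _ hb hjb).trans
      (Finpartition.part_eq_of_mem _ hb hjb').symm
    rw [s.2 _ _ _ ((hs _ _).2 h1)]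
  have h := (integrable_identify_iff _ Function.surjective_id hs id (fun _ => rfl) _).1
    (hint _ hmem)
  refine h.mono' ?_ (ae_of_all _ fun y => ?_)
  · refine (Finset.measurable_fun_prod _ fun i _ => (hf i).comp ?_).aestronglyMeasurable
    exact measurable_pi_lambda _ fun j => measurable_pi_apply _
  · exact (Finset.abs_prod _ _).le

end Partitions

section Pairs

variable {ℓ : ℕ} {X : Type*} [MeasurableSpace X] {lam : Measure X} [SigmaFinite lam]

/-- A partition of the index set with rows of length one, as an equivalence relation on the set of
rows. -/
def rowSetoidOne (σ : RowPartition fun _ : Fin ℓ => 1) : Setoid (Fin ℓ) :=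
  Setoid.ker fun i => σ.part ⟨i, 0⟩

theorem surjective_sigma_zero :
    Function.Surjective fun i : Fin ℓ => (⟨i, 0⟩ : RowIndex fun _ : Fin ℓ => 1) := fun ⟨i, j⟩ =>
  ⟨i, by rw [Subsingleton.elim j 0]⟩

theorem sigma_zero_fst (a : RowIndex fun _ : Fin ℓ => 1) :
    (⟨a.1, 0⟩ : RowIndex fun _ : Fin ℓ => 1) = a := by
  obtain ⟨i, j⟩ := a
  rw [Subsingleton.elim j 0]

theorem integrable_identify_pair_iff (σ : RowPartition fun _ : Fin ℓ => 1)
    (h : Fin ℓ → (Fin 1 → X) → ℝ) :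
    Integrable (identify σ (tensor h)) (Measure.pi fun _ => lam) ↔
      Integrable (pairProd (fun i x => h i fun _ => x) (rowSetoidOne σ))
        (Measure.pi fun _ => lam) :=
  integrable_identify_iff σ surjective_sigma_zero (fun _ _ => Iff.rfl) Sigma.fst sigma_zero_fst _

theorem integral_identify_pair (σ : RowPartition fun _ : Fin ℓ => 1)
    (h : Fin ℓ → (Fin 1 → X) → ℝ) :
    ∫ y, identify σ (tensor h) y ∂(Measure.pi fun _ => lam) =
      ∫ y, pairProd (fun i x => h i fun _ => x) (rowSetoidOne σ) y ∂(Measure.pi fun _ => lam) :=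
  integral_identify σ surjective_sigma_zero (fun _ _ => Iff.rfl) Sigma.fst sigma_zero_fst _

theorem card_part_eq_ncard (σ : RowPartition fun _ : Fin ℓ => 1) (i : Fin ℓ) :
    (σ.part ⟨i, 0⟩).card = {j | rowSetoidOne σ i j}.ncard := by
  rw [← Set.ncard_coe_finset]
  symm
  refine Set.ncard_congr (fun j _ => ⟨j, 0⟩) (fun j hj => ?_) (fun j j' _ _ h => ?_)
    fun a ha => ?_
  · have hj : σ.part ⟨i, 0⟩ = σ.part ⟨j, 0⟩ := hj
    rw [hj]
    exact σ.mem_part (Finset.mem_univ _)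
  · exact (Sigma.mk.inj h).1
  · refine ⟨a.1, ?_, sigma_zero_fst a⟩
    have : σ.part a = σ.part ⟨i, 0⟩ :=
      (σ.mem_part_iff_part_eq_part (Finset.mem_univ _) (Finset.mem_univ _)).1 ha
    rw [← sigma_zero_fst a] at this
    exact this.symm

open Classical in
theorem sum_pairPartitions (G : Setoid (Fin ℓ) → ℝ) :
    ∑ σ ∈ pairPartitions (fun _ : Fin ℓ => 1), G (rowSetoidOne σ) =
      ∑ t : Setoid (Fin ℓ) with IsPairSetoid t, G t := by
  refine Finset.sum_bij (fun σ _ => rowSetoidOne σ) (fun σ hσ => ?_) (fun σ _ σ' _ h => ?_)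
    (fun t ht => ?_) fun _ _ => rfl
  · refine Finset.mem_filter.2 ⟨Finset.mem_univ _, fun i => ?_⟩
    rw [← card_part_eq_ncard]
    exact (Finset.mem_filter.1 hσ).2 _ (σ.part_mem.2 (Finset.mem_univ _))
  · have key (i j : Fin ℓ) : σ.part ⟨i, 0⟩ = σ.part ⟨j, 0⟩ ↔ σ'.part ⟨i, 0⟩ = σ'.part ⟨j, 0⟩ :=
      iff_of_eq (congrArg (fun t : Setoid (Fin ℓ) => t i j) h)
    have hpart (a : RowIndex fun _ : Fin ℓ => 1) : σ.part a = σ'.part a := by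
      ext b
      rw [σ.mem_part_iff_part_eq_part (Finset.mem_univ _) (Finset.mem_univ _),
        σ'.mem_part_iff_part_eq_part (Finset.mem_univ _) (Finset.mem_univ _),
        ← sigma_zero_fst a, ← sigma_zero_fst b]
      exact key _ _
    have hsub (τ τ' : RowPartition fun _ : Fin ℓ => 1) (h : ∀ a, τ.part a = τ'.part a) :
        τ.parts ⊆ τ'.parts := fun b hb => by
      obtain ⟨a, -, ha⟩ := τ.part_surjOn hb
      rw [← ha, h]
      exact τ'.part_mem.2 (Finset.mem_univ _)
    exact Finpartition.ext ((hsub _ _ hpart).antisymm (hsub _ _ fun a => (hpart a).symm))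
  · have ht := (Finset.mem_filter.1 ht).2
    let s : Setoid (RowIndex fun _ : Fin ℓ => 1) := t.comap Sigma.fst
    have hs : rowSetoidOne (Finpartition.ofSetoid s) = t := Setoid.ext fun i j => by
      change (Finpartition.ofSetoid s).part ⟨i, 0⟩ = (Finpartition.ofSetoid s).part ⟨j, 0⟩ ↔ _
      rw [← Finpartition.mem_part_iff_part_eq_part _ (Finset.mem_univ _) (Finset.mem_univ _),
        Finpartition.mem_part_ofSetoid_iff_rel]
      exact ⟨t.symm, t.symm⟩
    refine ⟨Finpartition.ofSetoid s, ?_, hs⟩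
    refine Finset.mem_filter.2 ⟨Finset.mem_filter.2 ⟨Finset.mem_univ _, fun i b _ => ?_⟩,
      fun b hb => ?_⟩
    · refine Finset.card_le_one.2 fun a ha a' ha' => ?_
      have h1 : a.1 = i := (Finset.mem_filter.1 (Finset.mem_inter.1 ha).1).2
      have h2 : a'.1 = i := (Finset.mem_filter.1 (Finset.mem_inter.1 ha').1).2
      rw [← sigma_zero_fst a, ← sigma_zero_fst a', h1, h2]
    · obtain ⟨a, -, ha⟩ := (Finpartition.ofSetoid s).part_surjOn hb
      rw [← ha, ← sigma_zero_fst a, card_part_eq_ncard, hs]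
      exact ht _

end Pairs

/-! ### Moments of centred Poisson U-statistics -/

section UStatistics

variable {X Ω : Type*} [MeasurableSpace X] [MeasurableSpace Ω] {P : Measure Ω}
  {lam : Measure X} [SigmaFinite lam]

/-- The one-dimensional projection of a kernel that vanishes almost everywhere. -/
theorem projKernel_one_ae_eq_zero {m : ℕ} (hm : 1 ≤ m) {f : (Fin m → X) → ℝ}
    (hf : f =ᵐ[Measure.pi fun _ => lam] 0) :
    ∀ᵐ x ∂lam, projKernel lam f 1 (fun _ => x) = 0 := by
  obtain ⟨k, rfl⟩ : ∃ k, m = k + 1 := ⟨m - 1, by omega⟩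
  have h1 := (measurePreserving_piFinSuccAbove (fun _ : Fin (k + 1) => lam) 0).symm
    |>.quasiMeasurePreserving.ae hf
  filter_upwards [Measure.ae_ae_of_ae_prod h1] with x hx
  rw [projKernel_one_eq]
  refine mul_eq_zero_of_right _ (integral_eq_zero_of_ae (hx.mono fun z hz => ?_))
  refine Eq.trans (congrArg f (funext fun j => ?_)) hz
  cases j using Fin.cases with
  | zero => rfl
  | succ j => rfl

theorem integral_pairProd_eq_zero {L : Type*} [Fintype L] {h : L → X → ℝ} {i : L} (hi : ∀ᵐ x ∂lam, h i x = 0)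
    (t : Setoid L) : ∫ y, pairProd h t y ∂(Measure.pi fun _ => lam) = 0 := by
  refine integral_eq_zero_of_ae ?_
  filter_upwards [(Measure.quasiMeasurePreserving_eval (fun _ => lam) (Quotient.mk t i)).ae hi]
    with y hy
  exact Finset.prod_eq_zero (Finset.mem_univ i) hy

/-- A U-statistic whose kernel vanishes almost everywhere vanishes almost surely. -/
theorem IsPoissonSum.integral_facPi_eq_zero {κ : Ω → ℕ → Measure X}
    (h : IsPoissonSum P κ lam) {m : ℕ} {f : (Fin m → X) → ℝ}
    (hf : f =ᵐ[Measure.pi fun _ => lam] 0) :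
    ∀ᵐ ω ∂P, ∫ x, f x ∂(facPi (κ ω) (Fin m)) = 0 := by
  have habs : (fun x => |f x|) =ᵐ[Measure.pi fun _ => lam] 0 := hf.mono fun x hx => by simp [hx]
  obtain ⟨-, h2, h3⟩ := h.integrable_facPi (G := fun x => |f x|)
    ((integrable_zero _ _ _).congr habs.symm)
  rw [integral_congr_ae habs] at h3
  simp only [Pi.zero_apply, integral_zero] at h3
  filter_upwards [(integral_eq_zero_iff_of_nonneg
    (fun ω => integral_nonneg fun x => abs_nonneg _) h2).1 h3] with ω hω
  exact abs_nonpos_iff.1 ((abs_integral_le_integral_abs).trans hω.le)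

theorem IsPoissonSum.centred_uStat {κ : Ω → ℕ → Measure X} {η : Ω → Measure X}
    (h : IsPoissonSum P κ lam) (he : ∀ᵐ ω ∂P, η ω = Measure.sum (κ ω)) (c : ℝ) {m : ℕ}
    {f : (Fin m → X) → ℝ} (hf : Integrable f (Measure.pi fun _ => lam)) :
    (∀ᵐ ω ∂P, Integrable f (factorialMeasure (η ω) m)) ∧ Integrable (uStat c f η) P ∧
    centred P (uStat c f η) =ᵐ[P] fun ω =>
      c * (∫ x, f x ∂(facPi (κ ω) (Fin m)) - ∫ x, f x ∂(Measure.pi fun _ => lam)) := by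
  have := h.zeroOne
  obtain ⟨h1, h2, h3⟩ := h.integrable_facPi hf
  have hfac : ∀ᵐ ω ∂P, factorialMeasure (η ω) m = facPi (κ ω) (Fin m) := he.mono fun ω hω => by
    rw [hω, factorialMeasure_sum]
  have hU : uStat c f η =ᵐ[P] fun ω => c * ∫ x, f x ∂(facPi (κ ω) (Fin m)) :=
    hfac.mono fun ω hω => by rw [uStat, hω]
  refine ⟨?_, (h2.const_mul c).congr hU.symm, hU.mono fun ω hω => ?_⟩
  · filter_upwards [hfac, h1] with ω hω h1ω
    rwa [hω]
  · rw [centred, hω, integral_congr_ae hU, integral_const_mul, h3]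
    exact (mul_sub _ _ _).symm

variable [IsProbabilityMeasure P] {η : ℝ → Ω → Measure X} {L : Type*} [Fintype L] {n : L → ℕ}

open Classical in
/-- The mixed central moments of Poisson U-statistics, none of whose kernels vanishes. -/
theorem integral_prod_centred {t : ℝ} {η : Ω → Measure X}
    (hη : IsPoissonProcess P η (ENNReal.ofReal t • lam)) (c : L → ℝ)
    (f : ∀ i, (Fin (n i) → X) → ℝ) (hf : ∀ i, IsSymmL1 lam (f i))
    (h0 : ∀ i, ¬ f i =ᵐ[Measure.pi fun _ => lam] 0)
    (hint : ∀ s : RowSetoid n, Integrable (rowProd f s.1) (Measure.pi fun _ => lam)) :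
    Integrable (fun ω => ∏ i, centred P (uStat (c i) (f i) η) ω) P ∧
    ∫ ω, ∏ i, centred P (uStat (c i) (f i) η) ω ∂P =
      (∏ i, c i) * ∑ s : RowSetoid n with ∀ i, ¬ IsSingletonRow s.1 i,
        ∫ y, rowProd f s.1 y ∂(Measure.pi fun _ => ENNReal.ofReal t • lam) := by
  obtain ⟨κ, h, he⟩ := hη.exists_isPoissonSum
  obtain ⟨h1, h2⟩ := h.integral_prod_sub f (fun i => (hf i).measurable) fun J s =>
    integrable_pi_ofReal_smul t (integrable_rowProd_sub f h0 hint (fun i => (hf i).integrable) J s)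
  have hae : (fun ω => ∏ i, centred P (uStat (c i) (f i) η) ω) =ᵐ[P] fun ω =>
      (∏ i, c i) * ∏ i, (∫ x, f i x ∂(facPi (κ ω) (Fin (n i))) -
        ∫ x, f i x ∂(Measure.pi fun _ => ENNReal.ofReal t • lam)) := by
    filter_upwards [ae_all_iff.2 fun i => (h.centred_uStat he (c i)
      (integrable_pi_ofReal_smul t (hf i).integrable)).2.2] with ω hω
    rw [← Finset.prod_mul_distrib]
    exact Finset.prod_congr rfl fun i _ => hω i
  exact ⟨(h1.const_mul _).congr hae.symm, by
    rw [integral_congr_ae hae, integral_const_mul, h2]⟩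

open Classical in
theorem tendsto_integral_prod_centred
    (hη : ∀ t : ℝ, 0 < t → IsPoissonProcess P (η t) (ENNReal.ofReal t • lam))
    (hn : ∀ i, 1 ≤ n i) (g : L → ℝ → ℝ) (hg : ∀ i, ∀ᶠ t in atTop, g i t ≠ 0)
    (f : ∀ i, (Fin (n i) → X) → ℝ) (hf : ∀ i, IsSymmL1 lam (f i))
    (h0 : ∀ i, ¬ f i =ᵐ[Measure.pi fun _ => lam] 0)
    (hint : ∀ s : RowSetoid n, Integrable (rowProd f s.1) (Measure.pi fun _ => lam)) :
    Tendsto (fun t : ℝ => ∫ ω, ∏ i, (centred P (uStat (g i t) (f i) (η t)) ω /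
        (g i t * t ^ ((n i : ℝ) - 1 / 2))) ∂P) atTop
      (𝓝 (∑ t : Setoid L with IsPairSetoid t,
        ∫ y, pairProd (fun i x => projKernel lam (f i) 1 fun _ => x) t y
          ∂(Measure.pi fun _ => lam))) := by
  refine (tendsto_sum_rowProd hn f hf hint).congr' ?_
  filter_upwards [eventually_gt_atTop 0, eventually_all.2 hg] with t ht hgt
  simp only [Finset.prod_div_distrib, Finset.prod_mul_distrib]
  rw [integral_div, (integral_prod_centred (hη t ht) (fun i => g i t) f hf h0 hint).2,
    mul_div_mul_left _ _ (Finset.prod_ne_zero_iff.2 fun i _ => hgt i)]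

/-- The normalized joint cumulants tend to the joint cumulants of a Gaussian family. -/
theorem tendsto_jointCumulant {ℓ : ℕ} (hℓ : 3 ≤ ℓ)
    (hη : ∀ t : ℝ, 0 < t → IsPoissonProcess P (η t) (ENNReal.ofReal t • lam))
    {m : Fin ℓ → ℕ} (hm : ∀ i, 1 ≤ m i) (g : Fin ℓ → ℝ → ℝ) (hg : ∀ i, ∀ᶠ t in atTop, g i t ≠ 0)
    (f : ∀ i, (Fin (m i) → X) → ℝ) (hf : ∀ i, IsSymmL1 lam (f i))
    (h0 : ∀ i, ¬ f i =ᵐ[Measure.pi fun _ => lam] 0)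
    (hint : ∀ s : RowSetoid m, Integrable (rowProd f s.1) (Measure.pi fun _ => lam)) :
    Tendsto (fun t : ℝ => jointCumulant P (fun i => centred P (uStat (g i t) (f i) (η t))) /
        ((∏ i, (g i t * t ^ ((m i : ℝ) - 1 / 2)) : ℝ) : ℂ)) atTop (𝓝 0) := by
  obtain ⟨k, rfl⟩ : ∃ k, ℓ = k + 1 := ⟨ℓ - 1, by omega⟩
  set h : Fin (k + 1) → X → ℝ := fun i x => projKernel lam (f i) 1 fun _ => x
  have hsub (I : Finset (Fin (k + 1))) (s : RowSetoid fun i : I => m i) :=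
    integrable_rowProd_sub f h0 hint (fun i => (hf i).integrable) I s
  have hmom (I : Finset (Fin (k + 1))) : Tendsto
      (fun t : ℝ => ∫ ω, ∏ i ∈ I, (centred P (uStat (g i t) (f i) (η t)) ω /
        (g i t * t ^ ((m i : ℝ) - 1 / 2))) ∂P) atTop (𝓝 (pairMoment lam h I)) := by
    have := tendsto_integral_prod_centred (L := I) hη (fun i => hm i) (fun i => g i)
      (fun i => hg i) (fun i => f i) (fun i => hf i) (fun i => h0 i) (hsub I)
    rw [← sum_integral_pairProd]
    refine this.congr fun t => integral_congr_ae (ae_of_all _ fun ω => ?_)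
    exact Finset.prod_coe_sort I fun i => centred P (uStat (g i t) (f i) (η t)) ω /
        (g i t * t ^ ((m i : ℝ) - 1 / 2))
  have hlim := tendsto_cumulantOf (M := fun (t : ℝ) I =>
      ((∫ ω, ∏ i ∈ I, (centred P (uStat (g i t) (f i) (η t)) ω /
        (g i t * t ^ ((m i : ℝ) - 1 / 2))) ∂P : ℝ) : ℂ))
    (fun I => (Complex.continuous_ofReal.tendsto _).comp (hmom I))
    (by simp [pairMoment, matchings_empty]) (Fin.last k) Finset.univ
  rw [cumulantOf_pairMoment h _ (by simpa using hℓ)] at hlim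
  refine hlim.congr' ?_
  filter_upwards [eventually_gt_atTop 0] with t ht
  obtain ⟨κ, hκ, he⟩ := (hη t ht).exists_isPoissonSum
  rw [jointCumulant_eq (fun i => ?_) fun I => ?_]
  · have hmul : (fun I : Finset (Fin (k + 1)) =>
        ((∫ ω, ∏ i ∈ I, (centred P (uStat (g i t) (f i) (η t)) ω /
          (g i t * t ^ ((m i : ℝ) - 1 / 2))) ∂P : ℝ) : ℂ)) = fun I =>
        (∏ i ∈ I, (((g i t * t ^ ((m i : ℝ) - 1 / 2))⁻¹ : ℝ) : ℂ)) *
          ((∫ ω, ∏ i ∈ I, centred P (uStat (g i t) (f i) (η t)) ω ∂P : ℝ) : ℂ) := by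
      funext I
      rw [← Complex.ofReal_prod, ← Complex.ofReal_mul, ← integral_const_mul]
      simp only [div_eq_mul_inv, Finset.prod_mul_distrib, mul_comm]
    rw [hmul, cumulantOf_prod_mul, ← Complex.ofReal_prod, Finset.prod_inv_distrib,
      Complex.ofReal_inv, mul_comm, ← div_eq_mul_inv]
  · exact ((hκ.centred_uStat he _ (integrable_pi_ofReal_smul t (hf i).integrable)).2.1.sub
      (integrable_const _)).1
  · refine (integral_prod_centred (L := I) (hη t ht) (fun i => g i t) (fun i => f i)
      (fun i => hf i) (fun i => h0 i) (hsub I)).1.congr (ae_of_all _ fun ω => ?_)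
    exact Finset.prod_coe_sort I fun i => centred P (uStat (g i t) (f i) (η t)) ω

end UStatistics

/-! ### The limit theorem -/

theorem mainTheorem3
    {X Ω : Type*} [MeasurableSpace X] [MeasurableSpace Ω]
    (lam : Measure X) [SigmaFinite lam]
    (P : Measure Ω) [IsProbabilityMeasure P]
    (η : ℝ → Ω → Measure X)
    (hη : ∀ t : ℝ, 0 < t → IsPoissonProcess P (η t) (ENNReal.ofReal t • lam))
    (ℓ : ℕ) (hℓ : 1 ≤ ℓ)
    (m : Fin ℓ → ℕ) (hm : ∀ i, 1 ≤ m i)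
    (f : ∀ i, (Fin (m i) → X) → ℝ) (hf : ∀ i, IsSymmL1 lam (f i))
    (g : Fin ℓ → ℝ → ℝ) (hg : ∀ i, ∀ᶠ t in atTop, g i t ≠ 0)
    (hint : ∀ σ ∈ nonflatPartitions m,
      Integrable (identify σ (tensor fun i x => |f i x|)) (Measure.pi fun _ => lam)) :
    -- the random variables, expectations and integrals involved are well defined
    (∀ t : ℝ, 0 < t →
      (∀ i, ∀ᵐ ω ∂P, Integrable (f i) (factorialMeasure (η t ω) (m i))) ∧
      (∀ i, Integrable (uStat (g i t) (f i) (η t)) P) ∧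
      Integrable (fun ω => ∏ i, centred P (uStat (g i t) (f i) (η t)) ω) P ∧
      ((∀ i, ¬ f i =ᵐ[Measure.pi fun _ => lam] 0) → ∀ I : Finset (Fin ℓ),
        Integrable (fun ω => ∏ i ∈ I, centred P (uStat (g i t) (f i) (η t)) ω) P)) ∧
    (∀ σ ∈ pairPartitions (fun _ : Fin ℓ => 1),
      Integrable (identify σ (tensor fun i => projKernel lam (f i) 1))
        (Measure.pi fun _ => lam)) ∧
    -- the limit of the mixed moments
    Tendsto
      (fun t : ℝ => ∫ ω, ∏ i, (centred P (uStat (g i t) (f i) (η t)) ω /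
        (g i t * t ^ ((m i : ℝ) - 1 / 2))) ∂P)
      atTop
      (𝓝 (∑ σ ∈ pairPartitions (fun _ : Fin ℓ => 1),
        ∫ y, identify σ (tensor fun i => projKernel lam (f i) 1) y ∂(Measure.pi fun _ => lam))) ∧
    -- the limit of the joint cumulants
    (3 ≤ ℓ →
      Tendsto
        (fun t : ℝ => jointCumulant P (fun i => centred P (uStat (g i t) (f i) (η t))) /
          ((∏ i, (g i t * t ^ ((m i : ℝ) - 1 / 2)) : ℝ) : ℂ))
        atTop (𝓝 0)) := by
  classical
  have hint' := integrable_rowProd_of_nonflat f (fun i => (hf i).measurable) hint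
  have hκ (t : ℝ) (ht : 0 < t) := (hη t ht).exists_isPoissonSum
  have hc (t : ℝ) (ht : 0 < t) (i : Fin ℓ) :
      (∀ᵐ ω ∂P, Integrable (f i) (factorialMeasure (η t ω) (m i))) ∧
      Integrable (uStat (g i t) (f i) (η t)) P := by
    obtain ⟨κ, h, he⟩ := hκ t ht
    have := h.centred_uStat he (g i t) (integrable_pi_ofReal_smul t (hf i).integrable)
    exact ⟨this.1, this.2.1⟩
  have hlimit : ∑ σ ∈ pairPartitions (fun _ : Fin ℓ => 1),
      ∫ y, identify σ (tensor fun i => projKernel lam (f i) 1) y ∂(Measure.pi fun _ => lam) =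
      ∑ t : Setoid (Fin ℓ) with IsPairSetoid t,
        ∫ y, pairProd (fun i x => projKernel lam (f i) 1 fun _ => x) t y
          ∂(Measure.pi fun _ => lam) := by
    simp only [integral_identify_pair]
    exact sum_pairPartitions fun t => ∫ y,
      pairProd (fun i x => projKernel lam (f i) 1 fun _ => x) t y ∂(Measure.pi fun _ => lam)
  have hpair : ∀ σ ∈ pairPartitions (fun _ : Fin ℓ => 1),
      Integrable (identify σ (tensor fun i => projKernel lam (f i) 1))
        (Measure.pi fun _ => lam) := fun σ _ =>
    (integrable_identify_pair_iff σ _).2 (integrable_pairProd_projKernel hm _ f hf hint')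
  rw [hlimit]
  by_cases h0 : ∀ i, ¬ f i =ᵐ[Measure.pi fun _ => lam] 0
  · have hprod (t : ℝ) (ht : 0 < t) (I : Finset (Fin ℓ)) :
        Integrable (fun ω => ∏ i ∈ I, centred P (uStat (g i t) (f i) (η t)) ω) P := by
      refine (integral_prod_centred (L := I) (hη t ht) (fun i => g i t) (fun i => f i)
        (fun i => hf i) (fun i => h0 i)
        (integrable_rowProd_sub f h0 hint' (fun i => (hf i).integrable) I)).1.congr
        (ae_of_all _ fun ω => ?_)
      exact Finset.prod_coe_sort I fun i => centred P (uStat (g i t) (f i) (η t)) ω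
    exact ⟨fun t ht => ⟨fun i => (hc t ht i).1, fun i => (hc t ht i).2,
      hprod t ht Finset.univ, fun _ => hprod t ht⟩, hpair,
      tendsto_integral_prod_centred hη hm g hg f hf h0 hint',
      fun hℓ3 => tendsto_jointCumulant hℓ3 hη hm g hg f hf h0 hint'⟩
  · -- One of the U-statistics vanishes almost surely, and so do all quantities in question.
    push Not at h0
    obtain ⟨i, hi⟩ := h0
    have hzero (t : ℝ) (ht : 0 < t) :
        ∀ᵐ ω ∂P, centred P (uStat (g i t) (f i) (η t)) ω = 0 := by
      obtain ⟨κ, h, he⟩ := hκ t ht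
      have hi' : f i =ᵐ[Measure.pi fun _ => ENNReal.ofReal t • lam] 0 := by
        rw [pi_ofReal_smul]
        exact Measure.ae_smul_measure hi _
      filter_upwards [h.integral_facPi_eq_zero hi', (h.centred_uStat he (g i t)
        (integrable_pi_ofReal_smul t (hf i).integrable)).2.2] with ω h1 h2
      rw [h2, h1, integral_congr_ae hi']
      simp
    refine ⟨fun t ht => ⟨fun i => (hc t ht i).1, fun i => (hc t ht i).2, ?_,
      fun h => absurd hi (h i)⟩, hpair, ?_, fun _ => ?_⟩
    · refine (integrable_zero _ _ _).congr ((hzero t ht).mono fun ω hω => ?_)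
      exact (Finset.prod_eq_zero (Finset.mem_univ i) hω).symm
    · rw [Finset.sum_eq_zero fun t _ =>
        integral_pairProd_eq_zero (projKernel_one_ae_eq_zero (hm i) hi) t]
      refine tendsto_const_nhds.congr' ?_
      filter_upwards [eventually_gt_atTop 0] with t ht
      symm
      refine integral_eq_zero_of_ae ((hzero t ht).mono fun ω hω => ?_)
      exact Finset.prod_eq_zero (Finset.mem_univ i) (by rw [hω, zero_div])
    · refine tendsto_const_nhds.congr' ?_
      filter_upwards [eventually_gt_atTop 0] with t ht
      rw [jointCumulant_eq_zero (hzero t ht), zero_div]
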